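/- There are a combinatorial algorithm (a single word-RAM program, independent of $n$ and of the word size), a constant $\kappa$ and a function $T$ with $$T(n)=\hat O\left(\frac{n^3}{\log^4 n}\right)$$ such that, for every $n$, every tripartite graph $G$ on $n$ vertices, given by its adjacency matrix together with its tripartition $A\cup B\cup C$, and every word size $w\ge\kappa(\lfloor\log_2 n\rfloor+1)$, the algorithm, run on a word RAM with word size $w$, decides within $T(n)$ steps whether $G$ contains a triangle. Here $T=\hat O(f)$ means that $T(n)=O\bigl(f(n)\,(\log\log f(n))^{d}\bigr)$ for some constant $d$. "Combinatorial" is understood in the following sense. When the algorithm answers that there is a triangle, it exhibits one. When it answers that there is none, it has written out the record of an exhaustive search: a list of rectangles $S_j\times T_j$ of vertex sets with no edge of $G$ between $S_j$ and $T_j$, and a list of pairs $(a,j)$, such that for all $a\in A$, $b\in B$, $c\in C$ with $ab,ac\in E(G)$ there is a listed pair $(a,j)$ with $(b,c)\in S_j\times T_j$; moreover, the cost of the search, that is $\sum_j|S_j||T_j|$ plus the number of listed pairs $(a,j)$, is at most $T(n)$. -/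

import Mathlib

/-! ## The word RAM

A machine has finitely many named registers (those its program mentions) and a memory of `2 ^ w`
cells, addressed by words; a word is a natural number below `2 ^ w`.  A program is a fixed piece of
code that depends neither on the input nor on `w`.  Every primitive instruction and every control
decision takes one step. -/

namespace WordRAM

/-- The binary operations on words. Comparisons return `0` or `1`. -/
inductive Op where
  | add | sub | mul | div | and | or | xor | shl | shr | lt | eq

/-- The result of an operation, as a `w`-bit word (arithmetic is modulo `2 ^ w`; the quotient by `0`
is `0`). -/
def Op.eval (w : ℕ) (o : Op) (a b : ℕ) : ℕ :=
  (match o with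
    | .add => a + b
    | .sub => a + 2 ^ w - b
    | .mul => a * b
    | .div => a / b
    | .and => a &&& b
    | .or => a ||| b
    | .xor => a ^^^ b
    | .shl => a <<< b
    | .shr => a >>> b
    | .lt => if a < b then 1 else 0
    | .eq => if a = b then 1 else 0) % 2 ^ w

/-- Programs. Numbers `d a b r` are names of registers. -/
inductive Cmd where
  /-- `reg d := x` for a literal constant `x` -/
  | const (d x : ℕ)
  /-- `reg d := o (reg a) (reg b)` -/
  | op (o : Op) (d a b : ℕ)
  /-- `reg d := mem (reg a)` -/
  | load (d a : ℕ)
  /-- `mem (reg a) := reg b` -/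
  | store (a b : ℕ)
  /-- append the word `reg a` to the write-only output -/
  | emit (a : ℕ)
  /-- sequential composition -/
  | seq (c₁ c₂ : Cmd)
  /-- run `c₁` if `reg r ≠ 0`, and `c₂` otherwise -/
  | cond (r : ℕ) (c₁ c₂ : Cmd)
  /-- as long as `reg r ≠ 0`, run `c` -/
  | loop (r : ℕ) (c : Cmd)

/-- The data part of a configuration: registers, memory, and the output written so far. -/
structure State where
  reg : ℕ → ℕ
  mem : ℕ → ℕ
  out : List ℕ

/-- Assign the value `v` to register `d`. -/
def State.setReg (s : State) (d v : ℕ) : State :=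
  { s with reg := Function.update s.reg d v }

/-- One step of the machine with word size `w`. The list is the code that is still to be executed;
it plays the role of a program counter: it consists of pieces of the program, and the program
bounds its length. The machine has halted when the list is empty. -/
def step (w : ℕ) : List Cmd × State → List Cmd × State
  | ([], s) => ([], s)
  | (.const d x :: k, s) => (k, s.setReg d (x % 2 ^ w))
  | (.op o d a b :: k, s) => (k, s.setReg d (o.eval w (s.reg a) (s.reg b)))
  | (.load d a :: k, s) => (k, s.setReg d (s.mem (s.reg a)))
  | (.store a b :: k, s) => (k, { s with mem := Function.update s.mem (s.reg a) (s.reg b) })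
  | (.emit a :: k, s) => (k, { s with out := s.out ++ [s.reg a] })
  | (.seq c₁ c₂ :: k, s) => (c₁ :: c₂ :: k, s)
  | (.cond r c₁ c₂ :: k, s) => if s.reg r ≠ 0 then (c₁ :: k, s) else (c₂ :: k, s)
  | (.loop r c :: k, s) => if s.reg r ≠ 0 then (c :: .loop r c :: k, s) else (k, s)

/-- The initial state: all registers are `0`, nothing has been written, and the memory holds the
input. -/
def initial (w : ℕ) (input : ℕ → ℕ) : State where
  reg _ := 0
  mem i := input i % 2 ^ w
  out := []

/-- On a machine with word size `w`, program `P` started on `input` halts in state `s` after at most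
`t` steps. -/
def HaltsWithin (w : ℕ) (P : Cmd) (input : ℕ → ℕ) (t : ℕ) (s : State) : Prop :=
  (step w)^[t] ([P], initial w input) = ([], s)

end WordRAM

/-! ## Triangle detection in tripartite graphs -/

section Triangle

variable {n : ℕ} (G : SimpleGraph (Fin n)) (part : G.Coloring (Fin 3))

open scoped Classical in
/-- A tripartite graph with vertices `0, …, n - 1` as a memory content: `n` in cell `0`, then the
part (`0`, `1` or `2`) of each vertex, then the adjacency matrix row by row, and zeros after that. -/
noncomputable def tripartiteInput (k : ℕ) : ℕ :=
  if k = 0 then n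
  else if h : k - 1 < n then (part ⟨k - 1, h⟩ : ℕ)
  else if h : k - 1 - n < n * n then
    (let e : Fin (n * n) := ⟨k - 1 - n, h⟩
     if G.Adj e.divNat e.modNat then 1 else 0)
  else 0

/-! ### Combinatorial algorithms

What separates a combinatorial algorithm from an algebraic one is that its answer rests on the
pairs and triples of vertices that it has examined, with no cancellation. A positive answer comes
with a triangle. A negative answer comes with a record of the rectangles `S × T` in which all pairs
were examined and no edge was seen, and of which of these findings was used to dismiss which
vertex of the first part. -/

/-- An entry of the record of a search. -/
inductive SearchEntry (n : ℕ) where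
  /-- all pairs in `S × T` have been examined and none is an edge -/
  | rect (S T : List (Fin n))
  /-- the `j`-th rectangle of the record (counted from `0`) is used for the vertex `a` -/
  | use (a : Fin n) (j : ℕ)

/-- The words that represent an entry. -/
def SearchEntry.encode : SearchEntry n → List ℕ
  | .rect S T => 0 :: S.length :: T.length :: (S.map Fin.val ++ T.map Fin.val)
  | .use a j => [1, a, j]

/-- The cost of an entry: each pair of a rectangle is examined once, and each use costs `1`. -/
def SearchEntry.cost : SearchEntry n → ℕ
  | .rect S T => S.length * T.length
  | .use _ _ => 1

/-- The rectangles of a record, in order. -/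
def rectangles (R : List (SearchEntry n)) : List (List (Fin n) × List (Fin n)) :=
  R.filterMap fun
    | .rect S T => some (S, T)
    | .use _ _ => none

/-- The record `R` refutes the existence of a triangle: its rectangles contain no edge, and whenever
`a` in the first part is adjacent to `b` in the second part and to `c` in the third part, one of the
rectangles used for `a` contains `(b, c)`. -/
def IsRefutation (R : List (SearchEntry n)) : Prop :=
  (∀ p ∈ rectangles R, ∀ b ∈ p.1, ∀ c ∈ p.2, ¬ G.Adj b c) ∧
  ∀ a b c : Fin n, part a = 0 → part b = 1 → part c = 2 → G.Adj a b → G.Adj a c →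
    ∃ j p, SearchEntry.use a j ∈ R ∧ (rectangles R)[j]? = some p ∧ b ∈ p.1 ∧ c ∈ p.2

/-- In the final state `s` the answer is in register `0`. The answer `1` is justified by a triangle
in registers `1, 2, 3`; the answer `0` is justified by an output that is the record of a refutation
of cost at most `t`. -/
def CombinatoriallyJustified (s : WordRAM.State) (t : ℕ) : Prop :=
  (s.reg 0 = 1 → ∃ a b c : Fin n, s.reg 1 = a ∧ s.reg 2 = b ∧ s.reg 3 = c ∧
    G.Adj a b ∧ G.Adj a c ∧ G.Adj b c) ∧
  (s.reg 0 = 0 → ∃ R : List (SearchEntry n), s.out = R.flatMap SearchEntry.encode ∧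
    IsRefutation G part R ∧ (R.map SearchEntry.cost).sum ≤ t)

end Triangle

/-- `T = Ô(f)`: up to a factor polynomial in `log log f`, `T` is `O(f)`. -/
def HatO (T : ℕ → ℕ) (f : ℕ → ℝ) : Prop :=
  ∃ d : ℕ, (fun n => (T n : ℝ)) =O[Filter.atTop] fun n => f n * Real.log (Real.log (f n)) ^ d

/-! Write `l` for the bit length of `n`, `m` for the bit length of `l`, θ = 256 m² / l and R =
2^⌊l/4⌋. The search keeps a queue of subproblems B' × C', sets of pairs from the second and third
part that have not been dismissed yet; it starts with all pairs. The area of a subproblem is x =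
|B'||C'|. A vertex is dense in it if the product of its degrees into B' and C' is at least θ² x.

If x ≥ n² / R and some vertex a is dense, all pairs in N(a) ∩ B' × N(a) ∩ C' are examined. An edge
there closes a triangle with a; otherwise this is an edgeless rectangle that may be used for every
vertex of the first part at once. The rest of B' × C' is cut into two disjoint rectangles, which
join the queue. Every other subproblem is a leaf. There each side is divided into blocks of L =
2^(3m) ≥ l³ positions, and the neighbours of a vertex within a block into groups of at most g ≈ l /
(32 m). A group is named by a code, one of n M with M about n^(1/8) up to powers of l, and a table
over all pairs of codes records whether an edge joins the two groups. A vertex with degrees d₁, d₂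
then needs at most (d₁/g + |B'|/L + 1)(d₂/g + |C'|/L + 1) lookups, and each clear pair of groups it
looks up is a rectangle used for it.

The cost has three parts. (1) A split removes area at least θ² x ≥ θ² n² / R, so there are at most 1
+ R l² subproblems (`countN`). Each costs about n² M² for its table and O(n²) besides, which is
n^(5/2) up to powers of l in total (`base_mul_count_le`). (2) In a leaf without dense vertex, d₁ d₂
< θ² x, so a vertex makes O(x m⁶ / l⁴) lookups apart from O(n). As splits are disjoint, the areas of
leaves sum to at most n², and this part is O(n³ m⁶ / l⁴) (`rateN_le`). (3) In a small leaf only d₁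
d₂ ≤ x is known, so the total area of small leaves has to be O(n² / l⁴). The weight x^(1-δ) (n²/R)^δ
with δ = 16 m / l is at least x when x ≤ n² / R; it does not increase in total under a split; and at
the root it is n² R^(-δ), about n² 2^(-4m) ≤ n² / l⁴ (`le_smallN`, `smallN_split`, `smallN_le`).
That the weight does not increase is the analytic core, `rpow_split_le_one`. It needs the cut to run
along a side of which the dense vertex sees at least the fraction θ; one of the two sides qualifies
because the product of the fractions is at least θ².

The program is written in a small imperative language with exact step counts, and `Big.runs`
transfers its runs to the word RAM. The invariant `Search` of the main loop says that each relevant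
triple is covered by the record written so far or still waits in the queue; `exec_mainBody` charges
time and record cost to the decrease of the potential `costN`, whose inequalities are in
`prmN_potential`. `machine_correct` assembles the run and `hatO_timeN` gives the asymptotics. -/

namespace HL

open WordRAM (Op Cmd State step)

/-! ## A small structured language that compiles to the word RAM

Variables `0, …, 99` are registers; the arrays `0, …, 7` are interleaved in the memory above the
input; register `100` holds the address `S` of the first cell above the input. -/

/-- Exact (unbounded) value of an operation. -/
def opVal : Op → ℕ → ℕ → ℕ
  | .add, a, b => a + b
  | .sub, a, b => a - b
  | .mul, a, b => a * b
  | .div, a, b => a / b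
  | .and, a, b => a &&& b
  | .or, a, b => a ||| b
  | .xor, a, b => a ^^^ b
  | .shl, a, b => a <<< b
  | .shr, a, b => a >>> b
  | .lt, a, b => if a < b then 1 else 0
  | .eq, a, b => if a = b then 1 else 0

/-- A condition under which an operation on words below `W` has its exact value. -/
def opOk (W : ℕ) : Op → ℕ → ℕ → Prop
  | .add, a, b => a + b < W
  | .sub, a, b => b ≤ a
  | .mul, a, b => a * b < W
  | .div, _, _ => True
  | .and, _, _ => False
  | .or, _, _ => False
  | .xor, _, _ => False
  | .shl, a, b => a <<< b < W
  | .shr, _, _ => True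
  | .lt, _, _ => True
  | .eq, _, _ => True

theorem opVal_lt {W : ℕ} (hW : 1 < W) {o : Op} {a b : ℕ} (ha : a < W) (h : opOk W o a b) :
    opVal o a b < W := by
  cases o <;> simp only [opVal, opOk] at *
  · exact h
  · omega
  · exact h
  · exact (Nat.div_le_self _ _).trans_lt ha
  · exact h
  · exact (Nat.shiftRight_le _ _).trans_lt ha
  · split_ifs <;> omega
  · split_ifs <;> omega

theorem eval_eq_opVal {w : ℕ} (hw : 1 < 2 ^ w) {o : Op} {a b : ℕ} (ha : a < 2 ^ w)
    (h : opOk (2 ^ w) o a b) : o.eval w a b = opVal o a b := by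
  have h2 := opVal_lt hw ha h
  cases o <;> simp only [opVal, opOk, Op.eval] at * <;> try exact Nat.mod_eq_of_lt h2
  rw [show a + 2 ^ w - b = (a - b) + 2 ^ w by omega, Nat.add_mod_right]
  exact Nat.mod_eq_of_lt h2

/-- States of the structured language: variables, arrays, output. -/
structure HS where
  v : ℕ → ℕ
  a : ℕ → ℕ → ℕ
  out : List ℕ

/-- Assign to a variable. -/
def HS.setv (s : HS) (r x : ℕ) : HS := { s with v := Function.update s.v r x }

/-- Assign to an entry of an array. -/
def HS.seta (s : HS) (r i x : ℕ) : HS :=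
  { s with a := Function.update s.a r (Function.update (s.a r) i x) }

/-- Append to the output. -/
def HS.emit (s : HS) (x : ℕ) : HS := { s with out := s.out ++ [x] }

/-- Expressions: constants, variables, operations, cells of the input, entries of arrays. -/
inductive Ex where
  | lit (x : ℕ)
  | var (r : ℕ)
  | bin (o : Op) (e f : Ex)
  | inp (e : Ex)
  | arr (r : ℕ) (e : Ex)

/-- Statements. -/
inductive St where
  | set (r : ℕ) (e : Ex)
  | put (r : ℕ) (i e : Ex)
  | emit (e : Ex)
  | seq (c d : St)
  | ite (e : Ex) (c d : St)
  | loop (e : Ex) (c : St)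

namespace Ex

/-- The value of an expression. -/
def val (I : ℕ → ℕ) (s : HS) : Ex → ℕ
  | lit x => x
  | var r => s.v r
  | bin o e f => opVal o (e.val I s) (f.val I s)
  | inp e => I (e.val I s)
  | arr r e => s.a r (e.val I s)

/-- No overflow occurs in the evaluation. -/
def ok (W S : ℕ) (I : ℕ → ℕ) (s : HS) : Ex → Prop
  | lit x => x < W
  | var _ => True
  | bin o e f => e.ok W S I s ∧ f.ok W S I s ∧ opOk W o (e.val I s) (f.val I s)
  | inp e => e.ok W S I s ∧ e.val I s < S
  | arr r e => e.ok W S I s ∧ r < 8 ∧ S + (8 * e.val I s + 8) < W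

/-- Variables and arrays are in range. -/
def wf : Ex → Bool
  | lit _ => true
  | var r => r < 100
  | bin _ e f => e.wf && f.wf
  | inp e => e.wf
  | arr _ e => e.wf

/-- Code that leaves the address of entry `x` of array `r` in register `d`, which holds `x`. -/
def addrCode (r d : ℕ) : Cmd :=
  .seq (.const (d + 1) 8) (.seq (.op .mul d d (d + 1)) (.seq (.const (d + 1) r)
    (.seq (.op .add d d (d + 1)) (.op .add d d 100))))

/-- Code that leaves the value of an expression in register `d` and uses registers from `d` on. -/
def comp : Ex → ℕ → Cmd
  | lit x, d => .const d x
  | var r, d => .op .or d r r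
  | bin o e f, d => .seq (e.comp d) (.seq (f.comp (d + 1)) (.op o d d (d + 1)))
  | inp e, d => .seq (e.comp d) (.load d d)
  | arr r e, d => .seq (e.comp d) (.seq (addrCode r d) (.load d d))

/-- The number of steps of the evaluation. -/
def cost : Ex → ℕ
  | lit _ => 1
  | var _ => 1
  | bin _ e f => e.cost + f.cost + 3
  | inp e => e.cost + 2
  | arr _ e => e.cost + 12

end Ex

/-! ### Simulation of expressions by the word RAM -/

/-- Code `c` takes exactly `t` steps from `u` to `u'`. -/
def Runs (w : ℕ) (c : Cmd) (u : State) (t : ℕ) (u' : State) : Prop :=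
  ∀ k, (step w)^[t] (c :: k, u) = (k, u')

theorem Runs.seq {w : ℕ} {c d : Cmd} {u u' u'' : State} {t t' : ℕ} (h : Runs w c u t u')
    (hd : Runs w d u' t' u'') : Runs w (.seq c d) u (t + t' + 1) u'' := by
  intro k
  rw [Function.iterate_succ_apply, Nat.add_comm, Function.iterate_add_apply]
  show (step w)^[t'] ((step w)^[t] (c :: d :: k, u)) = _
  rw [h, hd]

/-- The machine state `u` represents the state `s` of the structured language. -/
structure Rel (w S : ℕ) (I : ℕ → ℕ) (s : HS) (u : State) : Prop where
  reg : ∀ r < 100, u.reg r = s.v r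
  base : u.reg 100 = S
  inp : ∀ i < S, u.mem i = I i
  arr : ∀ r < 8, ∀ i, u.mem (S + (8 * i + r)) = s.a r i
  out : u.out = s.out
  reg_lt : ∀ r, u.reg r < 2 ^ w
  mem_lt : ∀ i, u.mem i < 2 ^ w

section
variable {w S : ℕ} {I : ℕ → ℕ} {s : HS} {u : State}

theorem Rel.setReg (h : Rel w S I s u) {d x : ℕ} (hd : 100 < d) (hx : x < 2 ^ w) :
    Rel w S I s (u.setReg d x) where
  reg r hr := by simp [State.setReg, show r ≠ d by omega, h.reg r hr]
  base := by simp [State.setReg, show 100 ≠ d by omega, h.base]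
  inp := h.inp
  arr := h.arr
  out := h.out
  reg_lt r := by
    simp only [State.setReg, Function.update_apply]; split_ifs; exacts [hx, h.reg_lt r]
  mem_lt := h.mem_lt

/-- The room for `8` instead of `r` bounds every intermediate value, the literal `8` included, so no
reduction modulo `2 ^ w` takes effect. -/
theorem runs_addrCode (h : Rel w S I s u) {r d : ℕ} (hr : r < 8) (hd : 100 < d)
    (hb : S + (8 * u.reg d + 8) < 2 ^ w) :
    ∃ u', Runs w (Ex.addrCode r d) u 9 u' ∧ Rel w S I s u' ∧
      u'.reg d = S + (8 * u.reg d + r) ∧ ∀ i < d, u'.reg i = u.reg i := by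
  have h8 : (8 : ℕ) < 2 ^ w := by omega
  refine ⟨((((u.setReg (d + 1) 8).setReg d (8 * u.reg d)).setReg (d + 1) r).setReg d
    (8 * u.reg d + r)).setReg d (S + (8 * u.reg d + r)), ?_, ?_, ?_, ?_⟩
  · intro k
    have hr' : r < 2 ^ w := by omega
    have e1 : 8 * u.reg d % 2 ^ w = 8 * u.reg d := Nat.mod_eq_of_lt (by omega)
    have e2 : (8 * u.reg d + r) % 2 ^ w = 8 * u.reg d + r := Nat.mod_eq_of_lt (by omega)
    have e3 : (S + (8 * u.reg d + r)) % 2 ^ w = S + (8 * u.reg d + r) :=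
      Nat.mod_eq_of_lt (by omega)
    simp only [Ex.addrCode, Function.iterate_succ_apply, step, State.setReg, Op.eval,
      Nat.mod_eq_of_lt h8, Nat.mod_eq_of_lt hr', Function.iterate_zero, id]
    simp [h.base, show (100 : ℕ) ≠ d by omega,
      show (100 : ℕ) ≠ d + 1 by omega, Nat.mul_comm (u.reg d) 8, e1, e2,
      Nat.add_comm _ S, e3]
  · refine ((((h.setReg ?_ ?_).setReg ?_ ?_).setReg ?_ ?_).setReg ?_ ?_).setReg ?_ ?_ <;> omega
  · simp [State.setReg]
  · intro i hi
    simp [State.setReg, show i ≠ d by omega, show i ≠ d + 1 by omega]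

/-- Registers work as a stack: everything below `d` survives, so the left operand stays in `d` while
the right one is computed in `d + 1`. -/
theorem Ex.runs_comp (hw : 1 < 2 ^ w) (e : Ex) : ∀ {u : State} {d : ℕ}, Rel w S I s u → 100 < d →
    e.wf = true → e.ok (2 ^ w) S I s →
    ∃ u', Runs w (e.comp d) u e.cost u' ∧ Rel w S I s u' ∧ u'.reg d = e.val I s ∧
      ∀ i < d, u'.reg i = u.reg i := by
  induction e with
  | lit x =>
    intro u d h hd _ hok
    refine ⟨u.setReg d x, fun k => ?_, h.setReg hd hok, by simp [State.setReg, Ex.val], ?_⟩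
    · simp only [Ex.cost, Ex.comp, Function.iterate_one, step]
      rw [Nat.mod_eq_of_lt hok]
    · intro i hi; simp [State.setReg, show i ≠ d by omega]
  | var r =>
    intro u d h hd hwf hok
    have hr : r < 100 := by simpa [Ex.wf] using hwf
    refine ⟨u.setReg d (s.v r), fun k => ?_, h.setReg hd ?_, by simp [State.setReg, Ex.val], ?_⟩
    · simp only [Ex.cost, Ex.comp, Function.iterate_one, step, Op.eval, Nat.or_self]
      rw [Nat.mod_eq_of_lt (h.reg_lt r), h.reg r hr]
    · rw [← h.reg r hr]; exact h.reg_lt r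
    · intro i hi; simp [State.setReg, show i ≠ d by omega]
  | bin o e f ihe ihf =>
    intro u d h hd hwf hok
    simp only [Ex.wf, Bool.and_eq_true] at hwf
    obtain ⟨u1, r1, rel1, v1, f1⟩ := ihe h hd hwf.1 hok.1
    obtain ⟨u2, r2, rel2, v2, f2⟩ := ihf rel1 (d := d + 1) (by omega) hwf.2 hok.2.1
    have hd2 : u2.reg d = e.val I s := by rw [f2 d (by omega), v1]
    have hlt : e.val I s < 2 ^ w := by rw [← hd2]; exact rel2.reg_lt d
    have hev := eval_eq_opVal hw hlt hok.2.2
    refine ⟨u2.setReg d (opVal o (e.val I s) (f.val I s)), ?_,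
      rel2.setReg hd (opVal_lt hw hlt hok.2.2), by simp [State.setReg, Ex.val], ?_⟩
    · have r3 : Runs w (.op o d d (d + 1)) u2 1
          (u2.setReg d (opVal o (e.val I s) (f.val I s))) := by
        intro k
        simp only [Function.iterate_one, step]
        rw [hd2, v2, hev]
      have := r1.seq (r2.seq r3)
      rw [show e.cost + (f.cost + 1 + 1) + 1 = (Ex.bin o e f).cost by simp [Ex.cost]; omega] at this
      exact this
    · intro i hi
      simp [State.setReg, show i ≠ d by omega, f2 i (by omega), f1 i hi]
  | inp e ih =>
    intro u d h hd hwf hok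
    obtain ⟨u1, r1, rel1, v1, f1⟩ := ih h hd hwf hok.1
    refine ⟨u1.setReg d (u1.mem (u1.reg d)), ?_, rel1.setReg hd (rel1.mem_lt _), ?_, ?_⟩
    · have r3 : Runs w (.load d d) u1 1 (u1.setReg d (u1.mem (u1.reg d))) := fun k => rfl
      exact r1.seq r3
    · simp [State.setReg, Ex.val, v1, rel1.inp _ hok.2]
    · intro i hi; simp [State.setReg, show i ≠ d by omega, f1 i hi]
  | arr r e ih =>
    intro u d h hd hwf hok
    obtain ⟨u1, r1, rel1, v1, f1⟩ := ih h hd hwf hok.1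
    obtain ⟨u2, r2, rel2, v2, f2⟩ := runs_addrCode rel1 hok.2.1 hd (by rw [v1]; exact hok.2.2)
    refine ⟨u2.setReg d (u2.mem (u2.reg d)), ?_, rel2.setReg hd (rel2.mem_lt _), ?_, ?_⟩
    · have r3 : Runs w (.load d d) u2 1 (u2.setReg d (u2.mem (u2.reg d))) := fun k => rfl
      exact r1.seq (r2.seq r3)
    · simp only [State.setReg, Ex.val, v2, v1, Function.update_self]
      exact rel2.arr r hok.2.1 _
    · intro i hi
      simp [State.setReg, show i ≠ d by omega, f1 i hi, f2 i hi]

end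

/-! ### Statements: compilation, big-step semantics and simulation -/

namespace St

/-- Variables are in range. -/
def wf : St → Bool
  | set r e => r < 100 && e.wf
  | put _ i e => i.wf && e.wf
  | emit e => e.wf
  | seq c d => c.wf && d.wf
  | ite e c d => e.wf && c.wf && d.wf
  | .loop e c => e.wf && c.wf

/-- Translation to the word RAM. -/
def comp : St → Cmd
  | set r e => .seq (e.comp 101) (.op .or r 101 101)
  | put r i e => .seq (e.comp 101) (.seq (i.comp 102) (.seq (Ex.addrCode r 102) (.store 102 101)))
  | emit e => .seq (e.comp 101) (.emit 101)
  | seq c d => .seq c.comp d.comp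
  | ite e c d => .seq (e.comp 101) (.cond 101 c.comp d.comp)
  | .loop e c => .seq (e.comp 101) (.loop 101 (.seq c.comp (e.comp 101)))

/-- The variables that may be assigned. -/
def vmods : St → List ℕ
  | set r _ => [r]
  | put _ _ _ => []
  | emit _ => []
  | seq c d => c.vmods ++ d.vmods
  | ite _ c d => c.vmods ++ d.vmods
  | .loop _ c => c.vmods

/-- The arrays that may be written. -/
def amods : St → List ℕ
  | set _ _ => []
  | put r _ _ => [r]
  | emit _ => []
  | seq c d => c.amods ++ d.amods
  | ite _ c d => c.amods ++ d.amods
  | .loop _ c => c.amods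

/-- Whether there may be output. -/
def emits : St → Bool
  | set _ _ => false
  | put _ _ _ => false
  | emit _ => true
  | seq c d => c.emits || d.emits
  | ite _ c d => c.emits || d.emits
  | .loop _ c => c.emits

end St

/-- Big-step semantics with the number of machine steps. -/
inductive Big (W S : ℕ) (I : ℕ → ℕ) : St → HS → ℕ → HS → Prop
  | set {s : HS} {r : ℕ} {e : Ex} : e.ok W S I s →
      Big W S I (.set r e) s (e.cost + 2) (s.setv r (e.val I s))
  | put {s : HS} {r : ℕ} {i e : Ex} : i.ok W S I s → e.ok W S I s → r < 8 →
      S + (8 * i.val I s + 8) < W →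
      Big W S I (.put r i e) s (e.cost + i.cost + 13) (s.seta r (i.val I s) (e.val I s))
  | emit {s : HS} {e : Ex} : e.ok W S I s →
      Big W S I (.emit e) s (e.cost + 2) (s.emit (e.val I s))
  | seq {c d : St} {s s' s'' : HS} {t t' : ℕ} : Big W S I c s t s' → Big W S I d s' t' s'' →
      Big W S I (.seq c d) s (t + t' + 1) s''
  | ite_pos {e : Ex} {c d : St} {s s' : HS} {t : ℕ} : e.ok W S I s → e.val I s ≠ 0 →
      Big W S I c s t s' → Big W S I (.ite e c d) s (e.cost + t + 2) s'
  | ite_neg {e : Ex} {c d : St} {s s' : HS} {t : ℕ} : e.ok W S I s → e.val I s = 0 →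
      Big W S I d s t s' → Big W S I (.ite e c d) s (e.cost + t + 2) s'
  | loop_neg {e : Ex} {c : St} {s : HS} : e.ok W S I s → e.val I s = 0 →
      Big W S I (.loop e c) s (e.cost + 2) s
  | loop_pos {e : Ex} {c : St} {s s' sf : HS} {t t' : ℕ} : e.ok W S I s → e.val I s ≠ 0 →
      Big W S I c s t s' → Big W S I (.loop e c) s' t' sf →
      Big W S I (.loop e c) s (t + t' + e.cost + 2) sf

/-- What a statement cannot change. -/
structure Frame (c : St) (s s' : HS) : Prop where
  v : ∀ {r}, r ∉ c.vmods → s'.v r = s.v r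
  a : ∀ {r}, r ∉ c.amods → s'.a r = s.a r
  out : c.emits = false → s'.out = s.out

/-- Purely syntactic framing. It turns each later claim that a register or array is unchanged into
non-membership in a concrete list, settled by `decide`. -/
theorem Big.frame {W S : ℕ} {I : ℕ → ℕ} {c : St} {s s' : HS} {t : ℕ} (h : Big W S I c s t s') :
    Frame c s s' := by
  induction h with
  | set _ =>
    refine ⟨fun {r} hr => ?_, fun _ => rfl, fun _ => rfl⟩
    simp only [St.vmods, List.mem_singleton] at hr
    simp [HS.setv, hr]
  | put _ _ _ _ =>
    refine ⟨fun _ => rfl, fun {r} hr => ?_, fun _ => rfl⟩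
    simp only [St.amods, List.mem_singleton] at hr
    simp [HS.seta, hr]
  | emit _ => exact ⟨fun _ => rfl, fun _ => rfl, fun h => by simp [St.emits] at h⟩
  | seq _ _ h1 h2 =>
    refine ⟨fun hr => ?_, fun hr => ?_, fun hr => ?_⟩
    · simp only [St.vmods, List.mem_append, not_or] at hr; rw [h2.v hr.2, h1.v hr.1]
    · simp only [St.amods, List.mem_append, not_or] at hr; rw [h2.a hr.2, h1.a hr.1]
    · simp only [St.emits, Bool.or_eq_false_iff] at hr; rw [h2.out hr.2, h1.out hr.1]
  | ite_pos _ _ _ h1 =>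
    refine ⟨fun hr => ?_, fun hr => ?_, fun hr => ?_⟩
    · simp only [St.vmods, List.mem_append, not_or] at hr; rw [h1.v hr.1]
    · simp only [St.amods, List.mem_append, not_or] at hr; rw [h1.a hr.1]
    · simp only [St.emits, Bool.or_eq_false_iff] at hr; rw [h1.out hr.1]
  | ite_neg _ _ _ h1 =>
    refine ⟨fun hr => ?_, fun hr => ?_, fun hr => ?_⟩
    · simp only [St.vmods, List.mem_append, not_or] at hr; rw [h1.v hr.2]
    · simp only [St.amods, List.mem_append, not_or] at hr; rw [h1.a hr.2]
    · simp only [St.emits, Bool.or_eq_false_iff] at hr; rw [h1.out hr.2]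
  | loop_neg _ _ => exact ⟨fun _ => rfl, fun _ => rfl, fun _ => rfl⟩
  | loop_pos _ _ _ _ h1 h2 =>
    exact ⟨fun hr => by rw [h2.v hr, h1.v hr], fun hr => by rw [h2.a hr, h1.a hr],
      fun hr => by rw [h2.out hr, h1.out hr]⟩

section
variable {w S : ℕ} {I : ℕ → ℕ}

theorem Rel.setv {s : HS} {u : State} (h : Rel w S I s u) {r x : ℕ} (hr : r < 100)
    (hx : x < 2 ^ w) : Rel w S I (s.setv r x) (u.setReg r x) where
  reg i hi := by
    by_cases hir : i = r
    · simp [State.setReg, HS.setv, hir]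
    · simp [State.setReg, HS.setv, hir, h.reg i hi]
  base := by simp [State.setReg, show 100 ≠ r by omega, h.base]
  inp := h.inp
  arr := h.arr
  out := h.out
  reg_lt i := by
    simp only [State.setReg, Function.update_apply]; split_ifs; exacts [hx, h.reg_lt i]
  mem_lt := h.mem_lt

theorem Rel.seta {s : HS} {u : State} (h : Rel w S I s u) {r i x : ℕ} (hr : r < 8)
    (hx : x < 2 ^ w) :
    Rel w S I (s.seta r i x) { u with mem := Function.update u.mem (S + (8 * i + r)) x } where
  reg := h.reg
  base := h.base
  inp j hj := by simp [show j ≠ S + (8 * i + r) by omega, h.inp j hj]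
  arr r' hr' j := by
    by_cases hrr : r' = r
    · subst hrr
      by_cases hij : j = i
      · simp [HS.seta, hij]
      · simp [HS.seta, hij, h.arr r' hr']
    · have hne : S + (8 * j + r') ≠ S + (8 * i + r) := by omega
      simp only [HS.seta, Function.update_apply, hne, hrr, if_false]
      exact h.arr r' hr' j
  out := h.out
  reg_lt := h.reg_lt
  mem_lt j := by
    simp only [Function.update_apply]; split_ifs; exacts [hx, h.mem_lt j]

theorem Big.loop_cost_le {W : ℕ} {e : Ex} {c : St} {s s' : HS} {t : ℕ}
    (h : Big W S I (.loop e c) s t s') : e.cost + 2 ≤ t := by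
  cases h <;> omega

/-- The machine is deterministic, so a known first stage can be cancelled from a run. Loops need
this: the compiled condition is evaluated before the machine loop and again at the end of each
round, so the evaluation that opens the remaining loop has already happened inside the previous
round. -/
theorem Runs.iterate_seq {c d : Cmd} {u u' u'' : State} {t r : ℕ} (h : Runs w c u t u')
    (h' : Runs w (.seq c d) u (t + r + 1) u'') : Runs w d u' r u'' := by
  intro k
  have := h' k
  rw [Function.iterate_succ_apply, Nat.add_comm, Function.iterate_add_apply] at this
  change (step w)^[r] ((step w)^[t] (c :: d :: k, u)) = _ at this
  rwa [h] at this

theorem Big.runs (hw : 1 < 2 ^ w) {c : St} {s s' : HS} {t : ℕ}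
    (h : Big (2 ^ w) S I c s t s') : ∀ {u : State}, Rel w S I s u → c.wf = true →
    ∃ u', Runs w c.comp u t u' ∧ Rel w S I s' u' := by
  induction h with
  | @set s r e hok =>
    intro u hu hwf
    simp only [St.wf, Bool.and_eq_true, decide_eq_true_eq] at hwf
    obtain ⟨u1, r1, rel1, v1, f1⟩ := e.runs_comp hw hu (d := 101) (by omega) hwf.2 hok
    have hlt : e.val I s < 2 ^ w := by rw [← v1]; exact rel1.reg_lt _
    refine ⟨u1.setReg r (e.val I s), ?_, rel1.setv hwf.1 hlt⟩
    have r2 : Runs w (.op .or r 101 101) u1 1 (u1.setReg r (e.val I s)) := by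
      intro k
      simp only [Function.iterate_one, step, Op.eval, Nat.or_self, v1, Nat.mod_eq_of_lt hlt]
    exact r1.seq r2
  | @put s r i e hi he hr hb =>
    intro u hu hwf
    simp only [St.wf, Bool.and_eq_true] at hwf
    obtain ⟨u1, r1, rel1, v1, f1⟩ := e.runs_comp hw hu (d := 101) (by omega) hwf.2 he
    obtain ⟨u2, r2, rel2, v2, f2⟩ := i.runs_comp hw rel1 (d := 102) (by omega) hwf.1 hi
    obtain ⟨u3, r3, rel3, v3, f3⟩ := runs_addrCode (d := 102) rel2 hr (by omega) (by rw [v2]; exact hb)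
    have h101 : u3.reg 101 = e.val I s := by rw [f3 _ (by omega), f2 _ (by omega), v1]
    have hlt : e.val I s < 2 ^ w := by rw [← v1]; exact rel1.reg_lt _
    rw [v2] at v3
    refine ⟨_, ?_, rel3.seta (i := i.val I s) hr hlt⟩
    have r4 : Runs w (.store 102 101) u3 1
        { u3 with mem := Function.update u3.mem (S + (8 * i.val I s + r)) (e.val I s) } := by
      intro k
      simp only [Function.iterate_one, step, v3, h101]
    have := r1.seq (r2.seq (r3.seq r4))
    rw [show e.cost + (i.cost + (9 + 1 + 1) + 1) + 1 = e.cost + i.cost + 13 by omega] at this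
    exact this
  | @emit s e hok =>
    intro u hu hwf
    obtain ⟨u1, r1, rel1, v1, f1⟩ := e.runs_comp hw hu (d := 101) (by omega) hwf hok
    have r2 : Runs w (.emit 101) u1 1 { u1 with out := u1.out ++ [e.val I s] } := by
      intro k
      simp only [Function.iterate_one, step, v1]
    refine ⟨_, r1.seq r2, ⟨rel1.reg, rel1.base, rel1.inp, rel1.arr, ?_, rel1.reg_lt, rel1.mem_lt⟩⟩
    simp [HS.emit, rel1.out]
  | seq _ _ ih1 ih2 =>
    intro u hu hwf
    simp only [St.wf, Bool.and_eq_true] at hwf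
    obtain ⟨u1, r1, rel1⟩ := ih1 hu hwf.1
    obtain ⟨u2, r2, rel2⟩ := ih2 rel1 hwf.2
    exact ⟨u2, r1.seq r2, rel2⟩
  | @ite_pos e c d s s' t hok hv _ ih =>
    intro u hu hwf
    simp only [St.wf, Bool.and_eq_true] at hwf
    obtain ⟨u1, r1, rel1, v1, f1⟩ := e.runs_comp hw hu (d := 101) (by omega) hwf.1.1 hok
    obtain ⟨u2, r2, rel2⟩ := ih rel1 hwf.1.2
    refine ⟨u2, ?_, rel2⟩
    have r3 : Runs w (.cond 101 c.comp d.comp) u1 (t + 1) u2 := by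
      intro k
      rw [Function.iterate_succ_apply]
      simp only [step, v1, hv, ne_eq, not_false_eq_true, if_true]
      exact r2 k
    exact r1.seq r3
  | @ite_neg e c d s s' t hok hv _ ih =>
    intro u hu hwf
    simp only [St.wf, Bool.and_eq_true] at hwf
    obtain ⟨u1, r1, rel1, v1, f1⟩ := e.runs_comp hw hu (d := 101) (by omega) hwf.1.1 hok
    obtain ⟨u2, r2, rel2⟩ := ih rel1 hwf.2
    refine ⟨u2, ?_, rel2⟩
    have r3 : Runs w (.cond 101 c.comp d.comp) u1 (t + 1) u2 := by
      intro k
      rw [Function.iterate_succ_apply]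
      simp only [step, v1, hv, ne_eq, not_true_eq_false, if_false]
      exact r2 k
    exact r1.seq r3
  | @loop_neg e c s hok hv =>
    intro u hu hwf
    simp only [St.wf, Bool.and_eq_true] at hwf
    obtain ⟨u1, r1, rel1, v1, f1⟩ := e.runs_comp hw hu (d := 101) (by omega) hwf.1 hok
    refine ⟨u1, ?_, rel1⟩
    have r3 : Runs w (.loop 101 (.seq c.comp (e.comp 101))) u1 1 u1 := by
      intro k
      simp only [Function.iterate_one, step, v1, hv, ne_eq, not_true_eq_false, if_false]
    exact r1.seq r3
  | @loop_pos e c s s' s'' t t' hok hv hc hl ih1 ih2 =>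
    intro u hu hwf'
    have hwf := hwf'
    simp only [St.wf, Bool.and_eq_true] at hwf
    obtain ⟨u1, r1, rel1, v1, f1⟩ := e.runs_comp hw hu (d := 101) (by omega) hwf.1 hok
    obtain ⟨u2, r2, rel2⟩ := ih1 rel1 hwf.2
    obtain ⟨u4, r4, rel4⟩ := ih2 rel2 hwf'
    have hcost := hl.loop_cost_le
    have hok' : e.ok (2 ^ w) S I s' := by cases hl <;> assumption
    obtain ⟨u3, r3, rel3, v3, f3⟩ := e.runs_comp hw rel2 (d := 101) (by omega) hwf.1 hok'
    -- Of the `t'` steps of the remaining loop, `e.cost + 1` belong to the opening evaluation that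
    -- the current round has performed; `r` is what is left for the machine loop. Exact step counts
    -- make this subtraction possible.
    obtain ⟨r, rfl⟩ : ∃ r, t' = e.cost + r + 1 := ⟨t' - e.cost - 1, by omega⟩
    have r5 := r3.iterate_seq r4
    refine ⟨u4, ?_, rel4⟩
    have r6 : Runs w (.loop 101 (.seq c.comp (e.comp 101))) u1 (t + e.cost + r + 2) u4 := by
      intro k
      rw [show t + e.cost + r + 2 = r + (t + e.cost + 1) + 1 by omega, Function.iterate_succ_apply]
      simp only [step, v1, hv, ne_eq, not_false_eq_true, if_true]
      rw [Function.iterate_add_apply, r2.seq r3, r5]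
    have := r1.seq r6
    rw [show e.cost + (t + e.cost + r + 2) + 1 = t + (e.cost + r + 1) + e.cost + 2 by omega] at this
    exact this

end

/-! ### Straight-line code -/

namespace St

/-- The effect of code without loops. -/
def run (I : ℕ → ℕ) : St → HS → HS
  | set r e, s => s.setv r (e.val I s)
  | put r i e, s => s.seta r (i.val I s) (e.val I s)
  | emit e, s => s.emit (e.val I s)
  | seq c d, s => d.run I (c.run I s)
  | ite e c d, s => if e.val I s ≠ 0 then c.run I s else d.run I s
  | .loop _ _, s => s

/-- Code without loops runs without overflow. -/
def ok (W S : ℕ) (I : ℕ → ℕ) : St → HS → Prop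
  | set _ e, s => e.ok W S I s
  | put r i e, s => i.ok W S I s ∧ e.ok W S I s ∧ r < 8 ∧ S + (8 * i.val I s + 8) < W
  | emit e, s => e.ok W S I s
  | seq c d, s => c.ok W S I s ∧ d.ok W S I (c.run I s)
  | ite e c d, s => e.ok W S I s ∧ (e.val I s ≠ 0 → c.ok W S I s) ∧ (e.val I s = 0 → d.ok W S I s)
  | .loop _ _, _ => False

/-- A bound for the number of steps of code without loops. -/
def cost : St → ℕ
  | set _ e => e.cost + 2
  | put _ i e => e.cost + i.cost + 13
  | emit e => e.cost + 2
  | seq c d => c.cost + d.cost + 1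
  | ite e c d => e.cost + c.cost + d.cost + 2
  | .loop _ _ => 0

/-- For loop-free code the final state is computed instead of derived: a proof about such code only
simplifies `St.run` and checks `St.ok`. A conditional is charged for both branches, which keeps the
bound independent of the state. -/
theorem big_run {W S : ℕ} {I : ℕ → ℕ} (c : St) : ∀ {s : HS}, c.ok W S I s →
    ∃ t, Big W S I c s t (c.run I s) ∧ t ≤ c.cost := by
  induction c with
  | set r e => exact fun h => ⟨_, .set h, le_rfl⟩
  | put r i e => exact fun h => ⟨_, .put h.1 h.2.1 h.2.2.1 h.2.2.2, le_rfl⟩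
  | emit e => exact fun h => ⟨_, .emit h, le_rfl⟩
  | seq c d ihc ihd =>
    intro s h
    obtain ⟨t, h1, h2⟩ := ihc h.1
    obtain ⟨t', h1', h2'⟩ := ihd h.2
    exact ⟨_, .seq h1 h1', by simp only [cost]; omega⟩
  | ite e c d ihc ihd =>
    intro s h
    by_cases hv : e.val I s = 0
    · obtain ⟨t, h1, h2⟩ := ihd (h.2.2 hv)
      refine ⟨e.cost + t + 2, ?_, by simp only [cost]; omega⟩
      simp only [run, hv, ne_eq, not_true_eq_false, if_false]
      exact .ite_neg h.1 hv h1
    · obtain ⟨t, h1, h2⟩ := ihc (h.2.1 hv)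
      refine ⟨e.cost + t + 2, ?_, by simp only [cost]; omega⟩
      simp only [run, hv, ne_eq, not_false_eq_true, if_true]
      exact .ite_pos h.1 hv h1
  | loop e c _ => exact fun h => h.elim

end St

/-! ### Counting loops -/

/-- `for i < (value of variable b) do c`. -/
def St.for (i b : ℕ) (c : St) : St :=
  .seq (.set i (.lit 0)) (.loop (.bin .lt (.var i) (.var b))
    (.seq c (.set i (.bin .add (.var i) (.lit 1)))))

theorem Frame.trans {c : St} {s s' s'' : HS} (h : Frame c s s') (h' : Frame c s' s'') :
    Frame c s s'' :=
  ⟨fun hr => (h'.v hr).trans (h.v hr), fun hr => (h'.a hr).trans (h.a hr),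
    fun hr => (h'.out hr).trans (h.out hr)⟩

/-- The invariant is asserted with the counter already at its next value. The body may also assume
`Frame` relative to the start of the loop, so registers that the loop does not touch never enter an
invariant. The test and the increment cost fewer than `20` steps per round. -/
theorem Big.for {W S : ℕ} {I : ℕ → ℕ} {i b : ℕ} {c : St} {s₀ : HS} (N : ℕ) (τ : ℕ → ℕ)
    (Inv : ℕ → HS → Prop) (hW : 1 < W) (hN : N < W) (hb : s₀.v b = N) (hib : b ≠ i)
    (hi : i ∉ c.vmods) (hbm : b ∉ c.vmods) (h0 : Inv 0 (s₀.setv i 0))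
    (hstep : ∀ j < N, ∀ s, Frame (.for i b c) s₀ s → s.v i = j → Inv j s →
      ∃ t s', Big W S I c s t s' ∧ t ≤ τ j ∧ Inv (j + 1) (s'.setv i (j + 1))) :
    ∃ t s', Big W S I (.for i b c) s₀ t s' ∧ t ≤ ∑ j ∈ Finset.range N, (τ j + 20) + 20 ∧
      Inv N s' ∧ s'.v i = N := by
  have key : ∀ r j s, j + r = N → Frame (.for i b c) s₀ s → s.v i = j → Inv j s →
      ∃ t s', Big W S I (.loop (.bin .lt (.var i) (.var b))
        (.seq c (.set i (.bin .add (.var i) (.lit 1))))) s t s' ∧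
        t ≤ ∑ j ∈ Finset.Ico j N, (τ j + 20) + 10 ∧ Inv N s' ∧ s'.v i = N := by
    intro r
    induction r with
    | zero =>
      intro j s hj hF hsi hI
      have hsb : s.v b = N := by
        rw [hF.v (by simp [St.for, St.vmods, hbm, hib]), hb]
      obtain rfl : j = N := by omega
      refine ⟨_, s, .loop_neg (by simp [Ex.ok, opOk]) ?_, ?_, hI, hsi⟩
      · simp [Ex.val, opVal, hsi, hsb]
      · simp [Ex.cost]
    | succ r ih =>
      intro j s hj hF hsi hI
      have hsb : s.v b = N := by
        rw [hF.v (by simp [St.for, St.vmods, hbm, hib]), hb]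
      obtain ⟨t, s', hB, ht, hI'⟩ := hstep j (by omega) s hF hsi hI
      have hfr := hB.frame
      have hs'i : s'.v i = j := by rw [hfr.v hi, hsi]
      have hset : Big W S I (.set i (.bin .add (.var i) (.lit 1))) s' 7 (s'.setv i (j + 1)) := by
        have := Big.set (W := W) (S := S) (I := I) (s := s') (r := i)
          (e := .bin .add (.var i) (.lit 1)) (by simp [Ex.ok, opOk, hW, hs'i, Ex.val]; omega)
        simpa [Ex.val, opVal, hs'i, Ex.cost] using this
      have hbody := hB.seq hset
      have hF' : Frame (.for i b c) s₀ (s'.setv i (j + 1)) := by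
        refine hF.trans ?_
        refine ⟨fun hr => ?_, fun hr => ?_, fun hr => ?_⟩
        · simp only [St.for, St.vmods, List.mem_append, List.mem_singleton, not_or] at hr
          rw [hbody.frame.v (by simp [St.vmods, hr])]
        · simp only [St.for, St.amods, List.nil_append, List.append_nil] at hr
          rw [hbody.frame.a (by simpa [St.amods] using hr)]
        · simp only [St.for, St.emits, Bool.false_or, Bool.or_false] at hr
          rw [hbody.frame.out (by simpa [St.emits] using hr)]
      obtain ⟨t', s'', hB', ht', hI''⟩ := ih (j + 1) (s'.setv i (j + 1)) (by omega) hF'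
        (by simp [HS.setv]) hI'
      refine ⟨_, s'', .loop_pos (by simp [Ex.ok, opOk]) ?_ hbody hB', ?_, hI''⟩
      · simp [Ex.val, opVal, hsi, hsb]; omega
      · rw [Finset.sum_eq_sum_Ico_succ_bot (by omega)]
        simp only [Ex.cost]
        omega
  have hinit : Big W S I (.set i (.lit 0)) s₀ 3 (s₀.setv i 0) := by
    have := Big.set (W := W) (S := S) (I := I) (s := s₀) (r := i) (e := .lit 0)
      (by simp [Ex.ok]; omega)
    simpa [Ex.val, Ex.cost] using this
  obtain ⟨t, s', hB, ht, hI, hv⟩ := key N 0 (s₀.setv i 0) (by omega) (by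
    refine ⟨fun hr => ?_, fun _ => rfl, fun _ => rfl⟩
    simp only [St.for, St.vmods, List.mem_append, List.mem_singleton, not_or] at hr
    simp [HS.setv, hr.1]) (by simp [HS.setv]) h0
  refine ⟨_, s', hinit.seq hB, ?_, hI, hv⟩
  rw [Finset.range_eq_Ico]
  omega

/-! ### Evaluation and overflow rules -/

section Simp
variable {W S : ℕ} {I : ℕ → ℕ} {s : HS}

@[simp] theorem HS.setv_v (r x r' : ℕ) : (s.setv r x).v r' = if r' = r then x else s.v r' := by
  simp [HS.setv, Function.update_apply]
@[simp] theorem HS.setv_a (r x : ℕ) : (s.setv r x).a = s.a := rfl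
@[simp] theorem HS.setv_out (r x : ℕ) : (s.setv r x).out = s.out := rfl
@[simp] theorem HS.seta_v (r i x : ℕ) : (s.seta r i x).v = s.v := rfl
@[simp] theorem HS.seta_a (r i x r' j : ℕ) :
    (s.seta r i x).a r' j = if r' = r ∧ j = i then x else s.a r' j := by
  by_cases h : r' = r
  · subst h; simp [HS.seta, Function.update_apply]
  · simp [HS.seta, h]
@[simp] theorem HS.seta_out (r i x : ℕ) : (s.seta r i x).out = s.out := rfl
@[simp] theorem HS.emit_v (x : ℕ) : (s.emit x).v = s.v := rfl
@[simp] theorem HS.emit_a (x : ℕ) : (s.emit x).a = s.a := rfl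
@[simp] theorem HS.emit_out (x : ℕ) : (s.emit x).out = s.out ++ [x] := rfl

instance : Add Ex := ⟨.bin .add⟩
instance : Sub Ex := ⟨.bin .sub⟩
instance : Mul Ex := ⟨.bin .mul⟩
instance : Div Ex := ⟨.bin .div⟩
instance (x : ℕ) : OfNat Ex x := ⟨.lit x⟩
/-- Comparison `<`. -/
def Ex.lt (e f : Ex) : Ex := .bin .lt e f
/-- Comparison `=`. -/
def Ex.eq (e f : Ex) : Ex := .bin .eq e f
/-- Left shift. -/
def Ex.shl (e f : Ex) : Ex := .bin .shl e f

@[simp] theorem Ex.val_add (e f : Ex) : (e + f).val I s = e.val I s + f.val I s := rfl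
@[simp] theorem Ex.val_sub (e f : Ex) : (e - f).val I s = e.val I s - f.val I s := rfl
@[simp] theorem Ex.val_mul (e f : Ex) : (e * f).val I s = e.val I s * f.val I s := rfl
@[simp] theorem Ex.val_div (e f : Ex) : (e / f).val I s = e.val I s / f.val I s := rfl
@[simp] theorem Ex.val_lt (e f : Ex) :
    (e.lt f).val I s = if e.val I s < f.val I s then 1 else 0 := rfl
@[simp] theorem Ex.val_eq (e f : Ex) :
    (e.eq f).val I s = if e.val I s = f.val I s then 1 else 0 := rfl
@[simp] theorem Ex.val_shl (e f : Ex) : (e.shl f).val I s = e.val I s * 2 ^ f.val I s :=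
  Nat.shiftLeft_eq _ _
@[simp] theorem Ex.val_lit0 : (0 : Ex).val I s = 0 := rfl
@[simp] theorem Ex.val_lit1 : (1 : Ex).val I s = 1 := rfl
@[simp] theorem Ex.val_lit2 : (2 : Ex).val I s = 2 := rfl
@[simp] theorem Ex.val_lit3 : (3 : Ex).val I s = 3 := rfl
@[simp] theorem Ex.val_lit4 : (4 : Ex).val I s = 4 := rfl
@[simp] theorem Ex.val_lit32 : (32 : Ex).val I s = 32 := rfl
@[simp] theorem Ex.val_lit256 : (256 : Ex).val I s = 256 := rfl
@[simp] theorem Ex.val_lit (x : ℕ) : (Ex.lit x).val I s = x := rfl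
@[simp] theorem Ex.val_var (r : ℕ) : (Ex.var r).val I s = s.v r := rfl
@[simp] theorem Ex.val_inp (e : Ex) : (Ex.inp e).val I s = I (e.val I s) := rfl
@[simp] theorem Ex.val_arr (r : ℕ) (e : Ex) : (Ex.arr r e).val I s = s.a r (e.val I s) := rfl

@[simp] theorem Ex.ok_add (e f : Ex) : (e + f).ok W S I s ↔
    e.ok W S I s ∧ f.ok W S I s ∧ e.val I s + f.val I s < W := Iff.rfl
@[simp] theorem Ex.ok_sub (e f : Ex) : (e - f).ok W S I s ↔
    e.ok W S I s ∧ f.ok W S I s ∧ f.val I s ≤ e.val I s := Iff.rfl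
@[simp] theorem Ex.ok_mul (e f : Ex) : (e * f).ok W S I s ↔
    e.ok W S I s ∧ f.ok W S I s ∧ e.val I s * f.val I s < W := Iff.rfl
@[simp] theorem Ex.ok_div (e f : Ex) : (e / f).ok W S I s ↔ e.ok W S I s ∧ f.ok W S I s := by
  show _ ∧ _ ∧ True ↔ _
  rw [and_true]
@[simp] theorem Ex.ok_lt (e f : Ex) : (e.lt f).ok W S I s ↔ e.ok W S I s ∧ f.ok W S I s := by
  show _ ∧ _ ∧ True ↔ _
  rw [and_true]
@[simp] theorem Ex.ok_eq (e f : Ex) : (e.eq f).ok W S I s ↔ e.ok W S I s ∧ f.ok W S I s := by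
  show _ ∧ _ ∧ True ↔ _
  rw [and_true]
@[simp] theorem Ex.ok_shl (e f : Ex) : (e.shl f).ok W S I s ↔
    e.ok W S I s ∧ f.ok W S I s ∧ e.val I s * 2 ^ f.val I s < W := by
  rw [← Nat.shiftLeft_eq]; exact Iff.rfl
@[simp] theorem Ex.ok_lit0 : (0 : Ex).ok W S I s ↔ 0 < W := Iff.rfl
@[simp] theorem Ex.ok_lit1 : (1 : Ex).ok W S I s ↔ 1 < W := Iff.rfl
@[simp] theorem Ex.ok_lit2 : (2 : Ex).ok W S I s ↔ 2 < W := Iff.rfl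
@[simp] theorem Ex.ok_lit3 : (3 : Ex).ok W S I s ↔ 3 < W := Iff.rfl
@[simp] theorem Ex.ok_lit4 : (4 : Ex).ok W S I s ↔ 4 < W := Iff.rfl
@[simp] theorem Ex.ok_lit32 : (32 : Ex).ok W S I s ↔ 32 < W := Iff.rfl
@[simp] theorem Ex.ok_lit256 : (256 : Ex).ok W S I s ↔ 256 < W := Iff.rfl
@[simp] theorem Ex.ok_lit (x : ℕ) : (Ex.lit x).ok W S I s ↔ x < W := Iff.rfl
@[simp] theorem Ex.ok_var (r : ℕ) : (Ex.var r).ok W S I s ↔ True := Iff.rfl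
@[simp] theorem Ex.ok_inp (e : Ex) :
    (Ex.inp e).ok W S I s ↔ e.ok W S I s ∧ e.val I s < S := Iff.rfl
@[simp] theorem Ex.ok_arr (r : ℕ) (e : Ex) : (Ex.arr r e).ok W S I s ↔
    e.ok W S I s ∧ r < 8 ∧ S + (8 * e.val I s + 8) < W := Iff.rfl

/-- Do nothing. -/
def St.skip : St := .set 99 0

end Simp

infixr:60 ";;" => St.seq
local notation "V" => Ex.var

/-! ### The program

Registers: `0` answer, `1, 2, 3` triangle, `5` number `n` of vertices, `6` bit length `l` of `n`,
`7` bit length of `l`, `8` group size `g`, `9` block length `L`, `10` base `K` of the codes,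
`11` `M = K ^ g`, `12` `E = n * M`, `13` `E * E`, `14` ratio `R` below which a subproblem is small,
`15` density threshold, `16` current subproblem, `17` number of subproblems, `18` number of
rectangles so far, `19`, `20` sizes of the two sides of the current subproblem, `21` current vertex
of the first part, `22`, `23` its degrees, `24` one plus a dense vertex if there is one.

Arrays: `0` labels of the subproblems, `1`, `2` the two sides of the current subproblem (from index
`1` on), `3`, `4` the groups of the neighbourhood of the current vertex, `5` the edges that spoil
the rectangles. -/

/-- Whether `a` and `u` are adjacent. -/
def adjE (a u : Ex) : Ex := .inp (1 + V 5 + (a * V 5 + u))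

/-- Remainder of a division. -/
def modE (a b : Ex) : Ex := a - a / b * b

/-- List the vertices with label `q`. -/
def fillSide (q : ℕ) : St :=
  .set (18 + q) 0 ;; .for 25 5
    (.ite (.eq (.arr 0 (V 16 * V 5 + V 25)) (.lit q))
      (.set (18 + q) (V (18 + q) + 1) ;; .put q (V (18 + q)) (V 25)) .skip)

/-- Compute the degree of the current vertex into side `q`. -/
def degree (q : ℕ) : St :=
  .set (21 + q) 0 ;; .for 28 (18 + q)
    (.ite (adjE (V 21) (.arr q (V 28 + 1))) (.set (21 + q) (V (21 + q) + 1)) .skip)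

/-- Search for a vertex that is dense in the current subproblem, provided that it is large. -/
def search : St :=
  .set 24 0 ;; .ite (.lt (V 19 * V 20 * V 14) (V 5 * V 5)) .skip
    (.for 21 5 (degree 1 ;; degree 2 ;;
      .ite (.lt (V 22 * V 23 * (V 6 * V 6)) (V 15 * V 15 * (V 19 * V 20))) .skip
        (.set 24 (V 21 + 1))))

/-- Output the neighbours of the current vertex on side `q`. -/
def emitNbrs (q : ℕ) : St :=
  .for 28 (18 + q) (.ite (adjE (V 21) (.arr q (V 28 + 1))) (.emit (.arr q (V 28 + 1))) .skip)

/-- Search for an edge between the neighbourhoods of the current vertex. -/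
def checkNbrs : St :=
  .for 28 19 (.set 32 (.arr 1 (V 28 + 1)) ;; .ite (adjE (V 21) (V 32))
    (.for 29 20 (.set 33 (.arr 2 (V 29 + 1)) ;; .ite (adjE (V 21) (V 33))
      (.ite (adjE (V 32) (V 33)) (.set 0 1 ;; .set 1 (V 21) ;; .set 2 (V 32) ;; .set 3 (V 33)) .skip)
      .skip)) .skip)

/-- Use the last rectangle for all vertices. -/
def useAll : St := .for 25 5 (.emit 1 ;; .emit (V 25) ;; .emit (V 18))

/-- Append the two subproblems that remain without the last rectangle. -/
def children : St :=
  .ite (.lt (V 22 * V 6) (V 15 * V 19)) (.set 27 0) (.set 27 1) ;;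
  .for 25 5 (.set 26 (.arr 0 (V 16 * V 5 + V 25)) ;; .set 30 (adjE (V 21) (V 25)) ;;
    .put 0 (V 17 * V 5 + V 25) (V 26 * .eq (.eq (V 26) 1 + .eq (V 30) (V 27)) 1) ;;
    .ite (V 30) (.put 0 ((V 17 + 1) * V 5 + V 25) (V 26 * .eq (.eq (V 26) 1) (V 27)))
      (.put 0 ((V 17 + 1) * V 5 + V 25) (V 26))) ;;
  .set 17 (V 17 + 2)

/-- Treat a subproblem with a dense vertex. -/
def split : St :=
  .set 21 (V 24 - 1) ;; degree 1 ;; degree 2 ;; (.emit 0 ;; .emit (V 22) ;; .emit (V 23)) ;;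
  emitNbrs 1 ;; emitNbrs 2 ;; checkNbrs ;; useAll ;; .set 18 (V 18 + 1) ;; children

/-- Run `c` for the vertices `V 34` of the group of side `q` whose code consists of the block offset
in register `b` and the digits in register `r`. -/
def walk (q b r x y : ℕ) (c : St) : St :=
  .set x (V r) ;; .loop (V x) (.set y (.arr q (V b + modE (V x) (V 10))) ;; .set x (V x / V 10) ;; c)

/-- Examine one pair of groups. -/
def pairEntry : St :=
  (.set 35 (V 28 / V 12) ;; .set 36 (modE (V 28) (V 12)) ;;
    .set 37 (V 35 / V 11 * V 9) ;; .set 38 (modE (V 35) (V 11)) ;;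
    .set 39 (V 36 / V 11 * V 9) ;; .set 40 (modE (V 36) (V 11)) ;;
    .set 41 0 ;; .set 42 0 ;; .set 43 0) ;;
  walk 1 37 38 44 32 (.set 41 (V 41 + 1)) ;; walk 2 39 40 45 33 (.set 42 (V 42 + 1)) ;;
  walk 1 37 38 44 32 (walk 2 39 40 45 33
    (.ite (adjE (V 32) (V 33))
      (.put 5 (V 18 + V 28) (V 32 * V 5 + V 33 + 1) ;; .set 43 1) .skip)) ;;
  .emit 0 ;; .ite (V 43) (.emit 0 ;; .emit 0)
    (.emit (V 41) ;; .emit (V 42) ;; walk 1 37 38 44 32 (.emit (V 32)) ;;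
      walk 2 39 40 45 33 (.emit (V 33)))

/-- Cut the neighbourhood of the current vertex on side `q` into groups. -/
def groups (q : ℕ) : St :=
  .set 46 0 ;; .set 47 0 ;; .set (47 + q) 0 ;;
  .for 28 (18 + q) (
    .ite (adjE (V 21) (.arr q (V 28 + 1)))
      (.set 46 (V 46 * V 10 + (modE (V 28) (V 9) + 1)) ;; .set 47 (V 47 + 1)) .skip ;;
    .ite (.eq (V 47) (V 8) + .eq (modE (V 28 + 1) (V 9)) 0)
      (.put (2 + q) (V (47 + q)) (V 28 / V 9 * V 11 + V 46) ;; .set (47 + q) (V (47 + q) + 1) ;;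
        .set 46 0 ;; .set 47 0) .skip) ;;
  .put (2 + q) (V (47 + q)) (V (18 + q) / V 9 * V 11 + V 46) ;; .set (47 + q) (V (47 + q) + 1)

/-- Use the rectangles of all pairs of groups of the current vertex. -/
def visit : St :=
  .for 28 48 (.set 50 (V 18 + .arr 3 (V 28) * V 12) ;;
    .for 29 49 (.set 51 (V 50 + .arr 4 (V 29)) ;; .set 52 (.arr 5 (V 51)) ;;
      .ite (V 52) (.set 0 1 ;; .set 1 (V 21) ;; .set 2 ((V 52 - 1) / V 5) ;;
          .set 3 (modE (V 52 - 1) (V 5)))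
        (.emit 1 ;; .emit (V 21) ;; .emit (V 51))))

/-- Treat a subproblem without a dense vertex. -/
def leaf : St :=
  .for 28 13 pairEntry ;; .for 21 5 (groups 1 ;; groups 2 ;; visit) ;; .set 18 (V 18 + V 13)

/-- Treat all subproblems. -/
def mainLoop : St :=
  .loop (.lt (V 16) (V 17))
    (fillSide 1 ;; fillSide 2 ;; search ;; .ite (V 24) split leaf ;; .set 16 (V 16 + 1))

/-- Computation of the parameters from the bit lengths. -/
def params : St :=
  .set 8 (V 6 / (32 * V 7) + 1) ;; .set 9 (.shl 1 (3 * V 7)) ;; .set 10 (V 9 * 2) ;;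
  .set 11 (.shl 1 ((3 * V 7 + 1) * V 8)) ;; .set 12 (V 5 * V 11) ;; .set 13 (V 12 * V 12) ;;
  .set 14 (.shl 1 (V 6 / 4)) ;; .set 15 (256 * (V 7 * V 7))

/-- The parameters, and the initial subproblem. -/
def setup : St :=
  .set 6 1 ;; .set 25 (V 5 / 2) ;; .loop (V 25) (.set 25 (V 25 / 2) ;; .set 6 (V 6 + 1)) ;;
  .set 7 1 ;; .set 25 (V 6 / 2) ;; .loop (V 25) (.set 25 (V 25 / 2) ;; .set 7 (V 7 + 1)) ;;
  params ;; .for 25 5 (.put 0 (V 25) (.inp (1 + V 25))) ;; .set 16 0 ;; .set 17 1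

/-- The whole program in the structured language. -/
def prog : St := setup ;; mainLoop

theorem prog_wf : prog.wf = true := by decide

/-! ### Parameters of a run and the bounds that exclude overflow -/

/-- The numbers on which a run depends. -/
structure Prm where
  W : ℕ
  n : ℕ
  l : ℕ
  g : ℕ
  L : ℕ
  M : ℕ
  R : ℕ
  th : ℕ
  B : ℕ
  I : ℕ → ℕ
  adj : ℕ → ℕ → Bool

namespace Prm

/-- First address above the input. -/
def S (p : Prm) : ℕ := p.n * p.n + p.n + 1
/-- Base of the codes. -/
def K (p : Prm) : ℕ := p.L * 2
/-- Bound for the codes of groups. -/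
def E (p : Prm) : ℕ := p.n * p.M

/-- The parameters fit together and are far below the word bound. -/
structure Good (p : Prm) : Prop where
  adjI : ∀ a < p.n, ∀ u < p.n, p.I (1 + p.n + (a * p.n + u)) = if p.adj a u then 1 else 0
  L2 : 2 ≤ p.L
  MK : p.M = p.K ^ p.g
  g1 : 1 ≤ p.g
  SB : p.S ≤ p.B
  lB : p.l ≤ p.B
  gB : p.g ≤ p.B
  KB : p.K ≤ p.B
  MB : p.M ≤ p.B
  EB : p.E * p.E ≤ p.B
  RB : p.R ≤ p.B
  thB : p.th ≤ p.B
  hW : 100 * (p.B * p.B * (p.B * p.B)) ≤ p.W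

/-- The parameters are stored in the registers. -/
structure Holds (p : Prm) (s : HS) : Prop where
  v5 : s.v 5 = p.n
  v6 : s.v 6 = p.l
  v8 : s.v 8 = p.g
  v9 : s.v 9 = p.L
  v10 : s.v 10 = p.K
  v11 : s.v 11 = p.M
  v12 : s.v 12 = p.E
  v13 : s.v 13 = p.E * p.E
  v14 : s.v 14 = p.R
  v15 : s.v 15 = p.th

variable {p : Prm}

theorem Holds.frame {s s' : HS} {c : St} (h : p.Holds s) (hF : Frame c s s')
    (hc : (c.vmods.all fun r => decide (15 < r ∨ r < 5)) = true) : p.Holds s' := by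
  have key : ∀ r, 5 ≤ r → r ≤ 15 → s'.v r = s.v r := by
    intro r h1 h2
    refine hF.v fun hr => ?_
    have := List.all_eq_true.1 hc r hr
    simp only [decide_eq_true_eq] at this
    omega
  constructor <;> rw [key _ (by norm_num) (by norm_num)]
  exacts [h.v5, h.v6, h.v8, h.v9, h.v10, h.v11, h.v12, h.v13, h.v14, h.v15]

namespace Good

theorem B0 (h : p.Good) : 0 < p.B := lt_of_lt_of_le (by simp [Prm.S]) h.SB
theorem nB (h : p.Good) : p.n ≤ p.B := le_trans (by simp only [Prm.S]; omega) h.SB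
theorem hW3 (h : p.Good) : 100 * (p.B * p.B * p.B) ≤ p.W := by
  have := h.hW
  have h0 := h.B0
  have : p.B * p.B * p.B ≤ p.B * p.B * (p.B * p.B) := Nat.mul_le_mul le_rfl (Nat.le_mul_of_pos_left _ h0)
  omega
theorem hW2 (h : p.Good) : 100 * (p.B * p.B) ≤ p.W := by
  have := h.hW3
  have h0 := h.B0
  have : p.B * p.B ≤ p.B * p.B * p.B := Nat.le_mul_of_pos_right _ h0
  omega
theorem hW1 (h : p.Good) : 100 * p.B ≤ p.W := by
  have := h.hW2
  have h0 := h.B0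
  have : p.B ≤ p.B * p.B := Nat.le_mul_of_pos_right _ h0
  omega
theorem W1 (h : p.Good) : 1 < p.W := by have := h.hW1; have := h.B0; omega
theorem nW (h : p.Good) : p.n < p.W := by have := h.hW1; have := h.nB; have := h.B0; omega
theorem LK (h : p.Good) : p.L < p.K := by have := h.L2; simp only [Prm.K]; omega
theorem M0 (h : p.Good) : 0 < p.M := by
  rw [h.MK]; exact Nat.pow_pos (by have := h.LK; omega)
theorem index (_ : p.Good) {a u : ℕ} (ha : a < p.n) (hu : u < p.n) : a * p.n + u < p.n * p.n := by
  have : (a + 1) * p.n ≤ p.n * p.n := Nat.mul_le_mul_right _ ha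
  rw [Nat.succ_mul] at this
  omega

end Good
end Prm

section adjE
variable {p : Prm} (h : p.Good) {s : HS} {a u : Ex}

theorem adjE_ok {S : ℕ} (h : p.Good) (hS : S = p.S) (h5 : s.v 5 = p.n) (hao : a.ok p.W S p.I s)
    (huo : u.ok p.W S p.I s) (ha : a.val p.I s < p.n) (hu : u.val p.I s < p.n) :
    (adjE a u).ok p.W S p.I s := by
  subst hS
  have h1 := h.index ha hu
  have h2 := h.SB
  have h3 := h.hW1
  have h4 := h.B0
  have h6 : a.val p.I s * p.n ≤ p.n * p.n := Nat.mul_le_mul_right _ ha.le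
  simp only [adjE, Ex.ok_inp, Ex.ok_add, Ex.ok_mul, Ex.ok_var, Ex.ok_lit1, Ex.val_add, Ex.val_mul,
    Ex.val_var, Ex.val_lit1, h5, true_and, Prm.S] at *
  and_intros <;> omega

theorem adjE_val (h : p.Good) (h5 : s.v 5 = p.n) (ha : a.val p.I s < p.n) (hu : u.val p.I s < p.n) :
    (adjE a u).val p.I s = if p.adj (a.val p.I s) (u.val p.I s) then 1 else 0 := by
  rw [← h.adjI _ ha _ hu]
  simp [adjE, h5]

end adjE

/-- Execution with the parameters `p`. -/
abbrev Exec (p : Prm) : St → HS → ℕ → HS → Prop := Big p.W p.S p.I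

/-! ### Sides of a subproblem, degrees, and the search for a dense vertex -/

/-- The list `l` is stored in the array `f` from index `1` on. -/
def Stored (f : ℕ → ℕ) (l : List ℕ) : Prop := l = (List.range l.length).map fun i => f (i + 1)

/-- The vertices with label `q`. -/
def side (n : ℕ) (X : ℕ → ℕ) (q : ℕ) : List ℕ := (List.range n).filter fun v => X v = q

theorem length_side_le (n : ℕ) (X : ℕ → ℕ) (q : ℕ) : (side n X q).length ≤ n :=
  (List.length_filter_le _ _).trans (by simp)

theorem Exec.skip {p : Prm} (h : p.Good) (s : HS) : Exec p .skip s 3 (s.setv 99 0) :=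
  Big.set (e := .lit 0) (by simp [Ex.ok]; have := h.W1; omega)

/-- The last conclusion concerns cells beyond the new side, which may be stale. The table of a leaf
is built for all codes, including some that point to such cells, and these must still hold vertices.
-/
theorem exec_fillSide {p : Prm} (h : p.Good) {s : HS} (hs : p.Holds s) {q : ℕ}
    (hq : q = 1 ∨ q = 2) (hk : s.v 16 * p.n + p.n ≤ p.B) :
    ∃ t s', Exec p (fillSide q) s t s' ∧ t ≤ 200 * (p.n + 1) ∧
      s'.v (18 + q) = (side p.n (fun v => s.a 0 (s.v 16 * p.n + v)) q).length ∧
      Stored (s'.a q) (side p.n (fun v => s.a 0 (s.v 16 * p.n + v)) q) ∧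
      ∀ i, s'.a q i = s.a q i ∨ s'.a q i < p.n := by
  obtain ⟨t, s', hB, ht, ⟨hI1, hI2, hI3⟩, -⟩ := Big.for (W := p.W) (S := p.S) (I := p.I) (i := 25) (b := 5)
    (c := .ite (.eq (.arr 0 (V 16 * V 5 + V 25)) (.lit q))
      (.set (18 + q) (V (18 + q) + 1) ;; .put q (V (18 + q)) (V 25)) .skip)
    (s₀ := s.setv (18 + q) 0) p.n (fun _ => 100)
    (fun j s' => s'.v (18 + q) = (side j (fun v => s.a 0 (s.v 16 * p.n + v)) q).length ∧
      Stored (s'.a q) (side j (fun v => s.a 0 (s.v 16 * p.n + v)) q) ∧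
      ∀ i, s'.a q i = s.a q i ∨ s'.a q i < p.n) h.W1 h.nW
    (by rcases hq with rfl | rfl <;> simp [hs.v5]) (by decide)
    (by rcases hq with rfl | rfl <;> decide) (by rcases hq with rfl | rfl <;> decide)
    (by rcases hq with rfl | rfl <;> simp [side, Stored])
    (by
      intro j hj s1 hF hv25 ⟨h1, h2, h3⟩
      have hlen : (side j (fun v => s.a 0 (s.v 16 * p.n + v)) q).length ≤ j :=
        length_side_le _ _ _
      have h5 : s1.v 5 = p.n := by
        rw [hF.v (by rcases hq with rfl | rfl <;> decide)]
        rcases hq with rfl | rfl <;> simp [hs.v5]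
      have h16 : s1.v 16 = s.v 16 := by
        rw [hF.v (by rcases hq with rfl | rfl <;> decide)]
        rcases hq with rfl | rfl <;> simp
      have h0 : s1.a 0 = s.a 0 := hF.a (by rcases hq with rfl | rfl <;> decide)
      have hSB := h.SB
      have hW := h.hW1
      have hB0 := h.B0
      have hnB := h.nB
      obtain ⟨t, hB, ht⟩ := St.big_run (W := p.W) (S := p.S) (I := p.I) (s := s1)
        (.ite (.eq (.arr 0 (V 16 * V 5 + V 25)) (.lit q))
          (.set (18 + q) (V (18 + q) + 1) ;; .put q (V (18 + q)) (V 25)) .skip) (by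
            have : q < p.W := by omega
            rcases hq with rfl | rfl <;> norm_num at h1 <;>
            simp [St.ok, St.skip, h5, h16, hv25, h0, St.run, this, h1] <;> omega)
      refine ⟨t, _, hB, ht.trans (show _ ≤ 100 by rcases hq with rfl | rfl <;> decide), ?_⟩
      have hrec : side (j + 1) (fun v => s.a 0 (s.v 16 * p.n + v)) q =
          side j (fun v => s.a 0 (s.v 16 * p.n + v)) q ++
            if s.a 0 (s.v 16 * p.n + j) = q then [j] else [] := by
        simp only [side, List.range_succ, List.filter_append]
        congr 1
        by_cases hc : s.a 0 (s.v 16 * p.n + j) = q <;> simp [hc]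
      have hvl : (Ex.lit q).val p.I s1 = q := rfl
      by_cases hc : s.a 0 (s.v 16 * p.n + j) = q
      · rw [hrec, if_pos hc]
        set l := side j (fun v => s.a 0 (s.v 16 * p.n + v)) q
        have h2' : Stored (fun i => if i = l.length + 1 then j else s1.a q i) (l ++ [j]) := by
          unfold Stored at h2 ⊢
          conv_lhs => rw [h2]
          simp only [List.length_append, List.length_singleton, List.range_succ, List.map_append]
          congr 1
          · refine List.map_congr_left fun i hi => ?_
            rw [List.mem_range] at hi
            simp [show i ≠ l.length by omega]
          · simp
        rcases hq with rfl | rfl <;>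
        · simp [St.run, h5, h16, hv25, h0, hc, hvl] at h1 ⊢
          refine ⟨h1, ?_, ?_⟩
          · simpa [Stored, h1] using h2'
          · intro i
            split_ifs with hi
            · exact Or.inr hj
            · exact h3 i
      · rw [hrec, if_neg hc, List.append_nil]
        rcases hq with rfl | rfl <;>
        · simp [St.run, h5, h16, hv25, h0, hc, hvl, St.skip] at h1 ⊢
          exact ⟨h1, h2, h3⟩)
  have hset : Exec p (.set (18 + q) 0) s 3 (s.setv (18 + q) 0) :=
    Big.set (e := .lit 0) (by simp [Ex.ok]; have := h.W1; omega)
  refine ⟨_, s', hset.seq hB, ?_, hI1, hI2, hI3⟩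
  simp only [Finset.sum_const, Finset.card_range, smul_eq_mul] at ht
  omega

/-- The current subproblem has the sides `Ls 1` and `Ls 2`. -/
structure Node (p : Prm) (Ls : ℕ → List ℕ) (s : HS) : Prop extends p.Holds s where
  len : ∀ {q}, q = 1 ∨ q = 2 → s.v (18 + q) = (Ls q).length
  stored : ∀ {q}, q = 1 ∨ q = 2 → Stored (s.a q) (Ls q)
  lt : ∀ {q}, q = 1 ∨ q = 2 → ∀ v ∈ Ls q, v < p.n
  le : ∀ {q}, q = 1 ∨ q = 2 → (Ls q).length ≤ p.n

/-- The code leaves the description of the subproblem alone. -/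
def St.safe (c : St) : Bool :=
  (c.vmods.all fun r => decide ((15 < r ∧ r ≠ 19 ∧ r ≠ 20) ∨ r < 5)) &&
    c.amods.all fun r => decide (r ≠ 1 ∧ r ≠ 2)

section
variable {p : Prm} {Ls : ℕ → List ℕ}

theorem Node.frame {s s' : HS} {c : St} (h : Node p Ls s) (hF : Frame c s s')
    (hc : c.safe = true) : Node p Ls s' := by
  simp only [St.safe, Bool.and_eq_true, List.all_eq_true, decide_eq_true_eq] at hc
  obtain ⟨hv, ha⟩ := hc
  refine ⟨h.toHolds.frame hF ?_, fun {q} hq => ?_, fun {q} hq => ?_, h.lt, h.le⟩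
  · simp only [List.all_eq_true, decide_eq_true_eq]
    intro r hr
    have := hv r hr
    omega
  · rw [hF.v, h.len hq]
    intro hr
    have := hv _ hr
    omega
  · rw [hF.a, ]
    · exact h.stored hq
    · intro hr
      have := ha _ hr
      omega

theorem Stored.get {f : ℕ → ℕ} {l : List ℕ} (h : Stored f l) {j : ℕ} (hj : j < l.length) :
    l[j] = f (j + 1) := by
  have h1 : l[j]? = some (f (j + 1)) := by
    unfold Stored at h
    rw [h]
    simp [hj]
  simpa [hj] using h1

theorem St.for_safe {i b : ℕ} {c : St} (hi : 20 < i) (hc : c.safe = true) :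
    (St.for i b c).safe = true := by
  simp only [St.safe, Bool.and_eq_true, List.all_eq_true, decide_eq_true_eq] at hc ⊢
  refine ⟨fun r hr => ?_, fun r hr => ?_⟩
  · simp only [St.for, St.vmods, List.mem_append, List.mem_singleton] at hr
    rcases hr with rfl | hr | rfl
    · omega
    · exact hc.1 r hr
    · omega
  · simp only [St.for, St.amods, List.nil_append, List.append_nil] at hr
    exact hc.2 r hr

/-- A loop over one side of the current subproblem. -/
theorem Node.for (hp : p.Good) {s₀ : HS} (h : Node p Ls s₀) {q : ℕ} (hq : q = 1 ∨ q = 2) {i : ℕ}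
    {c : St} (τ : ℕ) (Inv : List ℕ → HS → Prop) (hi20 : 20 < i) (hi : i ∉ c.vmods)
    (hc : c.safe = true) (h0 : Inv [] (s₀.setv i 0))
    (hstep : ∀ j x pre, s₀.v (18 + q) = (Ls q).length → j < (Ls q).length → x ∈ Ls q → x < p.n → ∀ s, Frame (.for i (18 + q) c) s₀ s →
      Node p Ls s → s.v i = j → s.a q (j + 1) = x → Inv pre s →
      ∃ t s', Exec p c s t s' ∧ t ≤ τ ∧ Inv (pre ++ [x]) (s'.setv i (j + 1))) :
    ∃ t s', Exec p (.for i (18 + q) c) s₀ t s' ∧ t ≤ (τ + 20) * p.n + 20 ∧ Inv (Ls q) s' ∧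
      Node p Ls s' := by
  have hle := h.le hq
  obtain ⟨t, s', hB, ht, hI, -⟩ := Big.for (W := p.W) (S := p.S) (I := p.I) (i := i) (b := 18 + q)
    (c := c) (s₀ := s₀) (Ls q).length (fun _ => τ) (fun j s => Inv ((Ls q).take j) s) hp.W1
    (hle.trans_lt hp.nW) (h.len hq) (by omega) hi (by
      intro hr
      simp only [St.safe, Bool.and_eq_true, List.all_eq_true, decide_eq_true_eq] at hc
      have := hc.1 _ hr
      omega) (by simpa using h0)
    (by
      intro j hj s hF hv hI
      have hN := h.frame hF (St.for_safe hi20 hc)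
      have hx := (hN.stored hq).get hj
      have hm : (Ls q)[j] ∈ Ls q := List.getElem_mem hj
      obtain ⟨t, s', hB, ht, hI'⟩ := hstep j (Ls q)[j] _ (h.len hq) hj hm (h.lt hq _ hm) s hF hN hv hx.symm hI
      refine ⟨t, s', hB, ht, ?_⟩
      rwa [List.take_succ_eq_append_getElem hj])
  refine ⟨t, s', hB, ht.trans ?_, by simpa using hI, h.frame hB.frame (St.for_safe hi20 hc)⟩
  simp only [Finset.sum_const, Finset.card_range, smul_eq_mul]
  have : (Ls q).length * (τ + 20) ≤ p.n * (τ + 20) := Nat.mul_le_mul_right _ hle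
  linarith

/-- Degree of `a` into a list. -/
def Prm.deg (p : Prm) (a : ℕ) (l : List ℕ) : ℕ := l.countP (p.adj a)

theorem Prm.deg_le (p : Prm) (a : ℕ) (l : List ℕ) : p.deg a l ≤ l.length := List.countP_le_length

theorem exec_degree (hp : p.Good) {s : HS} (h : Node p Ls s) {q : ℕ} (hq : q = 1 ∨ q = 2)
    (ha : s.v 21 < p.n) :
    ∃ t s', Exec p (degree q) s t s' ∧ t ≤ 200 * (p.n + 1) ∧
      s'.v (21 + q) = p.deg (s.v 21) (Ls q) ∧ Node p Ls s' := by
  have h1W := hp.W1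
  have hset : Exec p (.set (21 + q) 0) s 3 (s.setv (21 + q) 0) :=
    Big.set (e := 0) (by simp; omega)
  have h' : Node p Ls (s.setv (21 + q) 0) := h.frame hset.frame (by rcases hq with rfl | rfl <;> decide)
  obtain ⟨t, s', hB, ht, hI, hN⟩ := h'.for hp hq (i := 28)
    (c := .ite (adjE (V 21) (.arr q (V 28 + 1))) (.set (21 + q) (V (21 + q) + 1)) .skip) 100
    (fun pre s' => s'.v (21 + q) = p.deg (s.v 21) pre ∧ pre.length ≤ s'.v 28) (by norm_num)
    (by rcases hq with rfl | rfl <;> decide) (by rcases hq with rfl | rfl <;> decide)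
    (by rcases hq with rfl | rfl <;> simp [Prm.deg])
    (by
      intro j x pre _ hj hx hxn s1 hF hN hv hax ⟨hd, hl⟩
      have hjn := (hj.trans_le (h.le hq))
      have hdl := p.deg_le (s.v 21) pre
      have h21 : s1.v 21 = s.v 21 := by
        rw [hF.v (by rcases hq with rfl | rfl <;> decide)]
        rcases hq with rfl | rfl <;> simp
      have hW := hp.hW1
      have hB0 := hp.B0
      have hnB := hp.nB
      have hSB := hp.SB
      have hq8 : q < 8 := by omega
      have hao : (adjE (V 21) (.arr q (V 28 + 1))).ok p.W p.S p.I s1 := by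
        refine adjE_ok hp rfl hN.v5 (by simp) ?_ (by simpa [h21]) (by simpa [hv, hax])
        simp [hv, hq8]; omega
      have hav := adjE_val (a := V 21) (u := .arr q (V 28 + 1)) hp hN.v5 (by simpa [h21])
        (by simpa [hv, hax])
      simp only [Ex.val_var, Ex.val_arr, Ex.val_add, Ex.val_lit1, hv, hax, h21] at hav
      obtain ⟨t, hB, ht⟩ := St.big_run (W := p.W) (S := p.S) (I := p.I) (s := s1)
        (.ite (adjE (V 21) (.arr q (V 28 + 1))) (.set (21 + q) (V (21 + q) + 1)) .skip) (by
          refine ⟨hao, fun _ => ?_, fun _ => ?_⟩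
          · simp [St.ok, hd]; omega
          · simp [St.skip, St.ok]; omega)
      refine ⟨t, _, hB, ht.trans (show _ ≤ 100 by rcases hq with rfl | rfl <;> decide), ?_⟩
      simp only [St.run, hav, Prm.deg, List.countP_append, List.countP_cons, List.countP_nil] at hd ⊢
      by_cases hc : p.adj (s.v 21) x = true
      · rcases hq with rfl | rfl <;> simp [hc] at hd ⊢ <;> omega
      · rcases hq with rfl | rfl <;> simp [hc, St.skip, St.run] at hd ⊢ <;> omega)
  exact ⟨_, s', hset.seq hB, by omega, hI.1, hN⟩

/-- Density is tested without division: with θ = `th / l`, the condition is `th² |B'||C'| ≤ d₁ d₂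
l²`. Subproblems of area below `n² / R` are not searched, so they become leaves even if they contain
a dense vertex; the inner disjunction keeps the two reasons for being a leaf apart. -/
theorem exec_search (hp : p.Good) {s : HS} (h : Node p Ls s) :
    ∃ t s', Exec p search s t s' ∧ t ≤ 1000 * ((p.n + 1) * (p.n + 1)) ∧ Node p Ls s' ∧
      ((s'.v 24 = 0 ∧ ((Ls 1).length * (Ls 2).length * p.R < p.n * p.n ∨
          ∀ a < p.n, p.deg a (Ls 1) * p.deg a (Ls 2) * (p.l * p.l) <
            p.th * p.th * ((Ls 1).length * (Ls 2).length))) ∨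
        ∃ a < p.n, s'.v 24 = a + 1 ∧ p.n * p.n ≤ (Ls 1).length * (Ls 2).length * p.R ∧
          p.th * p.th * ((Ls 1).length * (Ls 2).length) ≤
            p.deg a (Ls 1) * p.deg a (Ls 2) * (p.l * p.l)) := by
  have h1W := hp.W1
  have hset : Exec p (.set 24 0) s 3 (s.setv 24 0) := Big.set (e := 0) (by simp; omega)
  have h' : Node p Ls (s.setv 24 0) := h.frame hset.frame (by decide)
  have h19 : (s.setv 24 0).v 19 = (Ls 1).length := h'.len (q := 1) (by simp)
  have h20 : (s.setv 24 0).v 20 = (Ls 2).length := h'.len (q := 2) (by simp)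
  have hl1 := (h.le (q := 1) (by simp)).trans hp.nB
  have hl2 := (h.le (q := 2) (by simp)).trans hp.nB
  have hl12 := Nat.mul_le_mul hl1 hl2
  have hW2 := hp.hW2
  have hW3 := hp.hW3
  have hW4 := hp.hW
  have hB0 := hp.B0
  have hB2 : 0 < p.B * p.B := Nat.mul_pos hB0 hB0
  have hB3 : 0 < p.B * p.B * p.B := Nat.mul_pos hB2 hB0
  have hB4 : 0 < p.B * p.B * (p.B * p.B) := Nat.mul_pos hB2 hB2
  have hnn := Nat.mul_le_mul hp.nB hp.nB
  have hok : (Ex.lt (V 19 * V 20 * V 14) (V 5 * V 5)).ok p.W p.S p.I (s.setv 24 0) := by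
    have := Nat.mul_le_mul hl12 hp.RB
    simp only [Ex.ok_lt, Ex.ok_mul, Ex.ok_var, Ex.val_mul, Ex.val_var, h19, h20, h'.v14, h'.v5,
      true_and]
    omega
  have hval : (Ex.lt (V 19 * V 20 * V 14) (V 5 * V 5)).val p.I (s.setv 24 0) =
      if (Ls 1).length * (Ls 2).length * p.R < p.n * p.n then 1 else 0 := by
    simp only [Ex.val_lt, Ex.val_mul, Ex.val_var, h19, h20, h'.v14, h'.v5]
  by_cases hsmall : (Ls 1).length * (Ls 2).length * p.R < p.n * p.n
  · have h2 := Big.ite_pos hok (by simp [hval, hsmall]) (Exec.skip hp (s.setv 24 0))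
      (d := (.for 21 5 (degree 1 ;; degree 2 ;;
      .ite (.lt (V 22 * V 23 * (V 6 * V 6)) (V 15 * V 15 * (V 19 * V 20))) .skip
        (.set 24 (V 21 + 1)))))
    refine ⟨_, _, hset.seq h2, ?_, h'.frame h2.frame (by decide), Or.inl ⟨by simp, Or.inl hsmall⟩⟩
    have : (Ex.lt (V 19 * V 20 * V 14) (V 5 * V 5)).cost = 17 := by decide
    have : 0 < (p.n + 1) * (p.n + 1) := by positivity
    omega
  obtain ⟨t, s', hB, ht, hI, -⟩ := Big.for (W := p.W) (S := p.S) (I := p.I) (i := 21) (b := 5)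
    (c := (degree 1 ;; degree 2 ;;
      .ite (.lt (V 22 * V 23 * (V 6 * V 6)) (V 15 * V 15 * (V 19 * V 20))) .skip
        (.set 24 (V 21 + 1))))
    (s₀ := s.setv 24 0) p.n (fun _ => 600 * (p.n + 1)) (fun j s' =>
      (s'.v 24 = 0 ∧ ∀ a < j, p.deg a (Ls 1) * p.deg a (Ls 2) * (p.l * p.l) <
            p.th * p.th * ((Ls 1).length * (Ls 2).length)) ∨
        ∃ a < p.n, s'.v 24 = a + 1 ∧
          p.th * p.th * ((Ls 1).length * (Ls 2).length) ≤
            p.deg a (Ls 1) * p.deg a (Ls 2) * (p.l * p.l)) h1W hp.nW h'.v5 (by decide) (by decide)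
    (by decide) (by simp) (by
      intro j hj s1 hF hv hI
      have hN1 := h'.frame hF (by decide)
      obtain ⟨t1, s2, hB1, ht1, hd1, hN2⟩ := exec_degree hp hN1 (q := 1) (by simp) (by omega)
      have h21 : s2.v 21 = j := by rw [hB1.frame.v (by decide), hv]
      obtain ⟨t2, s3, hB2, ht2, hd2, hN3⟩ := exec_degree hp hN2 (q := 2) (by simp) (by omega)
      have h21' : s3.v 21 = j := by rw [hB2.frame.v (by decide), h21]
      have h22 : s3.v 22 = p.deg j (Ls 1) := by rw [hB2.frame.v (by decide), hd1, hv]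
      have h23 : s3.v 23 = p.deg j (Ls 2) := by rw [hd2, h21]
      have h19 : s3.v 19 = (Ls 1).length := hN3.len (q := 1) (by simp)
      have h20 : s3.v 20 = (Ls 2).length := hN3.len (q := 2) (by simp)
      have h24 : s3.v 24 = s1.v 24 := by rw [hB2.frame.v (by decide), hB1.frame.v (by decide)]
      -- Both sides of the comparison are products of four numbers bounded by `B`; this is what the
      -- fourth power in `Good.hW` is for.
      have e1 := Nat.mul_le_mul ((p.deg_le j (Ls 1)).trans hl1) ((p.deg_le j (Ls 2)).trans hl2)
      have e2 := Nat.mul_le_mul hp.lB hp.lB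
      have e3 := Nat.mul_le_mul e1 e2
      have e4 := Nat.mul_le_mul hp.thB hp.thB
      have e5 := Nat.mul_le_mul e4 hl12
      have hW1 := hp.hW1
      have hnB := hp.nB
      obtain ⟨t3, hB3, ht3⟩ := St.big_run (W := p.W) (S := p.S) (I := p.I) (s := s3)
        (.ite (.lt (V 22 * V 23 * (V 6 * V 6)) (V 15 * V 15 * (V 19 * V 20))) .skip
        (.set 24 (V 21 + 1))) (by
          simp only [St.ok, St.skip, Ex.ok_lt, Ex.ok_mul, Ex.ok_var, Ex.val_mul, Ex.val_var, h19, h20,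
            h22, h23, hN3.v6, hN3.v15, Ex.ok_lit0, Ex.ok_add, Ex.ok_lit1, Ex.val_lit1, h21', true_and]
          and_intros <;> omega)
      refine ⟨_, _, hB1.seq (hB2.seq hB3), ?_, ?_⟩
      · have : (St.ite (.lt (V 22 * V 23 * (V 6 * V 6)) (V 15 * V 15 * (V 19 * V 20))) .skip
          (.set 24 (V 21 + 1))).cost ≤ 100 := by decide
        omega
      · by_cases hc : p.deg j (Ls 1) * p.deg j (Ls 2) * (p.l * p.l) <
            p.th * p.th * ((Ls 1).length * (Ls 2).length)
        · simp [St.run, h22, h23, hN3.v6, hN3.v15, h19, h20, hc, St.skip, h24]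
          rcases hI with ⟨hI1, hI2⟩ | hI
          · left
            refine ⟨hI1, fun a ha => ?_⟩
            rcases Nat.le_iff_lt_or_eq.1 ha with ha | rfl
            exacts [hI2 a ha, hc]
          · right; exact hI
        · right
          refine ⟨j, hj, ?_, by omega⟩
          simp [St.run, h22, h23, hN3.v6, hN3.v15, h19, h20, hc, h21'])
  have h2 := Big.ite_neg hok (by simp [hval, hsmall]) hB (c := .skip)
  refine ⟨_, _, hset.seq h2, ?_, h'.frame h2.frame (by decide), ?_⟩
  · have : (Ex.lt (V 19 * V 20 * V 14) (V 5 * V 5)).cost = 17 := by decide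
    simp only [Finset.sum_const, Finset.card_range, smul_eq_mul] at ht
    nlinarith
  · rcases hI with ⟨h1, h2⟩ | ⟨a, ha, h1, h2⟩
    · exact Or.inl ⟨h1, Or.inr h2⟩
    · exact Or.inr ⟨a, ha, h1, by omega, h2⟩

end

/-! ### Record entries and the split at a dense vertex -/

/-- Entries of the record, with vertices as natural numbers. -/
inductive Entry where
  | rect (S T : List ℕ)
  | use (a j : ℕ)

/-- The words that represent an entry. -/
def Entry.encode : Entry → List ℕ
  | .rect S T => 0 :: S.length :: T.length :: (S ++ T)
  | .use a j => [1, a, j]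

/-- The cost of an entry. -/
def Entry.cost : Entry → ℕ
  | .rect S T => S.length * T.length
  | .use _ _ => 1

/-- The answer register is `0` or `1`, and `1` is justified. -/
structure Ans (p : Prm) (s : HS) : Prop where
  le : s.v 0 ≤ 1
  tri : s.v 0 = 1 → s.v 1 < p.n ∧ s.v 2 < p.n ∧ s.v 3 < p.n ∧ p.adj (s.v 1) (s.v 2) = true ∧
    p.adj (s.v 1) (s.v 3) = true ∧ p.adj (s.v 2) (s.v 3) = true

theorem Ans.congr {p : Prm} {s s' : HS} (h : Ans p s) (h0 : ∀ r < 4, s'.v r = s.v r) : Ans p s' := by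
  have h1 := h0 1 (by norm_num)
  have h2 := h0 2 (by norm_num)
  have h3 := h0 3 (by norm_num)
  have h4 := h0 0 (by norm_num)
  exact ⟨by rw [h4]; exact h.le, by rw [h1, h2, h3, h4]; exact h.tri⟩

theorem Ans.setv {p : Prm} {s : HS} (h : Ans p s) {r x : ℕ} (hr : 4 ≤ r) : Ans p (s.setv r x) :=
  h.congr fun i hi => by simp [show i ≠ r by omega]

theorem Ans.frame {p : Prm} {s s' : HS} {c : St} (h : Ans p s) (hF : Frame c s s')
    (hc : (c.vmods.all fun r => decide (4 ≤ r)) = true) : Ans p s' :=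
  h.congr fun i hi => hF.v fun hm => by
    have := List.all_eq_true.1 hc i hm
    simp only [decide_eq_true_eq] at this
    omega

section
variable {p : Prm} {Ls : ℕ → List ℕ}

theorem exec_emitNbrs (hp : p.Good) {s : HS} (h : Node p Ls s) {q : ℕ} (hq : q = 1 ∨ q = 2)
    (ha : s.v 21 < p.n) :
    ∃ t s', Exec p (emitNbrs q) s t s' ∧ t ≤ 200 * (p.n + 1) ∧
      s'.out = s.out ++ (Ls q).filter (p.adj (s.v 21)) ∧ Node p Ls s' := by
  obtain ⟨t, s', hB, ht, hI, hN⟩ := h.for hp hq (i := 28)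
    (c := .ite (adjE (V 21) (.arr q (V 28 + 1))) (.emit (.arr q (V 28 + 1))) .skip) 100
    (fun pre s' => s'.out = s.out ++ pre.filter (p.adj (s.v 21))) (by norm_num)
    (by rcases hq with rfl | rfl <;> decide) (by rcases hq with rfl | rfl <;> decide) (by simp)
    (by
      intro j x pre _ hj hx hxn s1 hF hN hv hax hout
      have hjn := (hj.trans_le (h.le hq))
      have h21 : s1.v 21 = s.v 21 := hF.v (by rcases hq with rfl | rfl <;> decide)
      have hW := hp.hW1
      have hB0 := hp.B0
      have hnB := hp.nB
      have hSB := hp.SB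
      have hq8 : q < 8 := by omega
      have hao : (adjE (V 21) (.arr q (V 28 + 1))).ok p.W p.S p.I s1 := by
        refine adjE_ok hp rfl hN.v5 (by simp) ?_ (by simpa [h21]) (by simpa [hv, hax])
        simp [hv, hq8]; omega
      have hav := adjE_val (a := V 21) (u := .arr q (V 28 + 1)) hp hN.v5 (by simpa [h21])
        (by simpa [hv, hax])
      simp only [Ex.val_var, Ex.val_arr, Ex.val_add, Ex.val_lit1, hv, hax, h21] at hav
      obtain ⟨t, hB, ht⟩ := St.big_run (W := p.W) (S := p.S) (I := p.I) (s := s1)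
        (.ite (adjE (V 21) (.arr q (V 28 + 1))) (.emit (.arr q (V 28 + 1))) .skip) (by
          refine ⟨hao, fun _ => ?_, fun _ => ?_⟩
          · simp [St.ok, hv, hq8]; omega
          · simp [St.skip, St.ok]; omega)
      refine ⟨t, _, hB, ht.trans (show _ ≤ 100 by rcases hq with rfl | rfl <;> decide), ?_⟩
      by_cases hc : p.adj (s.v 21) x = true
      · simp [St.run, hav, hc, hout, hv, hax]
      · simp [St.run, hav, hc, hout, St.skip])
  exact ⟨t, s', hB, by omega, hI, hN⟩

/-- An edge between the two neighbourhoods forms a triangle with the current vertex. Register `0` is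
never reset, so a final `0` means that neither this search nor an earlier one met an edge. -/
theorem exec_checkNbrs (hp : p.Good) {s : HS} (h : Node p Ls s) (hA : Ans p s)
    (ha : s.v 21 < p.n) :
    ∃ t s', Exec p checkNbrs s t s' ∧ t ≤ 1000 * ((p.n + 1) * (p.n + 1)) ∧ Node p Ls s' ∧ Ans p s' ∧
      (s'.v 0 = 0 → s.v 0 = 0 ∧ ∀ u ∈ Ls 1, p.adj (s.v 21) u = true → ∀ v ∈ Ls 2,
        p.adj (s.v 21) v = true → p.adj u v = false) := by
  have hW := hp.hW1
  have hB0 := hp.B0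
  have hnB := hp.nB
  have hSB := hp.SB
  obtain ⟨t, s', hB, ht, hI, hN⟩ := h.for hp (q := 1) (by simp) (i := 28)
    (c := (.set 32 (.arr 1 (V 28 + 1)) ;; .ite (adjE (V 21) (V 32))
    (.for 29 20 (.set 33 (.arr 2 (V 29 + 1)) ;; .ite (adjE (V 21) (V 33))
      (.ite (adjE (V 32) (V 33)) (.set 0 1 ;; .set 1 (V 21) ;; .set 2 (V 32) ;; .set 3 (V 33)) .skip)
      .skip)) .skip)) (300 * (p.n + 1))
    (fun pre s' => Ans p s' ∧ (s'.v 0 = 0 → s.v 0 = 0 ∧ ∀ u ∈ pre, p.adj (s.v 21) u = true →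
      ∀ v ∈ Ls 2, p.adj (s.v 21) v = true → p.adj u v = false)) (by norm_num)
    (by decide) (by decide) ⟨hA.setv (by norm_num), by simp⟩
    (by
      intro j x pre _ hj hx hxn s1 hF hN hv hax ⟨hA1, hI1⟩
      have hjn := hj.trans_le (h.le (by simp))
      have h21 : s1.v 21 = s.v 21 := hF.v (by decide)
      have hset : Exec p (.set 32 (.arr 1 (V 28 + 1))) s1 _ _ := Big.set (by simp [hv]; omega)
      simp only [Ex.val_arr, Ex.val_add, Ex.val_var, hv, Ex.val_lit1, hax] at hset
      have hN2 := hN.frame hset.frame (by decide)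
      have hA2 := hA1.setv (r := 32) (x := x) (by norm_num)
      have hI2 : (s1.setv 32 x).v 0 = 0 → s.v 0 = 0 ∧ ∀ u ∈ pre, p.adj (s.v 21) u = true →
        ∀ v ∈ Ls 2, p.adj (s.v 21) v = true → p.adj u v = false := by simpa using hI1
      have h21' : (s1.setv 32 x).v 21 = s.v 21 := by simp [h21]
      have h32' : (s1.setv 32 x).v 32 = x := by simp
      generalize s1.setv 32 x = s2 at *
      have hao : (adjE (V 21) (V 32)).ok p.W p.S p.I s2 :=
        adjE_ok hp rfl hN2.v5 (by simp) (by simp) (by simpa [h21']) (by simpa [h32'])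
      have hav := adjE_val (a := V 21) (u := V 32) hp hN2.v5 (by simpa [h21']) (by simpa [h32'])
      simp only [Ex.val_var, h21', h32'] at hav
      have hc1 : (adjE (V 21) (V 32)).cost = 19 := by decide
      have hc2 : (Ex.arr 1 (V 28 + 1)).cost = 17 := by decide
      by_cases hax' : p.adj (s.v 21) x = true
      swap
      · have h3 := Big.ite_neg (c := (.for 29 20 (.set 33 (.arr 2 (V 29 + 1)) ;; .ite (adjE (V 21) (V 33))
          (.ite (adjE (V 32) (V 33)) (.set 0 1 ;; .set 1 (V 21) ;; .set 2 (V 32) ;; .set 3 (V 33)) .skip)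
          .skip))) hao (by simp [hav, hax']) (Exec.skip hp s2)
        refine ⟨_, _, hset.seq h3, by omega, (hA2.setv (by norm_num)).setv (by norm_num), ?_⟩
        simp only [HS.setv_v]
        intro h0
        obtain ⟨h4, h5⟩ := hI2 h0
        refine ⟨h4, fun u hu => ?_⟩
        rw [List.mem_append, List.mem_singleton] at hu
        rcases hu with hu | rfl
        · exact h5 u hu
        · exact fun h6 => absurd h6 hax'
      obtain ⟨t3, s3, hB3, ht3, ⟨hI3, hI3'⟩, hN3⟩ := hN2.for hp (q := 2) (by simp) (i := 29)
        (c := (.set 33 (.arr 2 (V 29 + 1)) ;; .ite (adjE (V 21) (V 33))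
          (.ite (adjE (V 32) (V 33)) (.set 0 1 ;; .set 1 (V 21) ;; .set 2 (V 32) ;; .set 3 (V 33)) .skip)
          .skip)) 150
        (fun pre s' => Ans p s' ∧ (s'.v 0 = 0 → s2.v 0 = 0 ∧ 
          ∀ v ∈ pre, p.adj (s.v 21) v = true → p.adj x v = false)) (by norm_num)
        (by decide) (by decide) ⟨hA2.setv (by norm_num), by simp⟩
        (by
          intro j y pre _ hj hy hyn s3 hF hN3 hv3 hay ⟨hA3, hI3⟩
          have hjn := hj.trans_le (h.le (by simp))
          have hset : Exec p (.set 33 (.arr 2 (V 29 + 1))) s3 _ _ := Big.set (by simp [hv3]; omega)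
          simp only [Ex.val_arr, Ex.val_add, Ex.val_var, hv3, Ex.val_lit1, hay] at hset
          have h21'' : s3.v 21 = s.v 21 := by rw [hF.v (by decide), h21']
          have h32'' : s3.v 32 = x := by rw [hF.v (by decide), h32']
          have hN4 := hN3.frame hset.frame (by decide)
          have hA4 := hA3.setv (r := 33) (x := y) (by norm_num)
          have hI4 : (s3.setv 33 y).v 0 = 0 → s2.v 0 = 0 ∧ 
            ∀ v ∈ pre, p.adj (s.v 21) v = true → p.adj x v = false := by simpa using hI3
          have g21 : (s3.setv 33 y).v 21 = s.v 21 := by simp [h21'']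
          have g32 : (s3.setv 33 y).v 32 = x := by simp [h32'']
          have g33 : (s3.setv 33 y).v 33 = y := by simp
          generalize s3.setv 33 y = s4 at *
          have hao1 : (adjE (V 21) (V 33)).ok p.W p.S p.I s4 :=
            adjE_ok hp rfl hN4.v5 (by simp) (by simp) (by simpa [g21]) (by simpa [g33])
          have hav1 := adjE_val (a := V 21) (u := V 33) hp hN4.v5 (by simpa [g21]) (by simpa [g33])
          simp only [Ex.val_var, g21, g33] at hav1
          have hao2 : (adjE (V 32) (V 33)).ok p.W p.S p.I s4 :=
            adjE_ok hp rfl hN4.v5 (by simp) (by simp) (by simpa [g32]) (by simpa [g33])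
          have hav2 := adjE_val (a := V 32) (u := V 33) hp hN4.v5 (by simpa [g32]) (by simpa [g33])
          simp only [Ex.val_var, g32, g33] at hav2
          obtain ⟨t, hB, ht⟩ := St.big_run (W := p.W) (S := p.S) (I := p.I) (s := s4)
            (.ite (adjE (V 21) (V 33)) (.ite (adjE (V 32) (V 33))
              (.set 0 1 ;; .set 1 (V 21) ;; .set 2 (V 32) ;; .set 3 (V 33)) .skip) .skip) (by
              refine ⟨hao1, fun _ => ⟨hao2, fun _ => ?_, fun _ => ?_⟩, fun _ => ?_⟩ <;>
              simp [St.ok, St.skip] <;> omega)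
          have hc3 : (St.ite (adjE (V 21) (V 33)) (.ite (adjE (V 32) (V 33))
              (.set 0 1 ;; .set 1 (V 21) ;; .set 2 (V 32) ;; .set 3 (V 33)) .skip) .skip).cost ≤ 100 := by
            decide
          have hc4 : (Ex.arr 2 (V 29 + 1)).cost = 17 := by decide
          refine ⟨_, _, hset.seq hB, by omega, ?_⟩
          by_cases h1 : p.adj (s.v 21) y = true
          · by_cases h2 : p.adj x y = true
            · simp only [St.run, hav1, hav2, h1, h2, if_true, ne_eq, one_ne_zero, not_false_eq_true,
                Ex.val_lit1, Ex.val_var, HS.setv_v]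
              norm_num
              refine ⟨by simp, ?_⟩
              simp [g21, g32, g33, ha, hxn, hyn, h1, h2, hax']
            · simp only [St.run, hav1, hav2, h1, h2, if_true, ne_eq, one_ne_zero, not_false_eq_true,
                not_true_eq_false, if_false, Bool.false_eq_true, St.skip]
              refine ⟨(hA4.setv (by norm_num)).setv (by norm_num), ?_⟩
              intro h0
              obtain ⟨h5, h6⟩ := hI4 (by simpa using h0)
              refine ⟨h5, fun v hv => ?_⟩
              rw [List.mem_append, List.mem_singleton] at hv
              rcases hv with hv | rfl
              · exact h6 v hv
              · exact fun _ => by simpa using h2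
          · simp only [St.run, hav1, h1, ne_eq,
                not_true_eq_false, if_false, Bool.false_eq_true, St.skip]
            refine ⟨(hA4.setv (by norm_num)).setv (by norm_num), ?_⟩
            intro h0
            obtain ⟨h5, h6⟩ := hI4 (by simpa using h0)
            refine ⟨h5, fun v hv => ?_⟩
            rw [List.mem_append, List.mem_singleton] at hv
            rcases hv with hv | rfl
            · exact h6 v hv
            · exact fun h7 => absurd h7 h1)
      have h3 := Big.ite_pos (d := .skip) hao (by simp [hav, hax']) hB3
      refine ⟨_, _, hset.seq h3, by omega, hI3.setv (by norm_num), ?_⟩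
      simp only [HS.setv_v]
      intro h0
      obtain ⟨h4, h5⟩ := hI3' h0
      obtain ⟨h6, h7⟩ := hI2 h4
      refine ⟨h6, fun u hu => ?_⟩
      rw [List.mem_append, List.mem_singleton] at hu
      rcases hu with hu | rfl
      · exact h7 u hu
      · exact fun _ => h5)
  refine ⟨t, s', hB, ht.trans ?_, hN, hI⟩
  nlinarith

theorem exec_useAll (hp : p.Good) {s : HS} (h : p.Holds s) :
    ∃ t s', Exec p useAll s t s' ∧ t ≤ 200 * (p.n + 1) ∧
      s'.out = s.out ++ ((List.range p.n).map fun v => Entry.use v (s.v 18)).flatMap Entry.encode := by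
  have hW := hp.hW1
  have hB0 := hp.B0
  obtain ⟨t, s', hB, ht, hI, -⟩ := Big.for (W := p.W) (S := p.S) (I := p.I) (i := 25) (b := 5)
    (c := (.emit 1 ;; .emit (V 25) ;; .emit (V 18)))
    (s₀ := s) p.n (fun _ => 100) (fun j s' => s'.out = s.out ++
      ((List.range j).map fun v => Entry.use v (s.v 18)).flatMap Entry.encode) hp.W1 hp.nW h.v5
    (by decide) (by decide) (by decide) (by simp) (by
      intro j hj s1 hF hv hI
      obtain ⟨t, hB, ht⟩ := St.big_run (W := p.W) (S := p.S) (I := p.I) (s := s1)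
        (.emit 1 ;; .emit (V 25) ;; .emit (V 18)) (by simp [St.ok]; omega)
      refine ⟨t, _, hB, ht.trans (by decide), ?_⟩
      have h18 : s1.v 18 = s.v 18 := hF.v (by decide)
      simp [St.run, hI, List.range_succ, Entry.encode, hv, h18])
  refine ⟨t, s', hB, ht.trans ?_, hI⟩
  simp only [Finset.sum_const, Finset.card_range, smul_eq_mul]
  omega

/-- New label of a vertex in the first part of a split. -/
def child₁ (x y f : ℕ) : ℕ :=
  x * if (if x = 1 then 1 else 0) + (if y = f then 1 else 0) = 1 then 1 else 0

/-- New label of a vertex in the second part of a split. -/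
def child₂ (x y f : ℕ) : ℕ :=
  if y = 0 then x else x * if (if x = 1 then 1 else 0) = f then 1 else 0

/-- Which of the two sides is split. -/
def Prm.flag (p : Prm) (Ls : ℕ → List ℕ) (a : ℕ) : ℕ :=
  if p.deg a (Ls 1) * p.l < p.th * (Ls 1).length then 0 else 1

theorem exec_children (hp : p.Good) {s : HS} (h : Node p Ls s) (ha : s.v 21 < p.n)
    (h22 : s.v 22 = p.deg (s.v 21) (Ls 1)) (hcnt : (s.v 17 + 2) * p.n ≤ p.B)
    (hcB : s.v 17 + 2 ≤ p.B)
    (hk : s.v 16 < s.v 17) (hX : ∀ v < p.n, s.a 0 (s.v 16 * p.n + v) ≤ 2) :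
    ∃ t s', Exec p children s t s' ∧ t ≤ 500 * (p.n + 1) ∧ s'.v 17 = s.v 17 + 2 ∧
      (∀ i < s.v 17 * p.n, s'.a 0 i = s.a 0 i) ∧
      (∀ v < p.n, s'.a 0 (s.v 17 * p.n + v) = child₁ (s.a 0 (s.v 16 * p.n + v))
        (if p.adj (s.v 21) v then 1 else 0) (p.flag Ls (s.v 21))) ∧
      ∀ v < p.n, s'.a 0 ((s.v 17 + 1) * p.n + v) = child₂ (s.a 0 (s.v 16 * p.n + v))
        (if p.adj (s.v 21) v then 1 else 0) (p.flag Ls (s.v 21)) := by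
  have hW := hp.hW1
  have hW2 := hp.hW2
  have hB0 := hp.B0
  have hnB := hp.nB
  have hSB := hp.SB
  have h19 : s.v 19 = (Ls 1).length := h.len (q := 1) (by simp)
  have hl1 := (h.le (q := 1) (by simp)).trans hp.nB
  obtain ⟨t1, hB1, ht1⟩ := St.big_run (W := p.W) (S := p.S) (I := p.I) (s := s)
    (.ite (.lt (V 22 * V 6) (V 15 * V 19)) (.set 27 0) (.set 27 1)) (by
      have e1 := Nat.mul_le_mul ((p.deg_le (s.v 21) (Ls 1)).trans hl1) hp.lB
      have e2 := Nat.mul_le_mul hp.thB hl1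
      have : 0 < p.B * p.B := Nat.mul_pos hB0 hB0
      simp only [St.ok, Ex.ok_lt, Ex.ok_mul, Ex.ok_var, Ex.val_var, h22, h.v6, h.v15, h19,
        Ex.ok_lit0, Ex.ok_lit1, true_and]
      omega)
  have hs1 : St.run p.I (.ite (.lt (V 22 * V 6) (V 15 * V 19)) (.set 27 0) (.set 27 1)) s =
      s.setv 27 (p.flag Ls (s.v 21)) := by
    simp only [St.run, Ex.val_lt, Ex.val_mul, Ex.val_var, h22, h.v6, h.v15, h19, Prm.flag,
      Ex.val_lit0, Ex.val_lit1]
    split_ifs <;> simp_all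
  rw [hs1] at hB1
  set fl := p.flag Ls (s.v 21) with hfl
  have hsm : (s.v 17 + 2) * p.n = s.v 17 * p.n + 2 * p.n := by ring
  have hsm1 : (s.v 17 + 1) * p.n = s.v 17 * p.n + p.n := by ring
  -- The row of labels being read lies entirely below the two rows being written.
  have hkm : s.v 16 * p.n + p.n ≤ s.v 17 * p.n := by
    rw [← Nat.succ_mul]; exact Nat.mul_le_mul_right _ hk
  obtain ⟨t, s', hB, ht, hI, -⟩ := Big.for (W := p.W) (S := p.S) (I := p.I) (i := 25) (b := 5)
    (c := (.set 26 (.arr 0 (V 16 * V 5 + V 25)) ;; .set 30 (adjE (V 21) (V 25)) ;;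
      .put 0 (V 17 * V 5 + V 25) (V 26 * .eq (.eq (V 26) 1 + .eq (V 30) (V 27)) 1) ;;
      .ite (V 30) (.put 0 ((V 17 + 1) * V 5 + V 25) (V 26 * .eq (.eq (V 26) 1) (V 27)))
        (.put 0 ((V 17 + 1) * V 5 + V 25) (V 26))))
    (s₀ := s.setv 27 fl) p.n (fun _ => 300) (fun j s' =>
      (∀ i < s.v 17 * p.n, s'.a 0 i = s.a 0 i) ∧
      (∀ v < j, s'.a 0 (s.v 17 * p.n + v) = child₁ (s.a 0 (s.v 16 * p.n + v))
        (if p.adj (s.v 21) v then 1 else 0) fl) ∧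
      ∀ v < j, s'.a 0 ((s.v 17 + 1) * p.n + v) = child₂ (s.a 0 (s.v 16 * p.n + v))
        (if p.adj (s.v 21) v then 1 else 0) fl) hp.W1 hp.nW (by simp [h.v5])
    (by decide) (by decide) (by decide) (by simp) (by
      intro j hj s1 hF hv ⟨hI1, hI2, hI3⟩
      have h5 : s1.v 5 = p.n := by rw [hF.v (by decide)]; simp [h.v5]
      have h16 : s1.v 16 = s.v 16 := by rw [hF.v (by decide)]; simp
      have h17 : s1.v 17 = s.v 17 := by rw [hF.v (by decide)]; simp
      have h21 : s1.v 21 = s.v 21 := by rw [hF.v (by decide)]; simp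
      have h27 : s1.v 27 = fl := by rw [hF.v (by decide)]; simp
      have hx := hI1 (s.v 16 * p.n + j) (by omega)
      have hx2 := hX j hj
      have hset1 : Exec p (.set 26 (.arr 0 (V 16 * V 5 + V 25))) s1 _ _ :=
        Big.set (by simp [h16, h5, hv]; omega)
      simp only [Ex.val_arr, Ex.val_add, Ex.val_var, Ex.val_mul, h16, h5, hv, hx] at hset1
      set x := s.a 0 (s.v 16 * p.n + j)
      have hset2 : Exec p (.set 30 (adjE (V 21) (V 25))) (s1.setv 26 x) _ _ :=
        Big.set (adjE_ok hp rfl (by simp [h5]) (by simp) (by simp) (by simpa [h21]) (by simpa [hv]))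
      rw [adjE_val hp (by simp [h5]) (by simpa [h21]) (by simpa [hv])] at hset2
      simp only [Ex.val_var, HS.setv_v, h21, hv] at hset2
      norm_num at hset2
      set y := if p.adj (s.v 21) j = true then 1 else 0 with hy
      have hbool : ∀ c : Prop, ∀ [Decidable c], (if c then 1 else 0 : ℕ) ≤ 1 := by
        intro c _; split_ifs <;> omega
      have hmul : ∀ c : Prop, ∀ [Decidable c], x * (if c then 1 else 0 : ℕ) ≤ 2 := by
        intro c _; split_ifs <;> omega
      obtain ⟨t, hB, ht⟩ := St.big_run (W := p.W) (S := p.S) (I := p.I) (s := (s1.setv 26 x).setv 30 y)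
        (.put 0 (V 17 * V 5 + V 25) (V 26 * .eq (.eq (V 26) 1 + .eq (V 30) (V 27)) 1) ;;
      .ite (V 30) (.put 0 ((V 17 + 1) * V 5 + V 25) (V 26 * .eq (.eq (V 26) 1) (V 27)))
        (.put 0 ((V 17 + 1) * V 5 + V 25) (V 26))) (by
          have b1 := hbool (x = 1)
          have b2 := hbool (y = fl)
          have b3 := hmul ((if x = 1 then 1 else 0) + (if y = fl then 1 else 0) = 1)
          have b4 := hmul ((if x = 1 then 1 else 0) = fl)
          simp only [St.ok, Ex.ok_add, Ex.ok_mul, Ex.ok_eq, Ex.ok_var, Ex.ok_lit1, Ex.val_add, Ex.val_mul,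
            Ex.val_eq, Ex.val_var, Ex.val_lit1, HS.setv_v, HS.seta_v, h17, h5, h27, hv, true_and,
            St.run]
          norm_num [h16, h17, h5, h27, hv, hsm1, -mul_ite]
          and_intros <;> omega)
      have hcost : (St.put 0 (V 17 * V 5 + V 25) (V 26 * .eq (.eq (V 26) 1 + .eq (V 30) (V 27)) 1) ;;
        .ite (V 30) (.put 0 ((V 17 + 1) * V 5 + V 25) (V 26 * .eq (.eq (V 26) 1) (V 27)))
        (.put 0 ((V 17 + 1) * V 5 + V 25) (V 26))).cost ≤ 200 := by decide
      have hc1 : (Ex.arr 0 (V 16 * V 5 + V 25)).cost = 21 := by decide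
      have hc2 : (adjE (V 21) (V 25)).cost = 19 := by decide
      refine ⟨_, _, hset1.seq (hset2.seq hB), by omega, ?_⟩
      have hrun : ∀ i, (St.run p.I (.put 0 (V 17 * V 5 + V 25) (V 26 * .eq (.eq (V 26) 1 + .eq (V 30) (V 27)) 1) ;;
          .ite (V 30) (.put 0 ((V 17 + 1) * V 5 + V 25) (V 26 * .eq (.eq (V 26) 1) (V 27)))
          (.put 0 ((V 17 + 1) * V 5 + V 25) (V 26))) ((s1.setv 26 x).setv 30 y)).a 0 i =
          if i = (s.v 17 + 1) * p.n + j then child₂ x y fl else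
            if i = s.v 17 * p.n + j then child₁ x y fl else s1.a 0 i := by
        intro i
        simp only [St.run, Ex.val_add, Ex.val_mul,
            Ex.val_eq, Ex.val_var, Ex.val_lit1, HS.setv_v, HS.seta_v]
        by_cases hy0 : y = 0 <;> norm_num [h16, h17, h5, h27, hv, hy0, child₁, child₂]
      simp only [HS.setv_a, hrun]
      refine ⟨fun i hi => ?_, fun v hv => ?_, fun v hv => ?_⟩
      · rw [if_neg (by omega), if_neg (by omega), hI1 i hi]
      · rw [if_neg (by omega)]
        by_cases hvj : v = j
        · subst hvj; simp [x, y]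
        · rw [if_neg (by omega), hI2 v (by omega)]
      · by_cases hvj : v = j
        · subst hvj; simp [x, y]
        · rw [if_neg (by omega), if_neg (by omega), hI3 v (by omega)])
  have h17 : s'.v 17 = s.v 17 := by rw [hB.frame.v (by decide)]; simp
  have hset : Exec p (.set 17 (V 17 + 2)) s' _ _ := Big.set (by simp [h17]; omega)
  simp only [Ex.val_add, Ex.val_var, h17, Ex.val_lit2] at hset
  refine ⟨_, _, hB1.seq (hB.seq hset), ?_, by simp, by simpa using hI⟩
  have hc1 : (St.ite (.lt (V 22 * V 6) (V 15 * V 19)) (.set 27 0) (.set 27 1)).cost ≤ 50 := by decide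
  have hc2 : (V 17 + 2).cost = 5 := by decide
  simp only [Finset.sum_const, Finset.card_range, smul_eq_mul] at ht
  omega

end

section
variable {p : Prm} {Ls : ℕ → List ℕ}

/-- The neighbours of `a` in a list. -/
def Prm.nbr (p : Prm) (a : ℕ) (l : List ℕ) : List ℕ := l.filter (p.adj a)

theorem Prm.length_nbr (p : Prm) (a : ℕ) (l : List ℕ) : (p.nbr a l).length = p.deg a l :=
  List.countP_eq_length_filter.symm

/-- The entries of the record that a split produces. -/
def Prm.splitEntries (p : Prm) (Ls : ℕ → List ℕ) (a J : ℕ) : List Entry :=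
  .rect (p.nbr a (Ls 1)) (p.nbr a (Ls 2)) :: (List.range p.n).map fun v => .use v J

theorem exec_split (hp : p.Good) {s : HS} (h : Node p Ls s) (hA : Ans p s) {a : ℕ} (ha : a < p.n)
    (h24 : s.v 24 = a + 1) (hJ : s.v 18 + 1 ≤ p.B)
    (hcnt : (s.v 17 + 2) * p.n ≤ p.B) (hcB : s.v 17 + 2 ≤ p.B)
    (hk : s.v 16 < s.v 17) (hX : ∀ v < p.n, s.a 0 (s.v 16 * p.n + v) ≤ 2) :
    ∃ t s', Exec p split s t s' ∧ t ≤ 5000 * ((p.n + 1) * (p.n + 1)) ∧ s'.v 17 = s.v 17 + 2 ∧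
      s'.v 18 = s.v 18 + 1 ∧
      (∀ i < s.v 17 * p.n, s'.a 0 i = s.a 0 i) ∧
      (∀ v < p.n, s'.a 0 (s.v 17 * p.n + v) = child₁ (s.a 0 (s.v 16 * p.n + v))
        (if p.adj a v then 1 else 0) (p.flag Ls a)) ∧
      (∀ v < p.n, s'.a 0 ((s.v 17 + 1) * p.n + v) = child₂ (s.a 0 (s.v 16 * p.n + v))
        (if p.adj a v then 1 else 0) (p.flag Ls a)) ∧
      s'.out = s.out ++ (p.splitEntries Ls a (s.v 18)).flatMap Entry.encode ∧ Ans p s' ∧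
      (s'.v 0 = 0 → s.v 0 = 0 ∧ ∀ u ∈ p.nbr a (Ls 1), ∀ v ∈ p.nbr a (Ls 2), p.adj u v = false) := by
  have hW := hp.hW1
  have hB0 := hp.B0
  have hset : Exec p (.set 21 (V 24 - 1)) s _ _ := Big.set (by simp [h24]; omega)
  simp only [Ex.val_sub, Ex.val_var, h24, Ex.val_lit1, Nat.add_sub_cancel] at hset
  have hN0 := h.frame hset.frame (by decide)
  obtain ⟨t1, s1, hB1, ht1, hd1, hN1⟩ := exec_degree hp hN0 (q := 1) (by simp) (by simpa)
  have h21 : s1.v 21 = a := by rw [hB1.frame.v (by decide)]; simp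
  obtain ⟨t2, s2, hB2, ht2, hd2, hN2⟩ := exec_degree hp hN1 (q := 2) (by simp) (by omega)
  rw [h21] at hd2
  have h22 : s2.v 22 = p.deg a (Ls 1) := by rw [hB2.frame.v (by decide), hd1]; simp
  have h23 : s2.v 23 = p.deg a (Ls 2) := hd2
  -- Header of the `rect` entry: the tag and two lengths. The degrees just computed are the lengths
  -- of the neighbour lists that are output next.
  obtain ⟨t3, hB3, ht3⟩ := St.big_run (W := p.W) (S := p.S) (I := p.I) (s := s2)
    (.emit 0 ;; .emit (V 22) ;; .emit (V 23)) (by simp [St.ok]; omega)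
  obtain ⟨s3, hs3, hout3⟩ : ∃ s3, s3 = St.run p.I (.emit 0 ;; .emit (V 22) ;; .emit (V 23)) s2 ∧
      s3.out = s2.out ++ [0, p.deg a (Ls 1), p.deg a (Ls 2)] :=
    ⟨_, rfl, by simp [St.run, h22, h23]⟩
  rw [← hs3] at hB3
  have hN3 := hN2.frame hB3.frame (by decide)
  have h21 : s3.v 21 = a := by rw [hB3.frame.v (by decide), hB2.frame.v (by decide), h21]
  obtain ⟨t4, s4, hB4, ht4, ho4, hN4⟩ := exec_emitNbrs hp hN3 (q := 1) (by simp) (by omega)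
  rw [h21] at ho4
  have h21 : s4.v 21 = a := by rw [hB4.frame.v (by decide), h21]
  obtain ⟨t5, s5, hB5, ht5, ho5, hN5⟩ := exec_emitNbrs hp hN4 (q := 2) (by simp) (by omega)
  rw [h21] at ho5
  have h21 : s5.v 21 = a := by rw [hB5.frame.v (by decide), h21]
  have hF5 := hset.seq (hB1.seq (hB2.seq (hB3.seq (hB4.seq hB5))))
  have hA5 : Ans p s5 := hA.frame hF5.frame (by decide)
  obtain ⟨t6, s6, hB6, ht6, hN6, hA6, hI6⟩ := exec_checkNbrs hp hN5 hA5 (by omega)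
  obtain ⟨t7, s7, hB7, ht7, ho7⟩ := exec_useAll hp hN6.toHolds
  have hN7 := hN6.frame hB7.frame (by decide)
  have hF7 := hF5.seq (hB6.seq hB7)
  have h18 : s6.v 18 = s.v 18 := by
    rw [hB6.frame.v (by decide), hF5.frame.v (by decide)]
  have h18' : s7.v 18 = s.v 18 := by rw [hF7.frame.v (by decide)]
  -- The uses name the rectangle by its number counted from `0`, so the counter is raised only after
  -- they have been written.
  have hset8 : Exec p (.set 18 (V 18 + 1)) s7 _ _ := Big.set (by simp [h18']; omega)
  simp only [Ex.val_add, Ex.val_var, h18', Ex.val_lit1] at hset8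
  have hF8 := hF7.seq hset8
  have hN8 := hN7.frame hset8.frame (by decide)
  have h21 : (s7.setv 18 (s.v 18 + 1)).v 21 = a := by
    rw [hset8.frame.v (by decide), hB7.frame.v (by decide), hB6.frame.v (by decide), h21]
  have h22 : (s7.setv 18 (s.v 18 + 1)).v 22 = p.deg a (Ls 1) := by
    rw [hset8.frame.v (by decide), hB7.frame.v (by decide), hB6.frame.v (by decide),
      hB5.frame.v (by decide), hB4.frame.v (by decide), hB3.frame.v (by decide), h22]
  have h17 : (s7.setv 18 (s.v 18 + 1)).v 17 = s.v 17 := hF8.frame.v (by decide)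
  have h16 : (s7.setv 18 (s.v 18 + 1)).v 16 = s.v 16 := hF8.frame.v (by decide)
  have ha0 : (s7.setv 18 (s.v 18 + 1)).a 0 = s.a 0 := hF8.frame.a (by decide)
  obtain ⟨t9, s9, hB9, ht9, h17', hc1, hc2, hc3⟩ := exec_children hp hN8 (by omega)
    (by rw [h22, h21]) (by rwa [h17]) (by rwa [h17]) (by rwa [h16, h17]) (by rwa [h16, ha0])
  rw [h17] at h17'
  rw [h16, h17, ha0, h21] at hc2 hc3
  rw [h17, ha0] at hc1
  have hB := hset.seq (hB1.seq (hB2.seq (hB3.seq (hB4.seq (hB5.seq (hB6.seq (hB7.seq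
    (hset8.seq hB9))))))))
  refine ⟨_, s9, hB, ?_, h17', ?_, hc1, hc2, hc3, ?_, ?_, ?_⟩
  · have e1 : (V 24 - 1).cost = 5 := by decide
    have e2 : (V 18 + 1).cost = 5 := by decide
    have e3 : (St.emit 0 ;; .emit (V 22) ;; .emit (V 23)).cost = 11 := by decide
    have e4 : p.n + 1 ≤ (p.n + 1) * (p.n + 1) := Nat.le_mul_of_pos_left _ (Nat.succ_pos _)
    omega
  · rw [hB9.frame.v (by decide)]; simp
  · rw [hB9.frame.out rfl, HS.setv_out, ho7, hB6.frame.out rfl, ho5, ho4, hout3, hB2.frame.out rfl,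
      hB1.frame.out rfl]
    simp [Prm.splitEntries, Entry.encode, h18, Prm.nbr]
    constructor <;> exact List.countP_eq_length_filter
  · exact (hA6.frame hB7.frame (by decide)).frame (hset8.seq hB9).frame (by decide)
  · rw [hB9.frame.v (by decide), hset8.frame.v (by decide), hB7.frame.v (by decide)]
    intro h0
    obtain ⟨h1, h2⟩ := hI6 h0
    rw [hF5.frame.v (by decide)] at h1
    refine ⟨h1, fun u hu v hv => ?_⟩
    simp only [Prm.nbr, List.mem_filter] at hu hv
    rw [hB5.frame.v (by decide), hB4.frame.v (by decide), hB3.frame.v (by decide),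
      hB2.frame.v (by decide), hB1.frame.v (by decide)] at h2
    simp only [HS.setv_v, if_true] at h2
    exact h2 u hu.1 hu.2 v hv.1 hv.2

/-! ### Groups as digit strings, and the table entry of a pair of groups -/

/-- The elements of the array `f` above `b` whose offsets are the digits of `c`. -/
def digitList (K : ℕ) (f : ℕ → ℕ) (b c : ℕ) : List ℕ := (Nat.digits K c).map fun d => f (b + d)

/-- Repeated division by `K` produces `Nat.digits`, least significant digit first, and stops when
the quotient vanishes. `hInv` makes the invariant insensitive to the two scratch registers. The
prefix relation in `hstep` tells the body that the vertex at hand belongs to the list and that the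
part already seen is no longer than it. -/
theorem Exec.walk (hp : p.Good) {q b r x y : ℕ} {c : St} {s₀ : HS} (τ : ℕ)
    (Inv : List ℕ → HS → Prop) (h10 : s₀.v 10 = p.K) (hr : s₀.v r ≤ p.M)
    (hb : s₀.v b ≤ p.B * p.B) (hq : q < 8) (hx : x ∉ c.vmods) (hy : y ∉ 10 :: x :: b :: c.vmods)
    (hxb : x ≠ b ∧ x ≠ 10) (hc10 : 10 ∉ c.vmods) (hcb : b ∉ c.vmods) (hcq : q ∉ c.amods)
    (hInv : ∀ pre s u v, Inv pre s → Inv pre ((s.setv y u).setv x v))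
    (h0 : Inv [] (s₀.setv x (s₀.v r)))
    (hstep : ∀ pre z s, pre ++ [z] <+: digitList p.K (s₀.a q) (s₀.v b) (s₀.v r) →
      Frame (walk q b r x y c) s₀ s → s.v y = z → Inv pre s →
      ∃ t s', Exec p c s t s' ∧ t ≤ τ ∧ Inv (pre ++ [z]) s') :
    ∃ t s', Exec p (walk q b r x y c) s₀ t s' ∧
      t ≤ (τ + 100) * (digitList p.K (s₀.a q) (s₀.v b) (s₀.v r)).length + 100 ∧
      Inv (digitList p.K (s₀.a q) (s₀.v b) (s₀.v r)) s' := by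
  have hW := hp.hW1
  have hW2 := hp.hW2
  have hB0 := hp.B0
  have hBB : p.B ≤ p.B * p.B := Nat.le_mul_of_pos_right _ hB0
  have hSB := hp.SB
  have hKB := hp.KB
  have hMB := hp.MB
  have hK1 : 1 < p.K := by have := hp.LK; have := hp.L2; omega
  -- Strong induction on the part `cc` of the code still to be read; `pre` holds the elements
  -- already passed.
  have key : ∀ (cc : ℕ) (pre : List ℕ) (s : HS), s.v x = cc → cc ≤ p.M →
      pre ++ digitList p.K (s₀.a q) (s₀.v b) cc = digitList p.K (s₀.a q) (s₀.v b) (s₀.v r) →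
      Frame (HL.walk q b r x y c) s₀ s → Inv pre s →
      ∃ t s', Exec p (.loop (V x) (.set y (.arr q (V b + modE (V x) (V 10))) ;;
        .set x (V x / V 10) ;; c)) s t s' ∧
        t ≤ (τ + 100) * (digitList p.K (s₀.a q) (s₀.v b) cc).length + 50 ∧
        Inv (pre ++ digitList p.K (s₀.a q) (s₀.v b) cc) s' := by
    intro cc
    induction cc using Nat.strong_induction_on with
    | _ cc ih =>
      intro pre s hsx hcM hdig hF hI
      rcases Nat.eq_zero_or_pos cc with rfl | hpos
      · exact ⟨_, s, .loop_neg (by simp) (by simpa), by simp [digitList, Ex.cost],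
          by simpa [digitList] using hI⟩
      have hd := Nat.digits_def' hK1 hpos
      have hlist : digitList p.K (s₀.a q) (s₀.v b) cc =
          s₀.a q (s₀.v b + cc % p.K) :: digitList p.K (s₀.a q) (s₀.v b) (cc / p.K) := by
        simp [digitList, hd]
      have hbs : s.v b = s₀.v b := hF.v (by
        simp only [List.mem_cons, not_or] at hy
        simp only [HL.walk, St.vmods, List.mem_append, List.mem_singleton]
        tauto)
      have h10s : s.v 10 = p.K := by
        rw [hF.v, h10]
        simp only [List.mem_cons, not_or] at hy
        simp only [HL.walk, St.vmods, List.mem_append, List.mem_singleton]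
        tauto
      have haq : s.a q = s₀.a q := hF.a (by simpa [HL.walk, St.amods] using hcq)
      have hmod : cc - cc / p.K * p.K = cc % p.K := by
        have := Nat.div_add_mod' cc p.K; omega
      have hdm := Nat.div_mul_le_self cc p.K
      have hmlt := Nat.mod_lt cc (show p.K > 0 by omega)
      simp only [List.mem_cons, not_or] at hy
      have hset1 : Exec p (.set y (.arr q (V b + modE (V x) (V 10)))) s _ _ := Big.set (by
        simp [modE, hsx, h10s, hbs, hq, hmod]
        omega)
      simp only [Ex.val_arr, Ex.val_add, Ex.val_var, modE, Ex.val_sub, Ex.val_mul, Ex.val_div, hsx,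
        h10s, hbs, hmod, haq] at hset1
      have hset2 : Exec p (.set x (V x / V 10)) (s.setv y (s₀.a q (s₀.v b + cc % p.K))) _ _ :=
        Big.set (by simp)
      have hxy : x ≠ y := fun h => hy.2.1 h.symm
      have h10y : 10 ≠ y := fun h => hy.1 h.symm
      simp only [Ex.val_var, Ex.val_div, HS.setv_v, hxy, h10y, if_false, hsx, h10s] at hset2
      have hI1 := hInv pre s (s₀.a q (s₀.v b + cc % p.K)) (cc / p.K) hI
      have hF1 : Frame (HL.walk q b r x y c) s₀
          ((s.setv y (s₀.a q (s₀.v b + cc % p.K))).setv x (cc / p.K)) := by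
        refine hF.trans ⟨fun {i} hi => ?_, fun _ => rfl, fun _ => rfl⟩
        simp only [HL.walk, St.vmods, List.mem_append, List.mem_singleton, not_or] at hi
        simp [hi.1, hi.2.1]
      obtain ⟨t, s', hB, ht, hI'⟩ := hstep pre (s₀.a q (s₀.v b + cc % p.K)) _
        ⟨digitList p.K (s₀.a q) (s₀.v b) (cc / p.K), by rw [← hdig, hlist]; simp⟩ hF1
        (by simp [hy.2.1]) hI1
      have hF2 : Frame (HL.walk q b r x y c) s₀ s' := by
        refine hF1.trans ⟨fun {i} hi => ?_, fun {i} hi => ?_, fun hi => ?_⟩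
        · simp only [HL.walk, St.vmods, List.mem_append, List.mem_singleton, not_or] at hi
          exact hB.frame.v hi.2.2.2
        · simp only [HL.walk, St.amods, List.nil_append] at hi
          exact hB.frame.a hi
        · simp only [HL.walk, St.emits, Bool.false_or] at hi
          exact hB.frame.out hi
      obtain ⟨t', s'', hB', ht', hI''⟩ := ih (cc / p.K) (Nat.div_lt_self hpos hK1) _ s'
        (by rw [hB.frame.v hx]; simp) ((Nat.div_le_self _ _).trans hcM)
        (by rw [← hdig, hlist]; simp) hF2 hI'
      refine ⟨_, s'', .loop_pos (by simp) (by simp [hsx]; omega)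
        (hset1.seq (hset2.seq hB)) hB', ?_, ?_⟩
      · rw [hlist, List.length_cons]
        have e1 : (Ex.arr q (V b + (V x - V x / V 10 * V 10))).cost = 29 := rfl
        have e2 : (V x / V 10).cost = 5 := rfl
        have e3 : (V x).cost = 1 := rfl
        rw [Nat.mul_succ]
        omega
      · rw [hlist]
        simpa using hI''
  have hset : Exec p (.set x (V r)) s₀ 3 _ := Big.set (by simp)
  obtain ⟨t, s', hB, ht, hI⟩ := key (s₀.v r) [] (s₀.setv x (s₀.v r)) (by simp) hr (by simp)
    ⟨fun {i} hi => by
      simp only [HL.walk, St.vmods, List.mem_append, List.mem_singleton, not_or] at hi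
      simp [hi.1], fun _ => rfl, fun _ => rfl⟩ h0
  exact ⟨_, s', hset.seq hB, by omega, by simpa using hI⟩

end

section
variable {p : Prm} {Ls : ℕ → List ℕ}

/-- The group with code `e`, for a side stored in the array `f`. -/
def Prm.dec (p : Prm) (f : ℕ → ℕ) (e : ℕ) : List ℕ :=
  digitList p.K f (e / p.M * p.L) (e % p.M)

/-- There are no edges between two lists. -/
def Prm.clear (p : Prm) (S T : List ℕ) : Bool := S.all fun u => T.all fun v => !p.adj u v

theorem Prm.clear_iff {p : Prm} {S T : List ℕ} :
    p.clear S T = true ↔ ∀ u ∈ S, ∀ v ∈ T, p.adj u v = false := by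
  simp [Prm.clear]

/-- The entry of the record for a pair of groups. -/
def Prm.pairEnt (p : Prm) (S T : List ℕ) : Entry := if p.clear S T then .rect S T else .rect [] []

/-- A remainder modulo `M = K ^ g` has at most `g` digits, whether or not it is the code of an
actual group. -/
theorem Prm.Good.length_dec (hp : p.Good) (f : ℕ → ℕ) (e : ℕ) : (p.dec f e).length ≤ p.g := by
  have hK1 : 1 < p.K := by have := hp.LK; have := hp.L2; omega
  simp only [Prm.dec, digitList, List.length_map]
  rw [Nat.digits_length_le_iff hK1, ← hp.MK]
  exact Nat.mod_lt _ hp.M0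

theorem mem_digitList {K : ℕ} {f : ℕ → ℕ} {b c z : ℕ} (h : z ∈ digitList K f b c) :
    ∃ i, z = f i := by
  simp only [digitList, List.mem_map] at h
  obtain ⟨d, -, rfl⟩ := h
  exact ⟨_, rfl⟩

theorem Prm.Good.EEB (hp : p.Good) : p.E ≤ p.B := (Nat.le_mul_self _).trans hp.EB

theorem Prm.Good.blockB (hp : p.Good) {e : ℕ} (he : e < p.E) : e / p.M * p.L ≤ p.B * p.B := by
  have h1 : e / p.M < p.n := by rw [Nat.div_lt_iff_lt_mul hp.M0]; exact he
  exact Nat.mul_le_mul (h1.le.trans hp.nB) (hp.LK.le.trans hp.KB)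

/-- What is known after the pairs of a pair of groups have been looked at. -/
def PairInv (p : Prm) (S T : List ℕ) (s₀ : HS) (y : ℕ) (good : Prop) (s : HS) : Prop :=
  (s.v 43 = 0 ∧ good ∧ s.a 5 = s₀.a 5) ∨
  (s.v 43 = 1 ∧ p.clear S T = false ∧ (∀ i, i ≠ y → s.a 5 i = s₀.a 5 i) ∧
    ∃ u ∈ S, ∃ v ∈ T, p.adj u v = true ∧ s.a 5 y = u * p.n + v + 1)

-- Every pair of codes is processed, including codes that no vertex produces. Their lists may
-- contain stale cells or repetitions, but they consist of vertices, and the edge test is applied to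
-- precisely the lists that are output, so the entry is valid in any case. A pair spoiled by an edge
-- is recorded as an empty rectangle, which keeps the number of the rectangle equal to `s.v 18 + j`.
set_option maxHeartbeats 1000000 in
theorem exec_pairEntry (hp : p.Good) {s : HS} (h : p.Holds s) {j : ℕ} (hj : j < p.E * p.E)
    (h28 : s.v 28 = j) (hf1 : ∀ i, s.a 1 i < p.n) (hf2 : ∀ i, s.a 2 i < p.n)
    (hJ : s.v 18 + p.E * p.E ≤ p.B) :
    ∃ t s', Exec p pairEntry s t s' ∧ t ≤ 3000 * ((p.g + 1) * (p.g + 1)) ∧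
      s'.out = s.out ++ (p.pairEnt (p.dec (s.a 1) (j / p.E)) (p.dec (s.a 2) (j % p.E))).encode ∧
      ((p.clear (p.dec (s.a 1) (j / p.E)) (p.dec (s.a 2) (j % p.E)) = true ∧ s'.a 5 = s.a 5) ∨
        (p.clear (p.dec (s.a 1) (j / p.E)) (p.dec (s.a 2) (j % p.E)) = false ∧
          (∀ i, i ≠ s.v 18 + j → s'.a 5 i = s.a 5 i) ∧
          ∃ u ∈ p.dec (s.a 1) (j / p.E), ∃ v ∈ p.dec (s.a 2) (j % p.E), p.adj u v = true ∧
            s'.a 5 (s.v 18 + j) = u * p.n + v + 1)) := by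
  have hW := hp.hW1
  have hW2 := hp.hW2
  have hB0 := hp.B0
  have hBB : p.B ≤ p.B * p.B := Nat.le_mul_of_pos_right _ hB0
  have hSB := hp.SB
  have hnB := hp.nB
  have hEB := hp.EEB
  have hEE := hp.EB
  have hMB := hp.MB
  have hgB := hp.gB
  have hE0 : 0 < p.E := by by_contra hc; simp [show p.E = 0 by omega] at hj
  have he1 : j / p.E < p.E := by rw [Nat.div_lt_iff_lt_mul hE0]; exact hj
  have he2 : j % p.E < p.E := Nat.mod_lt _ hE0
  have hb1 := hp.blockB he1
  have hb2 := hp.blockB he2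
  have hmod : ∀ a b : ℕ, a - a / b * b = a % b := by
    intro a b; have := Nat.div_add_mod' a b; omega
  have hle : ∀ a b : ℕ, a / b * b ≤ a := Nat.div_mul_le_self
  obtain ⟨t1, hB1, ht1⟩ := St.big_run (W := p.W) (S := p.S) (I := p.I) (s := s)
    (.set 35 (V 28 / V 12) ;; .set 36 (modE (V 28) (V 12)) ;;
    .set 37 (V 35 / V 11 * V 9) ;; .set 38 (modE (V 35) (V 11)) ;;
    .set 39 (V 36 / V 11 * V 9) ;; .set 40 (modE (V 36) (V 11)) ;;
    .set 41 0 ;; .set 42 0 ;; .set 43 0) (by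
      have l1 := hle j p.E
      have l2 := hle (j / p.E) p.M
      have l3 := hle (j % p.E) p.M
      simp [St.ok, St.run, modE, h28, h.v12, h.v11, h.v9, hmod]
      and_intros <;> omega)
  have hc1 : (St.set 35 (V 28 / V 12) ;; .set 36 (modE (V 28) (V 12)) ;;
    .set 37 (V 35 / V 11 * V 9) ;; .set 38 (modE (V 35) (V 11)) ;;
    .set 39 (V 36 / V 11 * V 9) ;; .set 40 (modE (V 36) (V 11)) ;;
    .set 41 0 ;; .set 42 0 ;; .set 43 0).cost ≤ 200 := by decide
  obtain ⟨s1, hs1⟩ : ∃ s1, s1 = St.run p.I (.set 35 (V 28 / V 12) ;; .set 36 (modE (V 28) (V 12)) ;;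
    .set 37 (V 35 / V 11 * V 9) ;; .set 38 (modE (V 35) (V 11)) ;;
    .set 39 (V 36 / V 11 * V 9) ;; .set 40 (modE (V 36) (V 11)) ;;
    .set 41 0 ;; .set 42 0 ;; .set 43 0) s := ⟨_, rfl⟩
  rw [← hs1] at hB1
  have g37 : s1.v 37 = j / p.E / p.M * p.L := by
    simp [hs1, St.run, modE, h28, h.v12, h.v11, h.v9, hmod]
  have g38 : s1.v 38 = (j / p.E) % p.M := by
    simp [hs1, St.run, modE, h28, h.v12, h.v11, h.v9, hmod]
  have g39 : s1.v 39 = j % p.E / p.M * p.L := by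
    simp [hs1, St.run, modE, h28, h.v12, h.v11, h.v9, hmod]
  have g40 : s1.v 40 = (j % p.E) % p.M := by
    simp [hs1, St.run, modE, h28, h.v12, h.v11, h.v9, hmod]
  have g41 : s1.v 41 = 0 := by simp [hs1, St.run]
  have g42 : s1.v 42 = 0 := by simp [hs1, St.run]
  have g43 : s1.v 43 = 0 := by simp [hs1, St.run]
  have m1 := Nat.mod_lt (j / p.E) hp.M0
  have m2 := Nat.mod_lt (j % p.E) hp.M0
  have a1 : s1.a 1 = s.a 1 := hB1.frame.a (by decide)
  have a2 : s1.a 2 = s.a 2 := hB1.frame.a (by decide)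
  have a5 : s1.a 5 = s.a 5 := hB1.frame.a (by decide)
  have v18 : s1.v 18 = s.v 18 := hB1.frame.v (by decide)
  have v28 : s1.v 28 = j := by rw [hB1.frame.v (by decide), h28]
  have hH1 := h.frame hB1.frame (by decide)
  have o1 : s1.out = s.out := hB1.frame.out rfl
  clear hs1
  have hS : ∀ s' : HS, s'.a 1 = s.a 1 → s'.v 37 = j / p.E / p.M * p.L → s'.v 38 = (j / p.E) % p.M →
      digitList p.K (s'.a 1) (s'.v 37) (s'.v 38) = p.dec (s.a 1) (j / p.E) := by
    intro s' e1 e2 e3; rw [e1, e2, e3]; rfl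
  have hT : ∀ s' : HS, s'.a 2 = s.a 2 → s'.v 39 = j % p.E / p.M * p.L → s'.v 40 = (j % p.E) % p.M →
      digitList p.K (s'.a 2) (s'.v 39) (s'.v 40) = p.dec (s.a 2) (j % p.E) := by
    intro s' e1 e2 e3; rw [e1, e2, e3]; rfl
  have lS := hp.length_dec (s.a 1) (j / p.E)
  have lT := hp.length_dec (s.a 2) (j % p.E)
  have ltS : ∀ u ∈ p.dec (s.a 1) (j / p.E), u < p.n := by
    intro u hu; obtain ⟨i, rfl⟩ := mem_digitList hu; exact hf1 i
  have ltT : ∀ u ∈ p.dec (s.a 2) (j % p.E), u < p.n := by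
    intro u hu; obtain ⟨i, rfl⟩ := mem_digitList hu; exact hf2 i
  set S := p.dec (s.a 1) (j / p.E) with hSdef
  set T := p.dec (s.a 2) (j % p.E) with hTdef
  -- Two preliminary walks only count, since in the record the lengths precede the lists.
  obtain ⟨t2, s2, hB2, ht2, hI2⟩ := Exec.walk (s₀ := s1) (q := 1) (b := 37) (r := 38) (x := 44)
    (y := 32) (c := .set 41 (V 41 + 1)) hp 10 (fun pre s' => s'.v 41 = pre.length) hH1.v10
    (by omega) (by omega) (by norm_num) (by decide) (by decide) (by decide) (by decide) (by decide)
    (by decide) (by intro pre s u v; simp) (by simp [g41]) (by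
      intro pre z s' hz hF hv hI
      have hlen := hz.length_le
      rw [hS s1 a1 g37 g38, List.length_append, List.length_singleton] at hlen
      have hset : Exec p (.set 41 (V 41 + 1)) s' 7 _ := Big.set (by simp [hI]; omega)
      exact ⟨_, _, hset, by norm_num, by simp [hI]⟩)
  rw [hS s1 a1 g37 g38] at ht2 hI2
  have hH2 := hH1.frame hB2.frame (by decide)
  obtain ⟨t3, s3, hB3, ht3, hI3⟩ := Exec.walk (s₀ := s2) (q := 2) (b := 39) (r := 40) (x := 45)
    (y := 33) (c := .set 42 (V 42 + 1)) hp 10 (fun pre s' => s'.v 42 = pre.length) hH2.v10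
    (by rw [hB2.frame.v (by decide)]; omega) (by rw [hB2.frame.v (by decide)]; omega) (by norm_num)
    (by decide) (by decide) (by decide) (by decide) (by decide)
    (by decide) (by intro pre s u v; simp)
    (by have := hB2.frame.v (r := 42) (by decide); simpa [g42] using this) (by
      intro pre z s' hz hF hv hI
      have hlen := hz.length_le
      rw [hT s2 (by rw [hB2.frame.a (by decide), a2]) (by rw [hB2.frame.v (by decide), g39])
        (by rw [hB2.frame.v (by decide), g40]), List.length_append, List.length_singleton] at hlen
      have hset : Exec p (.set 42 (V 42 + 1)) s' 7 _ := Big.set (by simp [hI]; omega)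
      exact ⟨_, _, hset, by norm_num, by simp [hI]⟩)
  rw [hT s2 (by rw [hB2.frame.a (by decide), a2]) (by rw [hB2.frame.v (by decide), g39])
    (by rw [hB2.frame.v (by decide), g40])] at ht3 hI3
  have hF23 := (hB2.seq hB3).frame
  have hH3 := hH2.frame hB3.frame (by decide)
  have x37 : s3.v 37 = j / p.E / p.M * p.L := by rw [hF23.v (by decide), g37]
  have x38 : s3.v 38 = (j / p.E) % p.M := by rw [hF23.v (by decide), g38]
  have x39 : s3.v 39 = j % p.E / p.M * p.L := by rw [hF23.v (by decide), g39]
  have x40 : s3.v 40 = (j % p.E) % p.M := by rw [hF23.v (by decide), g40]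
  have x43 : s3.v 43 = 0 := by rw [hF23.v (by decide), g43]
  have x1 : s3.a 1 = s.a 1 := by rw [hF23.a (by decide), a1]
  have x2 : s3.a 2 = s.a 2 := by rw [hF23.a (by decide), a2]
  have x5 : s3.a 5 = s.a 5 := by rw [hF23.a (by decide), a5]
  have x18 : s3.v 18 = s.v 18 := by rw [hF23.v (by decide), v18]
  have x28 : s3.v 28 = j := by rw [hF23.v (by decide), v28]
  have x41 : s3.v 41 = S.length := by rw [hB3.frame.v (by decide), hI2]
  have hgg : p.g + 1 ≤ (p.g + 1) * (p.g + 1) := Nat.le_mul_of_pos_left _ (Nat.succ_pos _)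
  -- Nested walks test all pairs of the two groups, at most `g * g` of them. The last edge found
  -- remains in the table cell.
  obtain ⟨t4, s4, hB4, ht4, hI4⟩ := Exec.walk (s₀ := s3) (q := 1) (b := 37) (r := 38) (x := 44)
    (y := 32) (c := walk 2 39 40 45 33
    (.ite (adjE (V 32) (V 33))
      (.put 5 (V 18 + V 28) (V 32 * V 5 + V 33 + 1) ;; .set 43 1) .skip)) hp (200 * p.g + 100)
    (fun pre s' => PairInv p S T s (s.v 18 + j) (∀ u ∈ pre, ∀ v ∈ T, p.adj u v = false) s') hH3.v10
    (by omega) (by omega) (by norm_num) (by decide) (by decide) (by decide) (by decide) (by decide)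
    (by decide) (by intro pre s u v; simp [PairInv]) (by left; simp [x43, x5]) (by
      intro pre u s' hz hF hv hI
      rw [hS s3 x1 x37 x38] at hz
      have huS : u ∈ S := hz.subset (by simp)
      have hH' := hH3.frame hF (by decide)
      have y39 : s'.v 39 = j % p.E / p.M * p.L := by rw [hF.v (by decide), x39]
      have y40 : s'.v 40 = (j % p.E) % p.M := by rw [hF.v (by decide), x40]
      have y2 : s'.a 2 = s.a 2 := by rw [hF.a (by decide), x2]
      obtain ⟨t, s5, hB5, ht5, hI5⟩ := Exec.walk (s₀ := s') (q := 2) (b := 39) (r := 40) (x := 45)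
        (y := 33) (c := (.ite (adjE (V 32) (V 33))
          (.put 5 (V 18 + V 28) (V 32 * V 5 + V 33 + 1) ;; .set 43 1) .skip)) hp 100
        (fun pre' s' => PairInv p S T s (s.v 18 + j) ((∀ u ∈ pre, ∀ v ∈ T, p.adj u v = false) ∧
          ∀ v ∈ pre', p.adj u v = false) s') hH'.v10
        (by omega) (by omega) (by norm_num) (by decide) (by decide) (by decide) (by decide)
        (by decide) (by decide) (by intro pre s u v; simp [PairInv])
        (by simpa [PairInv] using hI) (by
          intro pre' v s6 hz' hF6 hv6 hI6
          rw [hT s' y2 y39 y40] at hz'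
          have hvT : v ∈ T := hz'.subset (by simp)
          have hun := ltS u huS
          have hvn := ltT v hvT
          have hH6 := hH'.frame hF6 (by decide)
          have z32 : s6.v 32 = u := by rw [hF6.v (by decide), hv]
          have z18 : s6.v 18 = s.v 18 := by rw [hF6.v (by decide), hF.v (by decide), x18]
          have z28 : s6.v 28 = j := by rw [hF6.v (by decide), hF.v (by decide), x28]
          have hao : (adjE (V 32) (V 33)).ok p.W p.S p.I s6 :=
            adjE_ok hp rfl hH6.v5 (by simp) (by simp) (by simpa [z32]) (by simpa [hv6])
          have hav := adjE_val (a := V 32) (u := V 33) hp hH6.v5 (by simpa [z32]) (by simpa [hv6])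
          simp only [Ex.val_var, z32, hv6] at hav
          have hidx := hp.index hun hvn
          have hSS : p.n * p.n ≤ p.S := by simp only [Prm.S]; omega
          have hun' : u * p.n ≤ p.n * p.n := Nat.mul_le_mul_right _ hun.le
          obtain ⟨t, hB, ht⟩ := St.big_run (W := p.W) (S := p.S) (I := p.I) (s := s6)
            (.ite (adjE (V 32) (V 33))
              (.put 5 (V 18 + V 28) (V 32 * V 5 + V 33 + 1) ;; .set 43 1) .skip) (by
              refine ⟨hao, fun _ => ?_, fun _ => ?_⟩
              · simp [St.ok, St.run, z32, hv6, z18, z28, hH6.v5]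
                omega
              · simp [St.ok, St.skip]; omega)
          refine ⟨t, _, hB, ht.trans (by decide), ?_⟩
          by_cases hc : p.adj u v = true
          · right
            have hcl : p.clear S T = false := by
              rw [Bool.eq_false_iff, ne_eq, Prm.clear_iff]
              intro hall
              have := hall u huS v hvT
              simp [hc] at this
            have hold : ∀ i, i ≠ s.v 18 + j → s6.a 5 i = s.a 5 i := by
              rcases hI6 with ⟨-, -, h6⟩ | ⟨-, -, h6, -⟩
              · intro i _; rw [h6]
              · exact h6
            simp only [St.run, hav, hc, if_true, ne_eq, one_ne_zero, not_false_eq_true]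
            refine ⟨by simp, hcl, fun i hi => ?_, u, huS, v, hvT, hc, ?_⟩
            · simp [z18, z28, hi, hold i hi]
            · simp [z18, z28, z32, hv6, hH6.v5]
          · have hc' : p.adj u v = false := by simpa using hc
            simp only [St.run, hav, hc', St.skip, ne_eq, not_true_eq_false, if_false,
              Bool.false_eq_true]
            rcases hI6 with ⟨h61, h62, h63⟩ | ⟨h61, h62, h63, h64⟩
            · left
              refine ⟨by simpa using h61, ⟨h62.1, ?_⟩, by simpa using h63⟩
              intro v' hv'
              rw [List.mem_append, List.mem_singleton] at hv'
              rcases hv' with hv' | rfl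
              exacts [h62.2 v' hv', hc']
            · right
              exact ⟨by simpa using h61, h62, by simpa using h63, by simpa using h64⟩)
      rw [hT s' y2 y39 y40] at ht5 hI5
      refine ⟨_, _, hB5, by omega, ?_⟩
      rcases hI5 with ⟨h61, h62, h63⟩ | h5
      · left
        refine ⟨h61, ?_, h63⟩
        intro u' hu'
        rw [List.mem_append, List.mem_singleton] at hu'
        rcases hu' with hu' | rfl
        exacts [h62.1 u' hu', h62.2]
      · exact Or.inr h5)
  rw [hS s3 x1 x37 x38] at ht4 hI4
  have hH4 := hH3.frame hB4.frame (by decide)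
  have w1 : s4.a 1 = s.a 1 := by rw [hB4.frame.a (by decide), x1]
  have w2 : s4.a 2 = s.a 2 := by rw [hB4.frame.a (by decide), x2]
  have w37 : s4.v 37 = j / p.E / p.M * p.L := by rw [hB4.frame.v (by decide), x37]
  have w38 : s4.v 38 = (j / p.E) % p.M := by rw [hB4.frame.v (by decide), x38]
  have w39 : s4.v 39 = j % p.E / p.M * p.L := by rw [hB4.frame.v (by decide), x39]
  have w40 : s4.v 40 = (j % p.E) % p.M := by rw [hB4.frame.v (by decide), x40]
  have w41 : s4.v 41 = S.length := by rw [hB4.frame.v (by decide), x41]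
  have w42 : s4.v 42 = T.length := by rw [hB4.frame.v (by decide), hI3]
  have o4 : s4.out = s.out := by
    rw [hB4.frame.out rfl, hB3.frame.out rfl, hB2.frame.out rfl, o1]
  have hem : Exec p (.emit 0) s4 3 _ := Big.emit (by simp; omega)
  simp only [Ex.val_lit0] at hem
  have ht4' : t4 ≤ 1000 * ((p.g + 1) * (p.g + 1)) := by
    have e1 := Nat.mul_le_mul_left (200 * p.g + 100 + 100) lS
    have e2 : (200 * p.g + 100 + 100) * p.g + 200 * (p.g + 1) = 200 * ((p.g + 1) * (p.g + 1)) := by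
      ring
    omega
  rcases hI4 with ⟨i1, i2, i3⟩ | ⟨i1, i2, i3, i4⟩
  · have hcl : p.clear S T = true := Prm.clear_iff.2 i2
    have hem2 : Exec p (.emit (V 41)) (s4.emit 0) 3 _ := Big.emit (by simp)
    simp only [Ex.val_var, HS.emit_v, w41] at hem2
    have hem3 : Exec p (.emit (V 42)) ((s4.emit 0).emit S.length) 3 _ := Big.emit (by simp)
    simp only [Ex.val_var, HS.emit_v, w42] at hem3
    set s5 := ((s4.emit 0).emit S.length).emit T.length with hs5
    have hH5 := ((hH4.frame hem.frame (by decide)).frame hem2.frame (by decide)).frame hem3.frame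
      (by decide)
    obtain ⟨t6, s6, hB6, ht6, hI6⟩ := Exec.walk (s₀ := s5) (q := 1) (b := 37) (r := 38) (x := 44)
      (y := 32) (c := .emit (V 32)) hp 10 (fun pre s' => s'.out = s5.out ++ pre) hH5.v10
      (by simp only [hs5, HS.emit_v]; omega) (by simp only [hs5, HS.emit_v]; omega) (by norm_num)
      (by decide) (by decide) (by decide) (by decide) (by decide)
      (by decide) (by intro pre s u v; simp) (by simp) (by
        intro pre z s' hz hF hv hI
        have hem : Exec p (.emit (V 32)) s' 3 _ := Big.emit (by simp)
        exact ⟨_, _, hem, by norm_num, by simp [hI, hv]⟩)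
    rw [hS s5 (by simpa [hs5]) (by simpa [hs5]) (by simpa [hs5])] at ht6 hI6
    have hH6 := hH5.frame hB6.frame (by decide)
    have f39 : s6.v 39 = j % p.E / p.M * p.L := by rw [hB6.frame.v (by decide)]; simpa [hs5]
    have f40 : s6.v 40 = (j % p.E) % p.M := by rw [hB6.frame.v (by decide)]; simpa [hs5]
    obtain ⟨t7, s7, hB7, ht7, hI7⟩ := Exec.walk (s₀ := s6) (q := 2) (b := 39) (r := 40) (x := 45)
      (y := 33) (c := .emit (V 33)) hp 10 (fun pre s' => s'.out = s6.out ++ pre) hH6.v10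
      (by omega) (by omega) (by norm_num)
      (by decide) (by decide) (by decide) (by decide) (by decide)
      (by decide) (by intro pre s u v; simp) (by simp) (by
        intro pre z s' hz hF hv hI
        have hem : Exec p (.emit (V 33)) s' 3 _ := Big.emit (by simp)
        exact ⟨_, _, hem, by norm_num, by simp [hI, hv]⟩)
    rw [hT s6 (by rw [hB6.frame.a (by decide)]; simpa [hs5]) f39 f40] at ht7 hI7
    have hite := Big.ite_neg (e := V 43) (c := (.emit 0 ;; .emit 0)) (by simp) (by simpa using i1)
      (hem2.seq (hem3.seq (hB6.seq hB7)))
    have hc : (V 43).cost = 1 := rfl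
    refine ⟨_, s7, hB1.seq (hB2.seq (hB3.seq (hB4.seq (hem.seq hite)))), by omega, ?_, Or.inl ⟨hcl, ?_⟩⟩
    · rw [hI7, hI6, hs5]
      simp [o4, Prm.pairEnt, hcl, Entry.encode]
    · rw [hB7.frame.a (by decide), hB6.frame.a (by decide)]
      simpa [hs5] using i3
  · have hem2 : Exec p (.emit 0) (s4.emit 0) 3 _ := Big.emit (by simp; omega)
    simp only [Ex.val_lit0] at hem2
    have hem3 : Exec p (.emit 0) ((s4.emit 0).emit 0) 3 _ := Big.emit (by simp; omega)
    simp only [Ex.val_lit0] at hem3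
    have hite := Big.ite_pos (e := V 43) (d := (.emit (V 41) ;; .emit (V 42) ;;
      walk 1 37 38 44 32 (.emit (V 32)) ;; walk 2 39 40 45 33 (.emit (V 33)))) (by simp)
      (by simp [i1]) (hem2.seq hem3)
    have hc : (V 43).cost = 1 := rfl
    refine ⟨_, _, hB1.seq (hB2.seq (hB3.seq (hB4.seq (hem.seq hite)))), by omega, ?_,
      Or.inr ⟨i2, by simpa using i3, by simpa using i4⟩⟩
    simp [o4, Prm.pairEnt, i2, Entry.encode]

end

/-! ### Cutting neighbourhoods into groups -/

section
variable {p : Prm} {Ls : ℕ → List ℕ}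

/-- The vertices `pre` have been treated: the groups `A 0, …, A (cg - 1)` are complete, and the group
with digits `c` of length `ln` in block `b` is open. -/
structure GroupInv (p : Prm) (f : ℕ → ℕ) (l : List ℕ) (a : ℕ) (pre : List ℕ) (b c ln cg : ℕ)
    (A : ℕ → ℕ) : Prop where
  c_lt : c < p.K ^ ln
  ln_le : ln ≤ p.g
  cnt : ∃ k, cg ≤ k + b ∧ p.g * k + ln ≤ p.deg a pre
  pend : ∀ u ∈ digitList p.K f (b * p.L) c, u ∈ l ∧ p.adj a u = true
  cover : ∀ u ∈ pre, p.adj a u = true →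
    (∃ t < cg, u ∈ p.dec f (A t)) ∨ u ∈ digitList p.K f (b * p.L) c
  codes : ∀ t < cg, A t < p.E ∧ ∀ u ∈ p.dec f (A t), u ∈ l ∧ p.adj a u = true

namespace GroupInv
variable {f : ℕ → ℕ} {l : List ℕ} {a : ℕ} {pre : List ℕ} {b c ln cg : ℕ} {A : ℕ → ℕ}

/-- The new offset becomes the least significant digit. It is positive and at most `L < K`, so it is
a genuine digit and `Nat.digits` keeps it even when the group was empty. -/
theorem push (hp : p.Good) (h : GroupInv p f l a pre b c ln cg A) (hln : ln < p.g) {d x : ℕ}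
    (hd : 0 < d) (hdL : d ≤ p.L) (hx : x = f (b * p.L + d)) (hxl : x ∈ l)
    (hadj : p.adj a x = true) : GroupInv p f l a (pre ++ [x]) b (c * p.K + d) (ln + 1) cg A := by
  have hLK := hp.LK
  have hL2 := hp.L2
  have hdig : digitList p.K f (b * p.L) (c * p.K + d) = x :: digitList p.K f (b * p.L) c := by
    have : Nat.digits p.K (d + p.K * c) = d :: Nat.digits p.K c :=
      Nat.digits_add p.K (by omega) d c (by omega) (Or.inl (by omega))
    rw [digitList, show c * p.K + d = d + p.K * c by ring, this, List.map_cons, ← hx]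
    rfl
  obtain ⟨k, hk1, hk2⟩ := h.cnt
  refine ⟨?_, hln, ⟨k, hk1, ?_⟩, ?_, ?_, h.codes⟩
  · have := h.c_lt
    calc c * p.K + d < c * p.K + p.K := by omega
      _ = (c + 1) * p.K := by ring
      _ ≤ p.K ^ ln * p.K := Nat.mul_le_mul_right _ this
      _ = p.K ^ (ln + 1) := (pow_succ _ _).symm
  · simp only [Prm.deg, List.countP_append, List.countP_cons, hadj] at hk2 ⊢
    simp
    omega
  · intro u hu
    rw [hdig, List.mem_cons] at hu
    rcases hu with rfl | hu
    exacts [⟨hxl, hadj⟩, h.pend u hu]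
  · intro u hu hau
    rw [hdig]
    rw [List.mem_append, List.mem_singleton] at hu
    rcases hu with hu | rfl
    · rcases h.cover u hu hau with h1 | h1
      exacts [Or.inl h1, Or.inr (List.mem_cons_of_mem _ h1)]
    · exact Or.inr List.mem_cons_self

theorem pass (h : GroupInv p f l a pre b c ln cg A) {x : ℕ} (hadj : p.adj a x = false) :
    GroupInv p f l a (pre ++ [x]) b c ln cg A := by
  obtain ⟨k, hk1, hk2⟩ := h.cnt
  refine ⟨h.c_lt, h.ln_le, ⟨k, hk1, ?_⟩, h.pend, ?_, h.codes⟩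
  · simp only [Prm.deg, List.countP_append] at hk2 ⊢
    omega
  · intro u hu hau
    rw [List.mem_append, List.mem_singleton] at hu
    rcases hu with hu | rfl
    · exact h.cover u hu hau
    · simp [hadj] at hau

theorem c_lt_M (hp : p.Good) (h : GroupInv p f l a pre b c ln cg A) : c < p.M := by
  rw [hp.MK]
  exact h.c_lt.trans_le (Nat.pow_le_pow_right (by have := hp.LK; omega) h.ln_le)

theorem code_lt (hp : p.Good) (h : GroupInv p f l a pre b c ln cg A) (hb : b < p.n) :
    b * p.M + c < p.E := by
  have h1 := h.c_lt_M hp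
  have h2 : (b + 1) * p.M ≤ p.n * p.M := Nat.mul_le_mul_right _ hb
  rw [Nat.succ_mul] at h2
  simp only [Prm.E]
  omega

theorem dec_code (hp : p.Good) (h : GroupInv p f l a pre b c ln cg A) :
    p.dec f (b * p.M + c) = digitList p.K f (b * p.L) c := by
  have h1 := h.c_lt_M hp
  have e1 : (b * p.M + c) / p.M = b := by
    rw [Nat.add_comm, Nat.add_mul_div_right _ _ hp.M0, Nat.div_eq_of_lt h1, zero_add]
  have e2 : (b * p.M + c) % p.M = c := by
    rw [Nat.add_comm, Nat.add_mul_mod_self_right, Nat.mod_eq_of_lt h1]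
  rw [Prm.dec, e1, e2]

/-- A group is closed for one of two reasons. A full group is paid for by its `g` neighbours and
counted by `k`; any other is paid for by the end of its block, through the increase of `b`. Hence
the number of groups is at most `deg / g` plus the number of blocks. -/
theorem close (hp : p.Good) (h : GroupInv p f l a pre b c ln cg A) (hb : b < p.n) {b' : ℕ}
    (hbb : b ≤ b') (hcl : ln = p.g ∨ b' = b + 1) {A' : ℕ → ℕ} (hA : ∀ t < cg, A' t = A t)
    (hA' : A' cg = b * p.M + c) : GroupInv p f l a pre b' 0 0 (cg + 1) A' := by
  obtain ⟨k, hk1, hk2⟩ := h.cnt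
  refine ⟨by simp, Nat.zero_le _, ?_, by simp [digitList], ?_, ?_⟩
  · rcases hcl with hcl | hcl
    · exact ⟨k + 1, by omega, by rw [Nat.mul_succ]; omega⟩
    · exact ⟨k, by omega, by omega⟩
  · intro u hu hau
    left
    rcases h.cover u hu hau with ⟨t, ht, h1⟩ | h1
    · exact ⟨t, by omega, by rwa [hA t ht]⟩
    · exact ⟨cg, by omega, by rwa [hA', h.dec_code hp]⟩
  · intro t ht
    rcases Nat.lt_succ_iff_lt_or_eq.1 ht with ht | rfl
    · rw [hA t ht]; exact h.codes t ht
    · rw [hA', h.dec_code hp]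
      exact ⟨h.code_lt hp hb, h.pend⟩

theorem cg_le (hp : p.Good) (h : GroupInv p f l a pre b c ln cg A) :
    cg ≤ p.deg a pre / p.g + b := by
  obtain ⟨k, hk1, hk2⟩ := h.cnt
  have : k ≤ p.deg a pre / p.g := by
    rw [Nat.le_div_iff_mul_le hp.g1, Nat.mul_comm]; omega
  omega

end GroupInv

-- A group ends when it is full or when its block ends, so a group never crosses blocks and its code
-- needs only the block number and offsets up to `L`. The last group is closed unconditionally, even
-- if empty, which accounts for the `+ 1`.
set_option maxHeartbeats 1000000 in
theorem exec_groups (hp : p.Good) {s : HS} (h : Node p Ls s) {q : ℕ} (hq : q = 1 ∨ q = 2)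
    (ha : s.v 21 < p.n) :
    ∃ t s', Exec p (groups q) s t s' ∧ t ≤ 500 * (p.n + 1) ∧ Node p Ls s' ∧
      s'.v (47 + q) ≤ p.deg (s.v 21) (Ls q) / p.g + (Ls q).length / p.L + 1 ∧
      (∀ i < s'.v (47 + q), s'.a (2 + q) i < p.E ∧
        ∀ u ∈ p.dec (s.a q) (s'.a (2 + q) i), u ∈ Ls q ∧ p.adj (s.v 21) u = true) ∧
      ∀ u ∈ Ls q, p.adj (s.v 21) u = true →
        ∃ i < s'.v (47 + q), u ∈ p.dec (s.a q) (s'.a (2 + q) i) := by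
  have hW := hp.hW1
  have hW2 := hp.hW2
  have hB0 := hp.B0
  have hBB : p.B ≤ p.B * p.B := Nat.le_mul_of_pos_right _ hB0
  have hnB := hp.nB
  have hSB := hp.SB
  have hLK := hp.LK
  have hKB := hp.KB
  have hMB := hp.MB
  have hgB := hp.gB
  have hL2 := hp.L2
  have hEB := hp.EEB
  have hq8 : q < 8 := by omega
  have hq8' : 2 + q < 8 := by omega
  have hmod : ∀ a b : ℕ, a - a / b * b = a % b := by
    intro a b; have := Nat.div_add_mod' a b; omega
  have hdle : ∀ a b : ℕ, a / b * b ≤ a := Nat.div_mul_le_self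
  have hset1 : Exec p (.set 46 0) s 3 _ := Big.set (by simp; omega)
  have hset2 : Exec p (.set 47 0) (s.setv 46 0) 3 _ := Big.set (by simp; omega)
  have hset3 : Exec p (.set (47 + q) 0) ((s.setv 46 0).setv 47 0) 3 _ := Big.set (by simp; omega)
  simp only [Ex.val_lit0] at hset1 hset2 hset3
  have hset := hset1.seq (hset2.seq hset3)
  have hN0 := h.frame hset.frame (by rcases hq with rfl | rfl <;> decide)
  obtain ⟨s0, hs0⟩ : ∃ s0, s0 = ((s.setv 46 0).setv 47 0).setv (47 + q) 0 := ⟨_, rfl⟩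
  rw [← hs0] at hset3 hN0
  have g46 : s0.v 46 = 0 := by rcases hq with rfl | rfl <;> simp [hs0]
  have g47 : s0.v 47 = 0 := by rcases hq with rfl | rfl <;> simp [hs0]
  have gq : s0.v (47 + q) = 0 := by rcases hq with rfl | rfl <;> simp [hs0]
  have g21 : s0.v 21 = s.v 21 := by rcases hq with rfl | rfl <;> simp [hs0]
  have ga : s0.a = s.a := by rw [hs0]; rfl
  clear hs0
  obtain ⟨t, s', hB, ht, ⟨hI1, hI2, hI3, hI4⟩, hN⟩ := hN0.for hp hq (i := 28)
    (c := .ite (adjE (V 21) (.arr q (V 28 + 1)))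
      (.set 46 (V 46 * V 10 + (modE (V 28) (V 9) + 1)) ;; .set 47 (V 47 + 1)) .skip ;;
    .ite (.eq (V 47) (V 8) + .eq (modE (V 28 + 1) (V 9)) 0)
      (.put (2 + q) (V (47 + q)) (V 28 / V 9 * V 11 + V 46) ;; .set (47 + q) (V (47 + q) + 1) ;;
        .set 46 0 ;; .set 47 0) .skip) 300
    (fun pre s' => s'.v 28 = pre.length ∧ s'.v 47 < p.g ∧ pre.length ≤ p.n ∧
      GroupInv p (s.a q) (Ls q) (s.v 21) pre (pre.length / p.L) (s'.v 46) (s'.v 47) (s'.v (47 + q))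
        (s'.a (2 + q))) (by norm_num)
    (by rcases hq with rfl | rfl <;> decide) (by rcases hq with rfl | rfl <;> decide)
    (by
      have hg := hp.g1
      refine ⟨by simp, by simp [g47]; omega, by simp, ?_⟩
      have e : (s0.setv 28 0).v (47 + q) = 0 := by rcases hq with rfl | rfl <;> simpa using gq
      rw [e]
      simp only [HS.setv_v, g46, g47]
      norm_num
      exact ⟨by simp, by simp, ⟨0, by simp⟩, by simp [digitList], by simp, by simp⟩)
    (by
      intro j x pre _ hj hx hxn s1 hF hN hv hax ⟨hI1, hI2, hI3, hI4⟩
      have hjn := (hj.trans_le (h.le hq))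
      have hjp : pre.length = j := by omega
      rw [hjp] at hI4 hI3
      have h21 : s1.v 21 = s.v 21 := by
        rw [hF.v (by rcases hq with rfl | rfl <;> decide), g21]
      have hfq : s1.a q = s.a q := by
        rw [hF.a (by rcases hq with rfl | rfl <;> decide), ga]
      have hao : (adjE (V 21) (.arr q (V 28 + 1))).ok p.W p.S p.I s1 := by
        refine adjE_ok hp rfl hN.v5 (by simp) ?_ (by simpa [h21]) (by simpa [hv, hax])
        simp [hv, hq8]; omega
      have hav := adjE_val (a := V 21) (u := .arr q (V 28 + 1)) hp hN.v5 (by simpa [h21])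
        (by simpa [hv, hax])
      simp only [Ex.val_var, Ex.val_arr, Ex.val_add, Ex.val_lit1, hv, hax, h21] at hav
      have hcM := hI4.c_lt_M hp
      have hmL := Nat.mod_lt j (show p.L > 0 by omega)
      have hcK : s1.v 46 * p.K ≤ p.B * p.B := Nat.mul_le_mul (by omega) hKB
      have hjL := hdle j p.L
      have hjL' := hdle (j + 1) p.L
      have hjd : j / p.L < p.n := (Nat.div_le_self _ _).trans_lt hjn
      -- Sides are stored from index `1` on, so position `j` is cell `j + 1`, at offset `j % L + 1`
      -- above the start of its block. Offsets therefore range over `1, …, L`, and the digit `0`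
      -- stays free.
      have hxeq : x = s.a q (j / p.L * p.L + (j % p.L + 1)) := by
        rw [← Nat.add_assoc, Nat.div_add_mod', ← hax, hfq]
      obtain ⟨t2, s2, hB2, ht2, h28, h47, hG, h29⟩ : ∃ t s2, Exec p (.ite (adjE (V 21) (.arr q (V 28 + 1)))
          (.set 46 (V 46 * V 10 + (modE (V 28) (V 9) + 1)) ;; .set 47 (V 47 + 1)) .skip) s1 t s2 ∧
          t ≤ 100 ∧ s2.v 28 = j ∧ s2.v 47 ≤ p.g ∧ GroupInv p (s.a q) (Ls q) (s.v 21) (pre ++ [x])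
            (j / p.L) (s2.v 46) (s2.v 47) (s2.v (47 + q)) (s2.a (2 + q)) ∧ Node p Ls s2 := by
        obtain ⟨t, hB, ht⟩ := St.big_run (W := p.W) (S := p.S) (I := p.I) (s := s1)
          (.ite (adjE (V 21) (.arr q (V 28 + 1)))
          (.set 46 (V 46 * V 10 + (modE (V 28) (V 9) + 1)) ;; .set 47 (V 47 + 1)) .skip) (by
            refine ⟨hao, fun _ => ?_, fun _ => ?_⟩
            · simp [St.ok, St.run, modE, hv, hN.v10, hN.v9, hmod]
              omega
            · simp [St.ok, St.skip]; omega)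
        refine ⟨t, _, hB, ht.trans (show _ ≤ 100 by rcases hq with rfl | rfl <;> decide), ?_, ?_, ?_,
          hN.frame hB.frame (by rcases hq with rfl | rfl <;> decide)⟩
        · rw [hB.frame.v (by rcases hq with rfl | rfl <;> decide), hv]
        · by_cases hc : p.adj (s.v 21) x = true
          · simp [St.run, hav, hc]; omega
          · simp [St.run, hav, hc, St.skip]; omega
        · rw [hB.frame.v (r := 47 + q) (by rcases hq with rfl | rfl <;> decide)]
          by_cases hc : p.adj (s.v 21) x = true
          · have := hI4.push hp hI2 (Nat.succ_pos _) hmL hxeq hx hc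
            simpa [St.run, hav, hc, modE, hv, hN.v10, hN.v9, hmod] using this
          · have := hI4.pass (x := x) (by simpa using hc)
            simpa [St.run, hav, hc, St.skip] using this
      have hcM2 := hG.c_lt_M hp
      have hcode := hG.code_lt hp hjd
      have hcg := hG.cg_le hp
      have hdg := Nat.div_le_self (p.deg (s.v 21) (pre ++ [x])) p.g
      have hdeg := p.deg_le (s.v 21) (pre ++ [x])
      rw [List.length_append, List.length_singleton, hjp] at hdeg
      have hval : (Ex.eq (V 47) (V 8) + .eq (modE (V 28 + 1) (V 9)) 0).val p.I s2 =
          (if s2.v 47 = p.g then 1 else 0) + (if (j + 1) % p.L = 0 then 1 else 0) := by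
        simp [modE, h28, h29.v8, h29.v9, hmod]
      have h01 : ∀ c : Prop, ∀ [Decidable c], (if c then 1 else 0 : ℕ) ≤ 1 := by
        intro c _; split_ifs <;> omega
      have hokc : (Ex.eq (V 47) (V 8) + .eq (modE (V 28 + 1) (V 9)) 0).ok p.W p.S p.I s2 := by
        have b1 := h01 (s2.v 47 = p.g)
        have b2 := h01 ((j + 1) % p.L = 0)
        simp [modE, h28, h29.v8, h29.v9, hmod]
        omega
      have hput : j / p.L * p.M ≤ p.B := by omega
      obtain ⟨t3, hB3, ht3⟩ := St.big_run (W := p.W) (S := p.S) (I := p.I) (s := s2)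
        (.ite (.eq (V 47) (V 8) + .eq (modE (V 28 + 1) (V 9)) 0)
          (.put (2 + q) (V (47 + q)) (V 28 / V 9 * V 11 + V 46) ;; .set (47 + q) (V (47 + q) + 1) ;;
          .set 46 0 ;; .set 47 0) .skip) (by
          refine ⟨hokc, fun _ => ?_, fun _ => ?_⟩
          · simp [St.ok, St.run, h28, h29.v9, h29.v11, hq8']
            omega
          · simp [St.ok, St.skip]; omega)
      refine ⟨_, _, hB2.seq hB3, ?_, ?_⟩
      · have : (St.ite (.eq (V 47) (V 8) + .eq (modE (V 28 + 1) (V 9)) 0)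
          (.put (2 + q) (V (47 + q)) (V 28 / V 9 * V 11 + V 46) ;; .set (47 + q) (V (47 + q) + 1) ;;
          .set 46 0 ;; .set 47 0) .skip).cost ≤ 150 := by rcases hq with rfl | rfl <;> decide
        omega
      have hlen' : (pre ++ [x]).length = j + 1 := by simp [hjp]
      rw [hlen']
      -- The block number grows exactly when `L ∣ j + 1`, which is the condition under which the
      -- program closes a group that is not full.
      have hsd : (j + 1) / p.L = j / p.L + if p.L ∣ j + 1 then 1 else 0 := Nat.succ_div
      by_cases hc : s2.v 47 = p.g ∨ (j + 1) % p.L = 0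
      · have hv0 : (Ex.eq (V 47) (V 8) + .eq (modE (V 28 + 1) (V 9)) 0).val p.I s2 ≠ 0 := by
          rw [hval]; rcases hc with hc | hc <;> simp [hc]
        have hcl := hG.close hp hjd (b' := (j + 1) / p.L) (Nat.div_le_div_right (by omega))
          (hc.imp_right fun hc => by rw [hsd, if_pos (Nat.dvd_of_mod_eq_zero hc)])
          (A' := Function.update (s2.a (2 + q)) (s2.v (47 + q)) (j / p.L * p.M + s2.v 46))
          (fun t ht => by simp [show t ≠ s2.v (47 + q) by omega]) (by simp)
        have hg := hp.g1
        refine ⟨by simp, ?_, by omega, ?_⟩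
        · simp only [St.run, hv0, ne_eq, not_false_eq_true, if_true]
          rcases hq with rfl | rfl <;> simp <;> omega
        · simp only [St.run, hv0, ne_eq, not_false_eq_true, if_true]
          rcases hq with rfl | rfl <;>
          · convert hcl using 1 <;> simp [HS.seta, h28, h29.v9, h29.v11]
      · have hv0 : (Ex.eq (V 47) (V 8) + .eq (modE (V 28 + 1) (V 9)) 0).val p.I s2 = 0 := by
          rw [hval]; push Not at hc; simp [hc.1, hc.2]
        push Not at hc
        rw [if_neg (fun hd => hc.2 (Nat.mod_eq_zero_of_dvd hd)), add_zero] at hsd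
        refine ⟨by simp, ?_, by omega, ?_⟩
        · simp only [St.run, hv0, ne_eq, not_true_eq_false, if_false, St.skip]
          simp; omega
        · simp only [St.run, hv0, ne_eq, not_true_eq_false, if_false, St.skip, hsd]
          rcases hq with rfl | rfl <;> simpa using hG)
  have hL := h.le hq
  have hbl : (Ls q).length / p.L < p.n := by
    rw [Nat.div_lt_iff_lt_mul (by omega)]
    have : p.n * 2 ≤ p.n * p.L := Nat.mul_le_mul_left _ hL2
    omega
  -- The final group is closed as if its block were complete, at the price of one more block.
  have hcl := hI4.close hp hbl (b' := (Ls q).length / p.L + 1) (by omega) (Or.inr rfl)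
      (A' := Function.update (s'.a (2 + q)) (s'.v (47 + q)) ((Ls q).length / p.L * p.M + s'.v 46))
      (fun t ht => by simp [show t ≠ s'.v (47 + q) by omega]) (by simp)
  have hcM2 := hI4.c_lt_M hp
  have hcode := hI4.code_lt hp hbl
  have hcg := hI4.cg_le hp
  have hdg := Nat.div_le_self (p.deg (s.v 21) (Ls q)) p.g
  have hdeg := p.deg_le (s.v 21) (Ls q)
  have hlen := hN.len hq
  obtain ⟨t3, hB3, ht3⟩ := St.big_run (W := p.W) (S := p.S) (I := p.I) (s := s')
    (.put (2 + q) (V (47 + q)) (V (18 + q) / V 9 * V 11 + V 46) ;; .set (47 + q) (V (47 + q) + 1)) (by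
      simp only [St.ok, St.run, Ex.ok_add, Ex.ok_mul, Ex.ok_div, Ex.ok_var, Ex.val_var, Ex.val_add,
        Ex.val_mul, Ex.val_div, HS.seta_v, hlen, hN.v9, hN.v11, Ex.ok_lit1, Ex.val_lit1, true_and,
        hq8']
      omega)
  have hc3 : (St.put (2 + q) (V (47 + q)) (V (18 + q) / V 9 * V 11 + V 46) ;;
    .set (47 + q) (V (47 + q) + 1)).cost ≤ 60 := by rcases hq with rfl | rfl <;> decide
  have hr1 : (St.run p.I (.put (2 + q) (V (47 + q)) (V (18 + q) / V 9 * V 11 + V 46) ;;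
    .set (47 + q) (V (47 + q) + 1)) s').v (47 + q) = s'.v (47 + q) + 1 := by
    simp [St.run]
  have hr2 : (St.run p.I (.put (2 + q) (V (47 + q)) (V (18 + q) / V 9 * V 11 + V 46) ;;
    .set (47 + q) (V (47 + q) + 1)) s').a (2 + q) =
      Function.update (s'.a (2 + q)) (s'.v (47 + q)) ((Ls q).length / p.L * p.M + s'.v 46) := by
    simp [St.run, HS.seta, hlen, hN.v9, hN.v11]
  refine ⟨_, _, hset1.seq (hset2.seq (hset3.seq (hB.seq hB3))), by omega,
    hN.frame hB3.frame (by rcases hq with rfl | rfl <;> decide), ?_, ?_, ?_⟩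
  · rw [hr1]; omega
  · rw [hr1, hr2]; exact hcl.codes
  · rw [hr1, hr2]
    intro u hu hau
    rcases hcl.cover u hu hau with h1 | h1
    · exact h1
    · simp [digitList] at h1

end

/-! ### Lookups for one vertex, and the treatment of a leaf -/

/-- The rectangles of a record, in order. -/
def rects (R : List Entry) : List (List ℕ × List ℕ) :=
  R.filterMap fun
    | .rect S T => some (S, T)
    | .use _ _ => none

/-- The cost of a record. -/
def costs (R : List Entry) : ℕ := (R.map Entry.cost).sum

theorem rects_append (R R' : List Entry) : rects (R ++ R') = rects R ++ rects R' :=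
  List.filterMap_append

theorem costs_append (R R' : List Entry) : costs (R ++ R') = costs R + costs R' := by
  simp [costs]

theorem rects_uses {R : List Entry} (h : ∀ e ∈ R, ∃ a y, e = .use a y) : rects R = [] := by
  simp only [rects, List.filterMap_eq_nil_iff]
  intro e he
  obtain ⟨a, y, rfl⟩ := h e he
  rfl

theorem costs_uses {R : List Entry} (h : ∀ e ∈ R, ∃ a y, e = .use a y) : costs R = R.length := by
  induction R with
  | nil => rfl
  | cons e R ih =>
    obtain ⟨a, y, rfl⟩ := h e (by simp)
    have := ih fun e he => h e (by simp [he])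
    simp only [costs, List.map_cons, List.sum_cons, List.length_cons, Entry.cost] at this ⊢
    omega

section
variable {p : Prm} {Ls : ℕ → List ℕ}

/-- Since the state `s₀`, at most `N` uses of rectangles have been written, all satisfying `Q`, and
either a triangle has been found, or these uses satisfy `C`. -/
def UseInv (p : Prm) (s₀ : HS) (Q : ℕ → Prop) (N : ℕ) (C : List Entry → Prop) (s : HS) : Prop :=
  Ans p s ∧ ∃ R : List Entry, s.out = s₀.out ++ R.flatMap Entry.encode ∧
    (∀ e ∈ R, ∃ a y, e = .use a y ∧ Q a) ∧ R.length ≤ N ∧ (s.v 0 = 0 → s₀.v 0 = 0 ∧ C R)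

theorem UseInv.setv {s₀ s : HS} {Q : ℕ → Prop} {N : ℕ} {C : List Entry → Prop}
    (h : UseInv p s₀ Q N C s) {r x : ℕ} (hr : 4 ≤ r) : UseInv p s₀ Q N C (s.setv r x) := by
  obtain ⟨h1, R, h2, h3, h4, h5⟩ := h
  refine ⟨h1.setv hr, R, h2, h3, h4, ?_⟩
  simpa [show 0 ≠ r by omega] using h5

theorem UseInv.mono {s₀ s : HS} {Q : ℕ → Prop} {N N' : ℕ} {C C' : List Entry → Prop}
    (h : UseInv p s₀ Q N C s) (hN : N ≤ N') (hC : ∀ R, C R → C' R) : UseInv p s₀ Q N' C' s := by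
  obtain ⟨h1, R, h2, h3, h4, h5⟩ := h
  exact ⟨h1, R, h2, h3, h4.trans hN, fun h0 => ⟨(h5 h0).1, hC R (h5 h0).2⟩⟩

theorem UseInv.trans {s₀ s s' : HS} {Q : ℕ → Prop} {N N' : ℕ} {C C' C'' : List Entry → Prop}
    (h : UseInv p s₀ Q N C s) (h' : UseInv p s Q N' C' s')
    (hC : ∀ R R', C R → C' R' → C'' (R ++ R')) : UseInv p s₀ Q (N + N') C'' s' := by
  obtain ⟨-, R, h2, h3, h4, h5⟩ := h
  obtain ⟨g1, R', g2, g3, g4, g5⟩ := h'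
  refine ⟨g1, R ++ R', by simp [g2, h2], ?_, by simp; omega, fun h0 => ?_⟩
  · intro e he
    rcases List.mem_append.1 he with he | he
    exacts [h3 e he, g3 e he]
  · obtain ⟨a1, a2⟩ := g5 h0
    obtain ⟨b1, b2⟩ := h5 a1
    exact ⟨b1, hC _ _ b2 a2⟩

theorem UseInv.refl {s : HS} (hA : Ans p s) (Q : ℕ → Prop) {C : List Entry → Prop} (hC : C []) :
    UseInv p s Q 0 C s :=
  ⟨hA, [], by simp, by simp, by simp, fun h => ⟨h, hC⟩⟩

/-- The groups consist of neighbours of `a`, so a nonzero cell, which names an edge between two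
groups, gives a triangle; this is what the hypothesis `hm` provides. A zero cell leads to a use of
the rectangle whose number is the address of the cell. -/
theorem exec_visit (hp : p.Good) {s : HS} (h : p.Holds s) (hA : Ans p s) {a : ℕ} (ha : a < p.n)
    (h21 : s.v 21 = a) (hJ : s.v 18 + p.E * p.E ≤ p.B)
    (hB48 : s.v 48 ≤ 2 * p.B + 1) (hB49 : s.v 49 ≤ 2 * p.B + 1)
    (h3 : ∀ i < s.v 48, s.a 3 i < p.E) (h4 : ∀ i < s.v 49, s.a 4 i < p.E)
    (hm : ∀ i < s.v 48, ∀ j < s.v 49, s.a 5 (s.v 18 + (s.a 3 i * p.E + s.a 4 j)) = 0 ∨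
      ∃ u < p.n, ∃ v < p.n, p.adj a u = true ∧ p.adj a v = true ∧ p.adj u v = true ∧
        s.a 5 (s.v 18 + (s.a 3 i * p.E + s.a 4 j)) = u * p.n + v + 1) :
    ∃ t s', Exec p visit s t s' ∧ t ≤ 300 * (s.v 48 * s.v 49) + 200 * (s.v 48 + 1) ∧
      UseInv p s (fun b => b = a) (s.v 48 * s.v 49) (fun R => ∀ i < s.v 48, ∀ j < s.v 49,
        s.a 5 (s.v 18 + (s.a 3 i * p.E + s.a 4 j)) = 0 ∧
          .use a (s.v 18 + (s.a 3 i * p.E + s.a 4 j)) ∈ R) s' := by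
  have hW := hp.hW1
  have hW2 := hp.hW2
  have hB0 := hp.B0
  have hBB : p.B ≤ p.B * p.B := Nat.le_mul_of_pos_right _ hB0
  have hSB := hp.SB
  have hnB := hp.nB
  have hEB := hp.EEB
  have hSS : p.n * p.n ≤ p.S := by simp only [Prm.S]; omega
  have hmod : ∀ a b : ℕ, a - a / b * b = a % b := by
    intro a b; have := Nat.div_add_mod' a b; omega
  have hdle : ∀ a b : ℕ, a / b * b ≤ a := Nat.div_mul_le_self
  obtain ⟨t, s', hB, ht, hI, -⟩ := Big.for (W := p.W) (S := p.S) (I := p.I) (i := 28) (b := 48)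
    (c := (.set 50 (V 18 + .arr 3 (V 28) * V 12) ;;
    .for 29 49 (.set 51 (V 50 + .arr 4 (V 29)) ;; .set 52 (.arr 5 (V 51)) ;;
      .ite (V 52) (.set 0 1 ;; .set 1 (V 21) ;; .set 2 ((V 52 - 1) / V 5) ;;
          .set 3 (modE (V 52 - 1) (V 5)))
        (.emit 1 ;; .emit (V 21) ;; .emit (V 51))))) (s₀ := s) (s.v 48)
    (fun _ => 170 * s.v 49 + 100)
    (fun j s' => UseInv p s (fun b => b = a) (j * s.v 49) (fun R => ∀ i < j, ∀ j < s.v 49,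
        s.a 5 (s.v 18 + (s.a 3 i * p.E + s.a 4 j)) = 0 ∧
          .use a (s.v 18 + (s.a 3 i * p.E + s.a 4 j)) ∈ R) s') hp.W1 (by omega) rfl
    (by decide) (by decide) (by decide)
    ((UseInv.refl hA _ (by simp)).setv (by norm_num) |>.mono (by simp) fun R h => h) (by
      intro i hi s1 hF hv hI
      have hH1 := h.frame hF (by decide)
      have g18 : s1.v 18 = s.v 18 := hF.v (by decide)
      have g21 : s1.v 21 = a := by rw [hF.v (by decide), h21]
      have g49 : s1.v 49 = s.v 49 := hF.v (by decide)
      have g3 : s1.a 3 = s.a 3 := hF.a (by decide)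
      have g4 : s1.a 4 = s.a 4 := hF.a (by decide)
      have g5 : s1.a 5 = s.a 5 := hF.a (by decide)
      have hAi := h3 i hi
      have hAE : s.a 3 i * p.E + p.E ≤ p.E * p.E := by
        rw [← Nat.succ_mul]; exact Nat.mul_le_mul_right _ hAi
      have hset : Exec p (.set 50 (V 18 + .arr 3 (V 28) * V 12)) s1 23 _ := Big.set (by
        simp [hv, g18, g3, hH1.v12]; omega)
      simp only [Ex.val_add, Ex.val_var, Ex.val_mul, Ex.val_arr, hv, g18, g3, hH1.v12] at hset
      set s2 := s1.setv 50 (s.v 18 + s.a 3 i * p.E) with hs2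
      have hH2 := hH1.frame hset.frame (by decide)
      obtain ⟨t, s3, hB3, ht3, hI3, -⟩ := Big.for (W := p.W) (S := p.S) (I := p.I) (i := 29) (b := 49)
        (c := (.set 51 (V 50 + .arr 4 (V 29)) ;; .set 52 (.arr 5 (V 51)) ;;
          .ite (V 52) (.set 0 1 ;; .set 1 (V 21) ;; .set 2 ((V 52 - 1) / V 5) ;;
              .set 3 (modE (V 52 - 1) (V 5)))
            (.emit 1 ;; .emit (V 21) ;; .emit (V 51)))) (s₀ := s2) (s.v 49)
        (fun _ => 150)
        (fun j s' => UseInv p s (fun b => b = a) (i * s.v 49 + j)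
          (fun R => (∀ i' < i, ∀ j < s.v 49,
            s.a 5 (s.v 18 + (s.a 3 i' * p.E + s.a 4 j)) = 0 ∧
              .use a (s.v 18 + (s.a 3 i' * p.E + s.a 4 j)) ∈ R) ∧
            ∀ j' < j, s.a 5 (s.v 18 + (s.a 3 i * p.E + s.a 4 j')) = 0 ∧
              .use a (s.v 18 + (s.a 3 i * p.E + s.a 4 j')) ∈ R) s') hp.W1 (by omega) (by simpa [hs2])
        (by decide) (by decide) (by decide)
        (((hI.setv (by norm_num)).setv (by norm_num)).mono (by simp) fun R h => ⟨h, by simp⟩) (by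
          intro j hj s4 hF4 hv4 hI4
          have hH4 := hH2.frame hF4 (by decide)
          have f50 : s4.v 50 = s.v 18 + s.a 3 i * p.E := by rw [hF4.v (by decide)]; simp [hs2]
          have f21 : s4.v 21 = a := by rw [hF4.v (by decide)]; simpa [hs2]
          have f4 : s4.a 4 = s.a 4 := by rw [hF4.a (by decide)]; simpa [hs2]
          have f5 : s4.a 5 = s.a 5 := by rw [hF4.a (by decide)]; simpa [hs2]
          have hCj := h4 j hj
          have hset1 : Exec p (.set 51 (V 50 + .arr 4 (V 29))) s4 19 _ := Big.set (by
            simp [hv4, f50, f4]; omega)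
          simp only [Ex.val_add, Ex.val_var, Ex.val_arr, hv4, f50, f4, Nat.add_assoc] at hset1
          set y := s.v 18 + (s.a 3 i * p.E + s.a 4 j) with hy
          have hset2 : Exec p (.set 52 (.arr 5 (V 51))) (s4.setv 51 y) 15 _ := Big.set (by
            simp; omega)
          simp only [Ex.val_var, Ex.val_arr, HS.setv_v, HS.setv_a, f5, if_true] at hset2
          set s5 := (s4.setv 51 y).setv 52 (s.a 5 y) with hs5
          have hI5 := (hI4.setv (r := 51) (x := y) (by norm_num)).setv (r := 52) (x := s.a 5 y)
            (by norm_num)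
          rw [← hs5] at hI5
          have k52 : s5.v 52 = s.a 5 y := by simp [hs5]
          have k51 : s5.v 51 = y := by simp [hs5]
          have k21 : s5.v 21 = a := by simpa [hs5]
          have hH5 := (hH4.frame hset1.frame (by decide)).frame hset2.frame (by decide)
          obtain ⟨t, hB, ht⟩ := St.big_run (W := p.W) (S := p.S) (I := p.I) (s := s5)
            (.ite (V 52) (.set 0 1 ;; .set 1 (V 21) ;; .set 2 ((V 52 - 1) / V 5) ;;
              .set 3 (modE (V 52 - 1) (V 5)))
            (.emit 1 ;; .emit (V 21) ;; .emit (V 51))) (by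
              have hd := hdle (s.a 5 y - 1) p.n
              have hy5 : s.a 5 y ≤ p.B + 1 := by
                rcases hm i hi j hj with h0 | ⟨u, hu, v, hv', -, -, -, hy5⟩
                · rw [← hy] at h0; omega
                · rw [← hy] at hy5
                  have := hp.index hu hv'
                  omega
              refine ⟨by simp, fun h0 => ?_, fun _ => ?_⟩
              · simp only [Ex.val_var, k52] at h0
                simp [St.ok, St.run, k52, modE, hH5.v5]
                omega
              · simp [St.ok]; omega)
          have hcost : (St.ite (V 52) (.set 0 1 ;; .set 1 (V 21) ;; .set 2 ((V 52 - 1) / V 5) ;;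
              .set 3 (modE (V 52 - 1) (V 5)))
            (.emit 1 ;; .emit (V 21) ;; .emit (V 51))).cost ≤ 100 := by decide
          refine ⟨_, _, hset1.seq (hset2.seq hB), by omega, ?_⟩
          refine UseInv.setv ?_ (by norm_num)
          have hUI : UseInv p s5 (fun b => b = a) 1 (fun R => s.a 5 y = 0 ∧ .use a y ∈ R)
              (St.run p.I (.ite (V 52) (.set 0 1 ;; .set 1 (V 21) ;; .set 2 ((V 52 - 1) / V 5) ;;
              .set 3 (modE (V 52 - 1) (V 5)))
            (.emit 1 ;; .emit (V 21) ;; .emit (V 51))) s5) := by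
            rcases hm i hi j hj with h0 | ⟨u, hu, v, hv', hau, hav, huv, hy5⟩
            · rw [← hy] at h0
              simp only [St.run, Ex.val_var, k52, h0, ne_eq, not_true_eq_false, if_false]
              refine ⟨hI5.1.congr (by simp), [.use a y], ?_, by simp, by simp, ?_⟩
              · simp [Entry.encode, k21, k51]
              · simp
            · rw [← hy] at hy5
              have hne : s.a 5 y ≠ 0 := by omega
              -- Cells store `u * n + v + 1`; the shift keeps `0` free to mean that no edge was
              -- found.
              have e1 : s.a 5 y - 1 = v + u * p.n := by omega
              have e2 : (s.a 5 y - 1) / p.n = u := by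
                rw [e1, Nat.add_mul_div_right _ _ (by omega), Nat.div_eq_of_lt hv', zero_add]
              have e3 : (s.a 5 y - 1) % p.n = v := by
                rw [e1, Nat.add_mul_mod_self_right, Nat.mod_eq_of_lt hv']
              have e4 : s.a 5 y - 1 - u * p.n = v := by omega
              simp only [St.run, Ex.val_var, k52, hne, ne_eq, not_false_eq_true, if_true]
              refine ⟨⟨by simp, fun _ => ?_⟩, [], by simp, by simp, by simp, by simp⟩
              simp [k52, k21, modE, hH5.v5, e2, e4, hu, hv', ha, hau, hav, huv]
          refine hI5.trans hUI ?_
          rintro R R' ⟨hR1, hR2⟩ ⟨hR3, hR4⟩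
          refine ⟨fun i' hi' j' hj' => ⟨(hR1 i' hi' j' hj').1, ?_⟩, fun j' hj' => ?_⟩
          · exact List.mem_append_left _ (hR1 i' hi' j' hj').2
          · rcases Nat.lt_succ_iff_lt_or_eq.1 hj' with hj' | rfl
            · exact ⟨(hR2 j' hj').1, List.mem_append_left _ (hR2 j' hj').2⟩
            · exact ⟨hR3, List.mem_append_right _ hR4⟩)
      refine ⟨_, _, hset.seq hB3, ?_, ?_⟩
      · simp only [Finset.sum_const, Finset.card_range, smul_eq_mul] at ht3
        omega
      · refine (hI3.setv (by norm_num)).mono (by rw [Nat.succ_mul]) ?_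
        rintro R ⟨hR1, hR2⟩ i' hi'
        rcases Nat.lt_succ_iff_lt_or_eq.1 hi' with hi' | rfl
        exacts [hR1 i' hi', hR2])
  refine ⟨t, s', hB, ht.trans ?_, hI⟩
  simp only [Finset.sum_const, Finset.card_range, smul_eq_mul]
  have : s.v 48 * (170 * s.v 49 + 100 + 20) = 170 * (s.v 48 * s.v 49) + 120 * s.v 48 := by ring
  omega

/-- Bound for the number of groups of a vertex of degree `d` on a side of length `len`. -/
def Prm.ngroups (p : Prm) (d len : ℕ) : ℕ := d / p.g + len / p.L + 1

/-- Bound for the total number of pairs of groups. -/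
def Prm.npairs (p : Prm) (Ls : ℕ → List ℕ) : ℕ :=
  ∑ a ∈ Finset.range p.n, p.ngroups (p.deg a (Ls 1)) (Ls 1).length *
    p.ngroups (p.deg a (Ls 2)) (Ls 2).length

/-- Bound for the cost of a subproblem without dense vertices. -/
def Prm.leafCost (p : Prm) (Ls : ℕ → List ℕ) : ℕ :=
  4000 * (p.E * p.E * ((p.g + 1) * (p.g + 1)) + (p.n + 1) * (p.n + 1) + p.npairs Ls)

/-- The entries for all pairs of groups. -/
def Prm.tabEntries (p : Prm) (f₁ f₂ : ℕ → ℕ) (N : ℕ) : List Entry :=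
  (List.range N).map fun j => p.pairEnt (p.dec f₁ (j / p.E)) (p.dec f₂ (j % p.E))

-- Cells are addressed by the global number of the rectangle. No cell is shared by two subproblems,
-- so the array never has to be cleared: everything from the current counter on is still `0`.
set_option maxHeartbeats 400000 in
theorem exec_table (hp : p.Good) {s : HS} (h : p.Holds s)
    (hf : 0 < p.n → ∀ i, s.a 1 i < p.n ∧ s.a 2 i < p.n)
    (hJ : s.v 18 + p.E * p.E ≤ p.B) (hm : ∀ i, s.v 18 ≤ i → s.a 5 i = 0) :
    ∃ t s', Exec p (.for 28 13 pairEntry) s t s' ∧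
      t ≤ 3020 * (p.E * p.E * ((p.g + 1) * (p.g + 1))) + 20 ∧
      s'.out = s.out ++ (p.tabEntries (s.a 1) (s.a 2) (p.E * p.E)).flatMap Entry.encode ∧
      (∀ i, s.v 18 + p.E * p.E ≤ i → s'.a 5 i = 0) ∧
      ∀ j < p.E * p.E, (p.clear (p.dec (s.a 1) (j / p.E)) (p.dec (s.a 2) (j % p.E)) = true ∧
          s'.a 5 (s.v 18 + j) = 0) ∨
        ∃ u ∈ p.dec (s.a 1) (j / p.E), ∃ v ∈ p.dec (s.a 2) (j % p.E), p.adj u v = true ∧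
            s'.a 5 (s.v 18 + j) = u * p.n + v + 1 := by
  have hW := hp.hW1
  have hB0 := hp.B0
  obtain ⟨t, s', hB, ht, ⟨hI1, hI2, hI3⟩, -⟩ := Big.for (W := p.W) (S := p.S) (I := p.I) (i := 28) (b := 13)
    (c := pairEntry) (s₀ := s) (p.E * p.E)
    (fun _ => 3000 * ((p.g + 1) * (p.g + 1)))
    (fun N s' => s'.out = s.out ++ (p.tabEntries (s.a 1) (s.a 2) N).flatMap Entry.encode ∧
      (∀ i, s.v 18 + N ≤ i → s'.a 5 i = 0) ∧
      ∀ j < N, (p.clear (p.dec (s.a 1) (j / p.E)) (p.dec (s.a 2) (j % p.E)) = true ∧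
          s'.a 5 (s.v 18 + j) = 0) ∨
        ∃ u ∈ p.dec (s.a 1) (j / p.E), ∃ v ∈ p.dec (s.a 2) (j % p.E), p.adj u v = true ∧
            s'.a 5 (s.v 18 + j) = u * p.n + v + 1) hp.W1 (by omega) h.v13 (by decide) (by decide)
    (by decide) ⟨by simp [Prm.tabEntries], by simpa using hm, by simp⟩ (by
      intro j hj s1 hF hv ⟨hI1, hI2, hI3⟩
      have hn : 0 < p.n := by
        by_contra hc
        simp [Prm.E, show p.n = 0 by omega] at hj
      have hH1 := h.frame hF (by decide)
      have e1 : s1.a 1 = s.a 1 := hF.a (by decide)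
      have e2 : s1.a 2 = s.a 2 := hF.a (by decide)
      have e18 : s1.v 18 = s.v 18 := hF.v (by decide)
      obtain ⟨t, s2, hB, ht, ho, hI⟩ := exec_pairEntry hp hH1 hj hv
        (fun i => by rw [e1]; exact (hf hn i).1) (fun i => by rw [e2]; exact (hf hn i).2) (by omega)
      rw [e1, e2] at ho hI
      rw [e18] at hI
      have hother : ∀ i, i ≠ s.v 18 + j → s2.a 5 i = s1.a 5 i := by
        rcases hI with ⟨-, h5⟩ | ⟨-, h5, -⟩
        · intro i _; rw [h5]
        · exact h5
      refine ⟨t, s2, hB, ht, ?_, ?_, ?_⟩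
      · simp [ho, hI1, Prm.tabEntries, List.range_succ]
      · intro i hi
        rw [HS.setv_a, hother i (by omega), hI2 i (by omega)]
      · intro j' hj'
        rw [HS.setv_a]
        rcases Nat.lt_succ_iff_lt_or_eq.1 hj' with hj' | rfl
        · rw [hother _ (by omega)]
          exact hI3 j' hj'
        · rcases hI with ⟨h4, h5⟩ | ⟨-, -, h5⟩
          · left
            refine ⟨h4, ?_⟩
            rw [h5, hI2 _ le_rfl]
          · exact Or.inr h5)
  refine ⟨t, s', hB, ht.trans ?_, hI1, hI2, hI3⟩
  simp only [Finset.sum_const, Finset.card_range, smul_eq_mul]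
  have e : p.E * p.E * (3000 * ((p.g + 1) * (p.g + 1)) + 20) =
    3000 * (p.E * p.E * ((p.g + 1) * (p.g + 1))) + 20 * (p.E * p.E) := by ring
  have : p.E * p.E ≤ p.E * p.E * ((p.g + 1) * (p.g + 1)) := Nat.le_mul_of_pos_right _ (by positivity)
  omega

end

/-- The vertices in an entry are below `n`. -/
def Entry.Lt (n : ℕ) : Entry → Prop
  | .rect S T => (∀ u ∈ S, u < n) ∧ ∀ v ∈ T, v < n
  | .use a _ => a < n

section
variable {p : Prm} {Ls : ℕ → List ℕ}

/-- In `R`, whose rectangles are numbered from `J` on, a rectangle with `(u, v)` is used for `a`. -/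
def Covers (J : ℕ) (R : List Entry) (a u v : ℕ) : Prop :=
  ∃ j S T, .use a (J + j) ∈ R ∧ (rects R)[j]? = some (S, T) ∧ u ∈ S ∧ v ∈ T

/-- From the state `s` to the state `s'` the entries `R`, of cost at most `c`, have been written, and
if no triangle has been found then they are correct and satisfy `C`. -/
structure Written (p : Prm) (s s' : HS) (R : List Entry) (c : ℕ) (C : Prop) : Prop where
  out : s'.out = s.out ++ R.flatMap Entry.encode
  count : s'.v 18 = s.v 18 + (rects R).length
  lt : ∀ e ∈ R, e.Lt p.n
  cost : costs R ≤ c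
  ans : Ans p s'
  correct : s'.v 0 = 0 → s.v 0 = 0 ∧ (∀ r ∈ rects R, p.clear r.1 r.2 = true) ∧ C

theorem rects_tabEntries (p : Prm) (f₁ f₂ : ℕ → ℕ) (N : ℕ) :
    rects (p.tabEntries f₁ f₂ N) = (List.range N).map fun j =>
      if p.clear (p.dec f₁ (j / p.E)) (p.dec f₂ (j % p.E)) then
        (p.dec f₁ (j / p.E), p.dec f₂ (j % p.E)) else ([], []) := by
  induction N with
  | zero => rfl
  | succ N ih =>
    simp only [Prm.tabEntries] at ih
    simp only [Prm.tabEntries, List.range_succ, List.map_append, rects_append, ih, List.map_cons,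
      List.map_nil]
    congr 1
    simp only [Prm.pairEnt]
    split_ifs <;> rfl

theorem costs_tabEntries (hp : p.Good) (f₁ f₂ : ℕ → ℕ) (N : ℕ) :
    costs (p.tabEntries f₁ f₂ N) ≤ N * (p.g * p.g) := by
  induction N with
  | zero => simp [Prm.tabEntries, costs]
  | succ N ih =>
    simp only [Prm.tabEntries] at ih
    simp only [Prm.tabEntries, List.range_succ, List.map_append, costs_append, List.map_cons,
      List.map_nil, Nat.succ_mul]
    refine Nat.add_le_add ih ?_
    simp only [Prm.pairEnt]
    split_ifs
    · simpa [costs, Entry.cost] using Nat.mul_le_mul (hp.length_dec _ _) (hp.length_dec _ _)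
    · simp [costs, Entry.cost]

-- Given neighbours `u`, `v` of `a`, the group of `u` and the group of `v` form a pair that is
-- looked up for `a`. If no triangle has been found, its cell is `0`, so the pair is clear and the
-- table holds the true rectangle rather than the empty substitute.
set_option maxHeartbeats 1000000 in
theorem exec_leaf (hp : p.Good) {s : HS} (h : Node p Ls s) (hA : Ans p s)
    (hf : 0 < p.n → ∀ i, s.a 1 i < p.n ∧ s.a 2 i < p.n)
    (hJ : s.v 18 + p.E * p.E ≤ p.B) (hm : ∀ i, s.v 18 ≤ i → s.a 5 i = 0) :
    ∃ t s' R, Exec p leaf s t s' ∧ t ≤ p.leafCost Ls ∧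
      Written p s s' R (p.leafCost Ls) (∀ a < p.n, ∀ u ∈ Ls 1, ∀ v ∈ Ls 2, p.adj a u = true →
        p.adj a v = true → Covers (s.v 18) R a u v) ∧
      (rects R).length = p.E * p.E ∧ ∀ i, s'.v 18 ≤ i → s'.a 5 i = 0 := by
  have hW := hp.hW1
  have hB0 := hp.B0
  have hnB := hp.nB
  obtain ⟨t1, s1, hB1, ht1, ho1, hz1, hm1⟩ := exec_table hp h.toHolds hf hJ hm
  have hN1 := h.frame hB1.frame (by decide)
  have hA1 := hA.frame hB1.frame (by decide)
  have e1 : s1.a 1 = s.a 1 := hB1.frame.a (by decide)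
  have e2 : s1.a 2 = s.a 2 := hB1.frame.a (by decide)
  have e18 : s1.v 18 = s.v 18 := hB1.frame.v (by decide)
  have e0 : s1.v 0 = s.v 0 := hB1.frame.v (by decide)
  set DB := fun a => p.ngroups (p.deg a (Ls 1)) (Ls 1).length with hDB
  set DC := fun a => p.ngroups (p.deg a (Ls 2)) (Ls 2).length with hDC
  have hD : ∀ q, q = 1 ∨ q = 2 → ∀ a, p.ngroups (p.deg a (Ls q)) (Ls q).length ≤ 2 * p.n + 1 := by
    intro q hq a
    have h1 := h.le hq
    have h2 := p.deg_le a (Ls q)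
    have h3 := Nat.div_le_self (p.deg a (Ls q)) p.g
    have h4 := Nat.div_le_self (Ls q).length p.L
    simp only [Prm.ngroups]
    omega
  obtain ⟨t2, s2, hB2, ht2, hI2, -⟩ := Big.for (W := p.W) (S := p.S) (I := p.I) (i := 21) (b := 5)
    (c := (groups 1 ;; groups 2 ;; visit)) (s₀ := s1) p.n
    (fun a => 1600 * (p.n + 1) + 300 * (DB a * DC a))
    (fun N s' => UseInv p s1 (fun b => b < p.n) (∑ a ∈ Finset.range N, DB a * DC a)
      (fun R => ∀ a < N, ∀ u ∈ Ls 1, ∀ v ∈ Ls 2, p.adj a u = true → p.adj a v = true →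
        ∃ j < p.E * p.E, .use a (s.v 18 + j) ∈ R ∧
          p.clear (p.dec (s.a 1) (j / p.E)) (p.dec (s.a 2) (j % p.E)) = true ∧
          u ∈ p.dec (s.a 1) (j / p.E) ∧ v ∈ p.dec (s.a 2) (j % p.E)) s')
    hp.W1 hp.nW hN1.v5 (by decide) (by decide) (by decide)
    ((UseInv.refl hA1 _ (by simp)).setv (by norm_num)) (by
      intro a ha s3 hF hv hI3
      have hN3 := hN1.frame hF (by decide)
      obtain ⟨t4, s4, hB4, ht4, hN4, hc4, hd4, hk4⟩ := exec_groups hp hN3 (q := 1) (by simp) (by omega)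
      have v21 : s4.v 21 = a := by rw [hB4.frame.v (by decide), hv]
      obtain ⟨t5, s5, hB5, ht5, hN5, hc5, hd5, hk5⟩ := exec_groups hp hN4 (q := 2) (by simp) (by omega)
      norm_num at hc4 hd4 hk4 hc5 hd5 hk5
      rw [v21] at hd5 hk5 hc5
      rw [hv] at hd4 hk4 hc4
      have c1 : s3.a 1 = s.a 1 := by rw [hF.a (by decide), e1]
      have c2 : s4.a 2 = s.a 2 := by rw [hB4.frame.a (by decide), hF.a (by decide), e2]
      rw [c1] at hd4 hk4
      rw [c2] at hd5 hk5
      have c3 : s5.a 3 = s4.a 3 := hB5.frame.a (by decide)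
      have c48 : s5.v 48 = s4.v 48 := hB5.frame.v (by decide)
      have c5 : s5.a 5 = s1.a 5 := by
        rw [hB5.frame.a (by decide), hB4.frame.a (by decide), hF.a (by decide)]
      have c18 : s5.v 18 = s.v 18 := by
        rw [hB5.frame.v (by decide), hB4.frame.v (by decide), hF.v (by decide), e18]
      have v21' : s5.v 21 = a := by rw [hB5.frame.v (by decide), v21]
      rw [← c3, ← c48] at hd4 hk4
      rw [← c48] at hc4
      have hF35 := (hB4.seq hB5).frame
      have hA5 : Ans p s5 := hI3.1.frame hF35 (by decide)
      have hE0 : ∀ {i}, i < p.E → 0 < p.E := fun h => by omega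
      have hj : ∀ i < s5.v 48, ∀ j < s5.v 49, s5.a 3 i * p.E + s5.a 4 j < p.E * p.E ∧
          (s5.a 3 i * p.E + s5.a 4 j) / p.E = s5.a 3 i ∧
          (s5.a 3 i * p.E + s5.a 4 j) % p.E = s5.a 4 j := by
        intro i hi j hj
        have h1 := (hd4 i hi).1
        have h2 := (hd5 j hj).1
        have h3 : (s5.a 3 i + 1) * p.E ≤ p.E * p.E := Nat.mul_le_mul_right _ h1
        rw [Nat.succ_mul] at h3
        refine ⟨by omega, ?_, ?_⟩
        · rw [Nat.add_comm, Nat.add_mul_div_right _ _ (by omega), Nat.div_eq_of_lt h2, zero_add]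
        · rw [Nat.add_comm, Nat.add_mul_mod_self_right, Nat.mod_eq_of_lt h2]
      have hDB' := hD 1 (by simp) a
      have hDC' := hD 2 (by simp) a
      have hc4' : s5.v 48 ≤ DB a := hc4
      have hc5' : s5.v 49 ≤ DC a := hc5
      obtain ⟨t6, s6, hB6, ht6, hI6⟩ := exec_visit hp hN5.toHolds hA5 ha v21' (by rwa [c18])
        (by simp only [hDB] at hc4'; omega) (by simp only [hDC] at hc5'; omega)
        (fun i hi => (hd4 i hi).1) (fun i hi => (hd5 i hi).1) (by
          intro i hi j hj'
          obtain ⟨k1, k2, k3⟩ := hj i hi j hj'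
          rw [c18, c5]
          rcases hm1 _ k1 with ⟨-, h0⟩ | ⟨u, hu, v, hv, huv, hy⟩
          · exact Or.inl h0
          · rw [k2] at hu
            rw [k3] at hv
            obtain ⟨b1, b2⟩ := (hd4 i hi).2 u hu
            obtain ⟨b3, b4⟩ := (hd5 j hj').2 v hv
            exact Or.inr ⟨u, h.lt (by simp) u b1, v, h.lt (by simp) v b3, b2, b4, huv, hy⟩)
      refine ⟨_, _, hB4.seq (hB5.seq hB6), ?_, ?_⟩
      · have := Nat.mul_le_mul hc4' hc5'
        simp only [hDB, hDC] at hc4' hc5' this ⊢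
        omega
      · refine UseInv.setv ?_ (by norm_num)
        rw [Finset.sum_range_succ]
        have hI5 : UseInv p s1 (fun b => b < p.n) (∑ a ∈ Finset.range a, DB a * DC a)
            (fun R => ∀ b < a, ∀ u ∈ Ls 1, ∀ v ∈ Ls 2, p.adj b u = true → p.adj b v = true →
              ∃ j < p.E * p.E, .use b (s.v 18 + j) ∈ R ∧
                p.clear (p.dec (s.a 1) (j / p.E)) (p.dec (s.a 2) (j % p.E)) = true ∧
                u ∈ p.dec (s.a 1) (j / p.E) ∧ v ∈ p.dec (s.a 2) (j % p.E)) s5 := by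
          obtain ⟨g1, R, g2, g3, g4, g5⟩ := hI3
          refine ⟨hA5, R, ?_, g3, g4, ?_⟩
          · rw [hF35.out rfl, g2]
          · rw [hF35.v (by decide)]; exact g5
        have hI6' : UseInv p s5 (fun b => b < p.n) (DB a * DC a) (fun R =>
            ∀ i < s5.v 48, ∀ j < s5.v 49, s5.a 5 (s5.v 18 + (s5.a 3 i * p.E + s5.a 4 j)) = 0 ∧
              .use a (s5.v 18 + (s5.a 3 i * p.E + s5.a 4 j)) ∈ R) s6 := by
          obtain ⟨g1, R, g2, g3, g4, g5⟩ := hI6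
          refine ⟨g1, R, g2, ?_, g4.trans (Nat.mul_le_mul hc4' hc5'), g5⟩
          intro e he
          obtain ⟨b, y, rfl, rfl⟩ := g3 e he
          exact ⟨_, y, rfl, ha⟩
        refine hI5.trans hI6' ?_
        intro R R' hR hR' b hb u hu v hvL hbu hbv
        rcases Nat.lt_succ_iff_lt_or_eq.1 hb with hb | rfl
        · obtain ⟨j, k1, k2, k3⟩ := hR b hb u hu v hvL hbu hbv
          exact ⟨j, k1, List.mem_append_left _ k2, k3⟩
        · obtain ⟨i, hi, hui⟩ := hk4 u hu hbu
          obtain ⟨j, hj', hvj⟩ := hk5 v hvL hbv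
          obtain ⟨k1, k2, k3⟩ := hj i hi j hj'
          obtain ⟨k4, k5⟩ := hR' i hi j hj'
          rw [c18] at k4 k5
          refine ⟨_, k1, List.mem_append_right _ k5, ?_, by rwa [k2], by rwa [k3]⟩
          -- A pair of groups joined by an edge would have left a nonzero cell, contrary to `k4`.
          rcases hm1 _ k1 with ⟨hcl, -⟩ | ⟨u', hu', v', hv', huv, hy⟩
          · exact hcl
          · rw [c5, hy] at k4
            omega)
  have c18 : s2.v 18 = s.v 18 := by rw [hB2.frame.v (by decide), e18]
  have c13 : s2.v 13 = p.E * p.E := (hN1.frame hB2.frame (by decide)).v13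
  have hset : Exec p (.set 18 (V 18 + V 13)) s2 7 _ := Big.set (by simp [c18, c13]; omega)
  simp only [Ex.val_add, Ex.val_var, c18, c13] at hset
  obtain ⟨g1, R, g2, g3, g4, g5⟩ := hI2
  have gu : ∀ e ∈ R, ∃ a y, e = .use a y := fun e he => by
    obtain ⟨a, y, rfl, -⟩ := g3 e he
    exact ⟨a, y, rfl⟩
  have hrects : rects (p.tabEntries (s.a 1) (s.a 2) (p.E * p.E) ++ R) =
      rects (p.tabEntries (s.a 1) (s.a 2) (p.E * p.E)) := by
    rw [rects_append, rects_uses gu, List.append_nil]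
  have hlen : (rects (p.tabEntries (s.a 1) (s.a 2) (p.E * p.E))).length = p.E * p.E := by
    simp [rects_tabEntries]
  have hsum : ∑ a ∈ Finset.range p.n, DB a * DC a = p.npairs Ls := rfl
  have hgg : p.g * p.g ≤ (p.g + 1) * (p.g + 1) := Nat.mul_le_mul (by omega) (by omega)
  refine ⟨_, _, p.tabEntries (s.a 1) (s.a 2) (p.E * p.E) ++ R, hB1.seq (hB2.seq hset), ?_,
    ⟨?_, ?_, ?_, ?_, g1.setv (by norm_num), ?_⟩, ?_, ?_⟩
  · have e : ∑ a ∈ Finset.range p.n, (1600 * (p.n + 1) + 300 * (DB a * DC a) + 20) =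
        p.n * (1600 * (p.n + 1) + 20) + 300 * p.npairs Ls := by
      rw [← hsum, Finset.mul_sum, Finset.sum_congr rfl (g := fun a => (1600 * (p.n + 1) + 20) +
        300 * (DB a * DC a)) (fun a _ => by ring), Finset.sum_add_distrib]
      simp
    rw [e] at ht2
    have e' : p.n * (1600 * (p.n + 1) + 20) ≤ 1620 * ((p.n + 1) * (p.n + 1)) := by nlinarith
    have : 1 ≤ (p.n + 1) * (p.n + 1) := Nat.mul_pos (by omega) (by omega)
    simp only [Prm.leafCost]
    omega
  · simp only [HS.setv_out, g2, ho1, List.flatMap_append, List.append_assoc]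
  · simp [hrects, hlen]
  · intro e he
    rcases List.mem_append.1 he with he | he
    · simp only [Prm.tabEntries, List.mem_map, List.mem_range] at he
      obtain ⟨j, hj, rfl⟩ := he
      have hn : 0 < p.n := by
        by_contra hc
        simp [Prm.E, show p.n = 0 by omega] at hj
      simp only [Prm.pairEnt]
      split_ifs
      · constructor
        · intro u hu; obtain ⟨i, rfl⟩ := mem_digitList hu; exact (hf hn i).1
        · intro u hu; obtain ⟨i, rfl⟩ := mem_digitList hu; exact (hf hn i).2
      · simp [Entry.Lt]
    · obtain ⟨a, y, rfl, ha⟩ := g3 e he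
      exact ha
  · rw [costs_append, costs_uses gu]
    have := costs_tabEntries hp (s.a 1) (s.a 2) (p.E * p.E)
    have := Nat.mul_le_mul_left (p.E * p.E) hgg
    simp only [Prm.leafCost]
    omega
  · simp only [HS.setv_v]
    intro h0
    obtain ⟨k1, k2⟩ := g5 h0
    refine ⟨by omega, ?_, ?_⟩
    · rw [hrects, rects_tabEntries]
      intro r hr
      simp only [List.mem_map] at hr
      obtain ⟨j, -, rfl⟩ := hr
      split_ifs with hc
      · exact hc
      · simp [Prm.clear]
    · intro a ha u hu v hv hau hav
      obtain ⟨j, l1, l2, l3, l4, l5⟩ := k2 a ha u hu v hv hau hav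
      refine ⟨j, p.dec (s.a 1) (j / p.E), p.dec (s.a 2) (j % p.E), List.mem_append_right _ l2, ?_, l4, l5⟩
      rw [hrects, rects_tabEntries]
      simp [l1, l3]
  · rw [hrects, hlen]
  · intro i hi
    have : s2.a 5 = s1.a 5 := hB2.frame.a (by decide)
    rw [HS.setv_a, this]
    simp only [HS.setv_v, if_true] at hi
    exact hz1 i hi

end

/-! ### Covering and areas of the two parts of a split -/

section
variable {p : Prm} {Ls : ℕ → List ℕ}

theorem rects_splitEntries (p : Prm) (Ls : ℕ → List ℕ) (a J : ℕ) :
    rects (p.splitEntries Ls a J) = [(p.nbr a (Ls 1), p.nbr a (Ls 2))] := by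
  have h : rects ((List.range p.n).map fun v => .use v J) = [] := rects_uses (by simp)
  simp only [Prm.splitEntries, rects, List.filterMap_cons] at h ⊢
  rw [h]

theorem written_split {s : HS} (h : Node p Ls s) {s' : HS} {a : ℕ} (h18 : s'.v 18 = s.v 18 + 1)
    (ho : s'.out = s.out ++ (p.splitEntries Ls a (s.v 18)).flatMap Entry.encode) (hA : Ans p s')
    (hc : s'.v 0 = 0 → s.v 0 = 0 ∧ ∀ u ∈ p.nbr a (Ls 1), ∀ v ∈ p.nbr a (Ls 2), p.adj u v = false) :
    Written p s s' (p.splitEntries Ls a (s.v 18)) (5000 * ((p.n + 1) * (p.n + 1)))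
      (∀ b < p.n, ∀ u ∈ p.nbr a (Ls 1), ∀ v ∈ p.nbr a (Ls 2),
        Covers (s.v 18) (p.splitEntries Ls a (s.v 18)) b u v) := by
  have hl : ∀ q, q = 1 ∨ q = 2 → (p.nbr a (Ls q)).length ≤ p.n := fun q hq =>
    (List.length_filter_le _ _).trans (h.le hq)
  have hlt : ∀ q, q = 1 ∨ q = 2 → ∀ u ∈ p.nbr a (Ls q), u < p.n := fun q hq u hu =>
    h.lt hq u (List.mem_filter.1 hu).1
  refine ⟨ho, by rw [h18, rects_splitEntries]; rfl, ?_, ?_, hA, fun h0 => ⟨(hc h0).1, ?_, ?_⟩⟩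
  · intro e he
    simp only [Prm.splitEntries, List.mem_cons, List.mem_map, List.mem_range] at he
    rcases he with rfl | ⟨v, hv, rfl⟩
    · exact ⟨hlt 1 (by simp), hlt 2 (by simp)⟩
    · exact hv
  · have h1 := Nat.mul_le_mul (hl 1 (by simp)) (hl 2 (by simp))
    have h2 := costs_uses (R := (List.range p.n).map fun v => .use v (s.v 18)) (by simp)
    simp only [costs, List.length_map, List.length_range] at h2
    simp only [costs, Prm.splitEntries, List.map_cons, List.sum_cons, Entry.cost, h2]
    have : (p.n + 1) * (p.n + 1) = p.n * p.n + 2 * p.n + 1 := by ring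
    omega
  · simpa [rects_splitEntries, Prm.clear_iff] using (hc h0).2
  · intro b hb u hu v hv
    exact ⟨0, _, _, by simp [Prm.splitEntries, hb], by rw [rects_splitEntries]; rfl, hu, hv⟩

/-- The product of the sizes of the two sides. -/
def area (n : ℕ) (X : ℕ → ℕ) : ℕ := (side n X 1).length * (side n X 2).length

theorem side_congr {n : ℕ} {X Y : ℕ → ℕ} (h : ∀ v < n, X v = Y v) (q : ℕ) :
    side n X q = side n Y q :=
  List.filter_congr fun v hv => by rw [h v (List.mem_range.1 hv)]

theorem area_congr {n : ℕ} {X Y : ℕ → ℕ} (h : ∀ v < n, X v = Y v) : area n X = area n Y := by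
  simp only [area, side_congr h]

theorem mem_side {n : ℕ} {X : ℕ → ℕ} {q v : ℕ} : v ∈ side n X q ↔ v < n ∧ X v = q := by
  simp [side]

/-- The areas of the two parts of a split. -/
def splitAreas (f sB sC dB dC : ℕ) : ℕ × ℕ :=
  if f = 0 then (dB * (sC - dC), (sB - dB) * sC) else ((sB - dB) * dC, sB * (sC - dC))

theorem length_side_filter (p : Prm) (X Y : ℕ → ℕ) (a q : ℕ)
    (h : ∀ v < p.n, Y v = q ↔ X v = q ∧ p.adj a v = true) :
    (side p.n Y q).length = p.deg a (side p.n X q) := by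
  rw [← p.length_nbr]
  simp only [side, Prm.nbr, List.filter_filter]
  congr 1
  refine List.filter_congr fun v hv => ?_
  have := h v (List.mem_range.1 hv)
  by_cases h1 : Y v = q <;> by_cases h2 : X v = q <;> by_cases h3 : p.adj a v = true <;> simp_all

theorem length_side_filter_not (p : Prm) (X Y : ℕ → ℕ) (a q : ℕ)
    (h : ∀ v < p.n, Y v = q ↔ X v = q ∧ p.adj a v = false) :
    (side p.n Y q).length = (side p.n X q).length - p.deg a (side p.n X q) := by
  have e := List.length_eq_length_filter_add (l := side p.n X q) (p.adj a)
  have e2 : (side p.n Y q).length = ((side p.n X q).filter fun v => !p.adj a v).length := by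
    simp only [side, List.filter_filter]
    congr 1
    refine List.filter_congr fun v hv => ?_
    have := h v (List.mem_range.1 hv)
    by_cases h1 : Y v = q <;> by_cases h2 : X v = q <;> by_cases h3 : p.adj a v = true <;> simp_all
  have e3 := p.length_nbr a (side p.n X q)
  simp only [Prm.nbr] at e3
  omega

theorem flag_le (p : Prm) (Ls : ℕ → List ℕ) (a : ℕ) : p.flag Ls a = 0 ∨ p.flag Ls a = 1 := by
  unfold Prm.flag
  split_ifs <;> simp

/-- Of the four sides of the two children, three are the neighbours or the non-neighbours of `a` in
a side of the parent, and the fourth is a side of the parent itself. For this last one, the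
auxiliary labelling equals `Y₂` pointwise but is written as a case distinction on `X`, so that the
filters can be compared directly. -/
theorem area_child {X Y₁ Y₂ : ℕ → ℕ} {a f : ℕ} (hf : f = 0 ∨ f = 1)
    (h₁ : ∀ v < p.n, Y₁ v = child₁ (X v) (if p.adj a v then 1 else 0) f)
    (h₂ : ∀ v < p.n, Y₂ v = child₂ (X v) (if p.adj a v then 1 else 0) f) :
    (area p.n Y₁, area p.n Y₂) = splitAreas f (side p.n X 1).length (side p.n X 2).length
      (p.deg a (side p.n X 1)) (p.deg a (side p.n X 2)) := by
  simp only [area, splitAreas]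
  rcases hf with rfl | rfl
  · rw [if_pos rfl, length_side_filter p X Y₁ a 1, length_side_filter_not p X Y₁ a 2,
      length_side_filter_not p X Y₂ a 1, side_congr (X := Y₂)
        (Y := fun v => if X v = 2 then 2 else if Y₂ v = 2 then 0 else Y₂ v) _ 2]
    rotate_left
    · intro v hv; simp only [h₂ v hv, child₂]; rcases h : p.adj a v <;> simp <;> grind
    · intro v hv; simp only [h₂ v hv, child₂]; rcases h : p.adj a v <;> simp; grind
    · intro v hv; simp only [h₁ v hv, child₁]; rcases h : p.adj a v <;> simp <;> grind
    · intro v hv; simp only [h₁ v hv, child₁]; rcases h : p.adj a v <;> simp <;> grind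
    congr 2
    congr 1
    simp only [side]
    refine List.filter_congr fun v hv => ?_
    by_cases h1 : X v = 2 <;> by_cases h2 : Y₂ v = 2 <;> simp [h1, h2]
  · rw [if_neg (by simp), length_side_filter_not p X Y₁ a 1, length_side_filter p X Y₁ a 2,
      length_side_filter_not p X Y₂ a 2, side_congr (X := Y₂)
        (Y := fun v => if X v = 1 then 1 else if Y₂ v = 1 then 0 else Y₂ v) _ 1]
    rotate_left
    · intro v hv; simp only [h₂ v hv, child₂]; rcases h : p.adj a v <;> simp <;> grind
    · intro v hv; simp only [h₂ v hv, child₂]; rcases h : p.adj a v <;> simp; grind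
    · intro v hv; simp only [h₁ v hv, child₁]; rcases h : p.adj a v <;> simp <;> grind
    · intro v hv; simp only [h₁ v hv, child₁]; rcases h : p.adj a v <;> simp <;> grind
    congr 2
    congr 1
    simp only [side]
    refine List.filter_congr fun v hv => ?_
    by_cases h1 : X v = 1 <;> by_cases h2 : Y₂ v = 1 <;> simp [h1, h2]

/-- The product of the two neighbourhoods and the two children cover the product of the sides. The
flag only decides in which direction the L-shaped remainder is cut. -/
theorem child_cover {x x' y y' f : ℕ} (hf : f = 0 ∨ f = 1) (hy : y = 0 ∨ y = 1) (hy' : y' = 0 ∨ y' = 1)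
    (hx : x = 1) (hx' : x' = 2) : (y = 1 ∧ y' = 1) ∨ (child₁ x y f = 1 ∧ child₁ x' y' f = 2) ∨
      (child₂ x y f = 1 ∧ child₂ x' y' f = 2) := by
  subst hx hx'
  rcases hf with rfl | rfl <;> rcases hy with rfl | rfl <;> rcases hy' with rfl | rfl <;> decide

theorem child₁_eq (x y f : ℕ) : child₁ x y f = 0 ∨ child₁ x y f = x := by
  unfold child₁; split_ifs <;> simp

theorem child₂_eq (x y f : ℕ) : child₂ x y f = 0 ∨ child₂ x y f = x := by
  unfold child₂; split_ifs <;> simp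

end

/-! ### The main loop: invariant and potentials -/

section
variable {p : Prm}

/-- The labels of the `i`-th subproblem. -/
def labels (p : Prm) (s : HS) (i : ℕ) : ℕ → ℕ := fun v => s.a 0 (i * p.n + v)

/-- The state of the search after `k` subproblems have been treated, with the record `R`. -/
structure Search (p : Prm) (N : ℕ → ℝ) (N₀ : ℕ) (lab : ℕ → ℕ) (R : List Entry) (s : HS) : Prop
    extends p.Holds s where
  ans : Ans p s
  labels : ∀ i < s.v 17, ∀ v < p.n, labels p s i v = 0 ∨ labels p s i v = lab v
  sides : 0 < p.n → ∀ i, s.a 1 i < p.n ∧ s.a 2 i < p.n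
  memo : ∀ i, s.v 18 ≤ i → s.a 5 i = 0
  out : s.out = R.flatMap Entry.encode
  count : s.v 18 = (rects R).length
  lt : ∀ e ∈ R, e.Lt p.n
  correct : s.v 0 = 0 → (∀ r ∈ rects R, p.clear r.1 r.2 = true) ∧
    ∀ a < p.n, ∀ u < p.n, ∀ v < p.n, lab u = 1 → lab v = 2 → p.adj a u = true → p.adj a v = true →
      Covers 0 R a u v ∨
        ∃ i, s.v 16 ≤ i ∧ i < s.v 17 ∧ HL.labels p s i u = 1 ∧ HL.labels p s i v = 2
  le : s.v 16 ≤ s.v 17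
  nodes : s.v 16 + ∑ i ∈ Finset.Ico (s.v 16) (s.v 17), N (area p.n (HL.labels p s i)) ≤ N₀
  rect_le : s.v 18 ≤ s.v 16 * (p.E * p.E + 1)

/-- `N` and `F` bound the number of subproblems and the cost, in terms of the area. -/
structure Potential (p : Prm) (N F : ℕ → ℝ) (N₀ : ℕ) : Prop where
  one_le : ∀ x, 1 ≤ N x
  split : ∀ Ls : ℕ → List ℕ, (∀ q, q = 1 ∨ q = 2 → (Ls q).length ≤ p.n) → ∀ a < p.n,
    p.n * p.n ≤ (Ls 1).length * (Ls 2).length * p.R →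
    p.th * p.th * ((Ls 1).length * (Ls 2).length) ≤
      p.deg a (Ls 1) * p.deg a (Ls 2) * (p.l * p.l) →
    ∀ x₁ x₂, (x₁, x₂) = splitAreas (p.flag Ls a) (Ls 1).length (Ls 2).length (p.deg a (Ls 1))
      (p.deg a (Ls 2)) → 1 + (N x₁ + N x₂) ≤ N ((Ls 1).length * (Ls 2).length) ∧
      10000 * ((p.n : ℝ) + 1) ^ 2 + (F x₁ + F x₂) ≤ F ((Ls 1).length * (Ls 2).length)
  leaf : ∀ Ls : ℕ → List ℕ, (∀ q, q = 1 ∨ q = 2 → (Ls q).length ≤ p.n) →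
    ((Ls 1).length * (Ls 2).length * p.R < p.n * p.n ∨
      ∀ a < p.n, p.deg a (Ls 1) * p.deg a (Ls 2) * (p.l * p.l) <
        p.th * p.th * ((Ls 1).length * (Ls 2).length)) →
    (p.leafCost Ls : ℝ) + 5000 * ((p.n : ℝ) + 1) ^ 2 ≤ F ((Ls 1).length * (Ls 2).length)
  size : (N₀ + 2) * (p.n + 1) ≤ p.B
  size' : (N₀ + 1) * (p.E * p.E + 1) ≤ p.B

variable {N F : ℕ → ℝ} {N₀ : ℕ} {lab : ℕ → ℕ} {R : List Entry}

theorem Covers.append_left {J : ℕ} {R : List Entry} {a u v : ℕ} (h : Covers J R a u v)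
    (R' : List Entry) : Covers J (R ++ R') a u v := by
  obtain ⟨j, S, T, h1, h2, h3, h4⟩ := h
  refine ⟨j, S, T, List.mem_append_left _ h1, ?_, h3, h4⟩
  rw [rects_append, List.getElem?_append_left (List.getElem?_eq_some_iff.1 h2).1, h2]

theorem Covers.append_right {R R' : List Entry} {a u v : ℕ} (h : Covers (rects R).length R' a u v) :
    Covers 0 (R ++ R') a u v := by
  obtain ⟨j, S, T, h1, h2, h3, h4⟩ := h
  refine ⟨(rects R).length + j, S, T, ?_, ?_, h3, h4⟩
  · rw [zero_add]; exact List.mem_append_right _ h1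
  · rw [rects_append, List.getElem?_append_right (by omega), Nat.add_sub_cancel_left, h2]

/-- One subproblem. -/
def mainBody : St := fillSide 1 ;; fillSide 2 ;; search ;; .ite (V 24) split leaf ;; .set 16 (V 16 + 1)

/-- The invariant bounds the treated subproblems plus the sum of `N` over the waiting ones. Since `N
≥ 1`, the number of subproblems ever created stays below `N₀`, which keeps all addresses in range.
-/
theorem Search.count_le (hP : Potential p N F N₀) {s : HS} (h : Search p N N₀ lab R s) :
    s.v 17 ≤ N₀ := by
  have h1 := h.nodes
  have h2 : ((s.v 17 - s.v 16 : ℕ) : ℝ) ≤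
      ∑ i ∈ Finset.Ico (s.v 16) (s.v 17), N (area p.n (HL.labels p s i)) := by
    have := Finset.card_nsmul_le_sum (Finset.Ico (s.v 16) (s.v 17))
      (fun i => N (area p.n (HL.labels p s i))) 1 (fun i _ => hP.one_le _)
    simpa using this
  rw [Nat.cast_sub h.le] at h2
  have : (s.v 17 : ℝ) ≤ N₀ := by linarith
  exact_mod_cast this

-- Time and record cost are both charged to the decrease of the sum of `F` over the waiting
-- subproblems: a leaf gives up its own `F`, and a split exchanges it for the `F` of the two
-- children. The extra `10` pays for the test of the main loop.
set_option maxHeartbeats 1000000 in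
theorem exec_mainBody (hp : p.Good) (hP : Potential p N F N₀) (hlab : ∀ v < p.n, lab v ≤ 2) {s : HS}
    (h : Search p N N₀ lab R s) (hk : s.v 16 < s.v 17) :
    ∃ t s' R', Exec p mainBody s t s' ∧ Search p N N₀ lab (R ++ R') s' ∧ s'.v 16 = s.v 16 + 1 ∧
      ((t : ℝ) + 10 + ∑ i ∈ Finset.Ico (s'.v 16) (s'.v 17), F (area p.n (labels p s' i)) ≤
        ∑ i ∈ Finset.Ico (s.v 16) (s.v 17), F (area p.n (labels p s i))) ∧
      ((costs R' : ℝ) + ∑ i ∈ Finset.Ico (s'.v 16) (s'.v 17), F (area p.n (labels p s' i)) ≤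
        ∑ i ∈ Finset.Ico (s.v 16) (s.v 17), F (area p.n (labels p s i))) := by
  have hW := hp.hW1
  have hB0 := hp.B0
  have hcN := h.count_le hP
  have hsz := hP.size
  have hsz' := hP.size'
  have hkn : (s.v 16 + 1) * p.n ≤ (N₀ + 2) * (p.n + 1) := Nat.mul_le_mul (by omega) (by omega)
  have hkn' : s.v 16 * p.n + p.n ≤ p.B := by rw [Nat.succ_mul] at hkn; omega
  have hJB : s.v 18 + p.E * p.E + 1 ≤ p.B := by
    have h1 := h.rect_le
    have h2 : (s.v 16 + 1) * (p.E * p.E + 1) ≤ (N₀ + 1) * (p.E * p.E + 1) :=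
      Nat.mul_le_mul_right _ (by omega)
    rw [Nat.succ_mul] at h2
    omega
  set X := labels p s (s.v 16) with hX
  set Ls := side p.n X with hLs
  obtain ⟨t1, s1, hB1, ht1, hl1, hs1, hm1⟩ := exec_fillSide hp h.toHolds (q := 1) (by simp) hkn'
  have hH1 := h.toHolds.frame hB1.frame (by decide)
  have e16 : s1.v 16 = s.v 16 := hB1.frame.v (by decide)
  have e0 : s1.a 0 = s.a 0 := hB1.frame.a (by decide)
  obtain ⟨t2, s2, hB2, ht2, hl2, hs2, hm2⟩ := exec_fillSide hp hH1 (q := 2) (by simp) (by rwa [e16])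
  rw [e16, e0] at hl2 hs2
  norm_num at hl1 hl2
  have hH2 := hH1.frame hB2.frame (by decide)
  have hN2 : Node p Ls s2 := by
    refine ⟨hH2, ?_, ?_, ?_, fun _ => length_side_le _ _ _⟩
    · rintro q (rfl | rfl)
      · rw [hB2.frame.v (by decide)]; exact hl1
      · exact hl2
    · rintro q (rfl | rfl)
      · rw [hB2.frame.a (by decide)]; exact hs1
      · exact hs2
    · intro q hq v hv
      exact (mem_side.1 hv).1
  obtain ⟨t3, s3, hB3, ht3, hN3, hcase⟩ := exec_search hp hN2
  have hB123 := hB1.seq (hB2.seq hB3)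
  have hF := hB123.frame
  have hA3 := h.ans.frame hF (by decide)
  have f0 : s3.v 0 = s.v 0 := hF.v (by decide)
  have f16 : s3.v 16 = s.v 16 := hF.v (by decide)
  have f17 : s3.v 17 = s.v 17 := hF.v (by decide)
  have f18 : s3.v 18 = s.v 18 := hF.v (by decide)
  have fa0 : s3.a 0 = s.a 0 := hF.a (by decide)
  have fa5 : s3.a 5 = s.a 5 := hF.a (by decide)
  have fo : s3.out = s.out := hF.out rfl
  have hlen : ∀ q, q = 1 ∨ q = 2 → (Ls q).length ≤ p.n := fun q _ => length_side_le _ _ _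
  have hf : 0 < p.n → ∀ i, s3.a 1 i < p.n ∧ s3.a 2 i < p.n := by
    intro hn i
    have a1 : s3.a 1 = s1.a 1 := by rw [hB3.frame.a (by decide), hB2.frame.a (by decide)]
    have a2 : s3.a 2 = s2.a 2 := by rw [hB3.frame.a (by decide)]
    have a3 : s1.a 2 = s.a 2 := hB1.frame.a (by decide)
    rw [a1, a2]
    constructor
    · rcases hm1 i with h1 | h1
      · rw [h1]; exact (h.sides hn i).1
      · exact h1
    · rcases hm2 i with h1 | h1
      · rw [h1, a3]; exact (h.sides hn i).2
      · exact h1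
  have hsumN : ∀ G : ℕ → ℝ, ∑ i ∈ Finset.Ico (s.v 16) (s.v 17), G (area p.n (labels p s i)) =
      G ((Ls 1).length * (Ls 2).length) +
        ∑ i ∈ Finset.Ico (s.v 16 + 1) (s.v 17), G (area p.n (labels p s i)) := fun G => by
    rw [Finset.sum_eq_sum_Ico_succ_bot hk]; rfl
  have hnodes := h.nodes
  rw [hsumN] at hnodes ⊢
  have hsq : 1 ≤ (p.n + 1) * (p.n + 1) := Nat.mul_pos (by omega) (by omega)
  have hsq' : p.n + 1 ≤ (p.n + 1) * (p.n + 1) := Nat.le_mul_of_pos_left _ (Nat.succ_pos _)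
  have hsqR : (((p.n + 1) * (p.n + 1) : ℕ) : ℝ) = ((p.n : ℝ) + 1) ^ 2 := by push_cast; ring
  rcases hcase with ⟨h24, hleaf⟩ | ⟨a, ha, h24, hbig, hdense⟩
  · obtain ⟨t4, s4, R', hB4, ht4, hW4, hR4, hz4⟩ := exec_leaf hp hN3 hA3 hf (by omega)
      (by rw [f18, fa5]; exact h.memo)
    have k16 : s4.v 16 = s.v 16 := by rw [hB4.frame.v (by decide), f16]
    have k17 : s4.v 17 = s.v 17 := by rw [hB4.frame.v (by decide), f17]
    have ka0 : s4.a 0 = s.a 0 := by rw [hB4.frame.a (by decide), fa0]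
    have hN2 : N₀ + 2 ≤ (N₀ + 2) * (p.n + 1) := Nat.le_mul_of_pos_right _ (by omega)
    have hset : Exec p (.set 16 (V 16 + 1)) s4 7 _ := Big.set (by simp [k16]; omega)
    simp only [Ex.val_add, Ex.val_var, Ex.val_lit1, k16] at hset
    have hite : Exec p (.ite (V 24) split leaf) s3 _ s4 :=
      Big.ite_neg (by simp) (by simpa using h24) hB4
    have hlab' : ∀ i, labels p (s4.setv 16 (s.v 16 + 1)) i = labels p s i := by
      intro i; funext v; simp [labels, ka0]
    have hpot := hP.leaf Ls hlen hleaf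
    refine ⟨_, _, R', hB1.seq (hB2.seq (hB3.seq (hite.seq hset))), ?_, by simp, ?_, ?_⟩
    · refine ⟨((hN3.toHolds.frame hB4.frame (by decide)).frame hset.frame (by decide)),
        hW4.ans.setv (by norm_num), ?_, ?_, ?_, ?_, ?_, ?_, ?_, ?_, ?_, ?_⟩
      · intro i hi v hv
        rw [hlab']
        exact h.labels i (by simpa [k17] using hi) v hv
      · intro hn i
        have a1 : s4.a 1 = s3.a 1 := hB4.frame.a (by decide)
        have a2 : s4.a 2 = s3.a 2 := hB4.frame.a (by decide)
        rw [HS.setv_a, a1, a2]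
        exact hf hn i
      · intro i hi
        exact hz4 i (by simpa using hi)
      · simp only [HS.setv_out, hW4.out, fo, h.out, List.flatMap_append]
      · simp [hW4.count, f18, h.count, rects_append]
      · intro e he
        rcases List.mem_append.1 he with he | he
        exacts [h.lt e he, hW4.lt e he]
      · intro h0
        obtain ⟨c1, c2, c3⟩ := hW4.correct (by simpa using h0)
        obtain ⟨d1, d2⟩ := h.correct (by rw [← f0, c1])
        refine ⟨?_, ?_⟩
        · intro r hr
          rw [rects_append] at hr
          rcases List.mem_append.1 hr with hr | hr
          exacts [d1 r hr, c2 r hr]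
        · intro b hb u hu v hv hlu hlv hbu hbv
          rcases d2 b hb u hu v hv hlu hlv hbu hbv with hc | ⟨i, hi1, hi2, hi3, hi4⟩
          · exact Or.inl (hc.append_left _)
          · rcases Nat.eq_or_lt_of_le hi1 with rfl | hi1
            · left
              refine Covers.append_right ?_
              rw [← h.count, ← f18]
              exact c3 b hb u (mem_side.2 ⟨hu, hi3⟩) v (mem_side.2 ⟨hv, hi4⟩) hbu hbv
            · refine Or.inr ⟨i, by simpa using hi1, by simpa [k17] using hi2, ?_, ?_⟩ <;>
              simpa only [hlab']
      · simpa [k17] using hk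
      · simp only [hlab', HS.setv_v, if_true, k17]
        norm_num [k17] 
        have := hP.one_le ((Ls 1).length * (Ls 2).length)
        linarith
      · have := h.rect_le
        simp only [HS.setv_v, if_true, if_false, show (18 = 16) = False by simp, hW4.count, hR4, f18,
          Nat.succ_mul]
        omega
    · simp only [hlab', HS.setv_v, if_true, k17]
      norm_num [k17]
      have e1 : (V 24).cost = 1 := rfl
      have ht : t1 + (t2 + (t3 + ((V 24).cost + t4 + 2 + 7 + 1) + 1) + 1) + 1 + 10 ≤
        p.leafCost Ls + 5000 * ((p.n + 1) * (p.n + 1)) := by omega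
      have ht' : (((t1 + (t2 + (t3 + ((V 24).cost + t4 + 2 + 7 + 1) + 1) + 1) + 1 + 10 : ℕ)) : ℝ) ≤
        p.leafCost Ls + 5000 * ((p.n : ℝ) + 1) ^ 2 := by
        rw [← hsqR]; exact_mod_cast ht
      push_cast at ht'
      linarith
    · simp only [hlab', HS.setv_v, if_true, k17]
      norm_num [k17]
      have : (costs R' : ℝ) ≤ p.leafCost Ls := by exact_mod_cast hW4.cost
      have : 0 ≤ ((p.n : ℝ) + 1) ^ 2 := by positivity
      linarith
  · have hXle : ∀ v < p.n, s3.a 0 (s3.v 16 * p.n + v) ≤ 2 := by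
      intro v hv
      rw [f16, fa0]
      have := h.labels _ hk v hv
      have := hlab v hv
      simp only [labels] at *
      omega
    have hcn : (s3.v 17 + 2) * p.n ≤ p.B :=
      (Nat.mul_le_mul (by omega) (by omega)).trans hsz
    have hN2 : N₀ + 2 ≤ (N₀ + 2) * (p.n + 1) := Nat.le_mul_of_pos_right _ (by omega)
    obtain ⟨t4, s4, hB4, ht4, h17, h18, hc1, hc2, hc3, ho4, hA4, hk4⟩ := exec_split hp hN3 hA3 ha h24
      (by omega) hcn (by omega) (by omega) hXle
    have hW4 := written_split hN3 h18 ho4 hA4 hk4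
    set R' := p.splitEntries Ls a (s3.v 18) with hR'
    have k16 : s4.v 16 = s.v 16 := by rw [hB4.frame.v (by decide), f16]
    have k17 : s4.v 17 = s.v 17 + 2 := by rw [h17, f17]
    rw [f17, fa0] at hc1
    rw [f16, f17, fa0] at hc2 hc3
    have hset : Exec p (.set 16 (V 16 + 1)) s4 7 _ := Big.set (by simp [k16]; omega)
    simp only [Ex.val_add, Ex.val_var, Ex.val_lit1, k16] at hset
    have hite : Exec p (.ite (V 24) split leaf) s3 _ s4 :=
      Big.ite_pos (by simp) (by simp [h24]) hB4
    have hold : ∀ i < s.v 17, ∀ v < p.n, labels p (s4.setv 16 (s.v 16 + 1)) i v = labels p s i v := by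
      intro i hi v hv
      have : (i + 1) * p.n ≤ s.v 17 * p.n := Nat.mul_le_mul_right _ hi
      rw [Nat.succ_mul] at this
      exact hc1 _ (by omega)
    have hnew1 : ∀ v < p.n, labels p (s4.setv 16 (s.v 16 + 1)) (s.v 17) v =
      child₁ (X v) (if p.adj a v then 1 else 0) (p.flag Ls a) := hc2
    have hnew2 : ∀ v < p.n, labels p (s4.setv 16 (s.v 16 + 1)) (s.v 17 + 1) v =
      child₂ (X v) (if p.adj a v then 1 else 0) (p.flag Ls a) := hc3
    have hpot := hP.split Ls hlen a ha hbig hdense _ _ (area_child (flag_le p Ls a) hnew1 hnew2)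
    have hsumN' : ∀ G : ℕ → ℝ, ∑ i ∈ Finset.Ico (s.v 16 + 1) (s.v 17 + 2),
        G (area p.n (labels p (s4.setv 16 (s.v 16 + 1)) i)) =
        ∑ i ∈ Finset.Ico (s.v 16 + 1) (s.v 17), G (area p.n (labels p s i)) +
          (G (area p.n (labels p (s4.setv 16 (s.v 16 + 1)) (s.v 17))) +
          G (area p.n (labels p (s4.setv 16 (s.v 16 + 1)) (s.v 17 + 1)))) := fun G => by
      rw [Finset.sum_Ico_succ_top (by omega), Finset.sum_Ico_succ_top (by omega), add_assoc]
      congr 1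
      refine Finset.sum_congr rfl fun i hi => ?_
      rw [area_congr (hold i (Finset.mem_Ico.1 hi).2)]
    refine ⟨_, _, R', hB1.seq (hB2.seq (hB3.seq (hite.seq hset))), ?_, by simp, ?_, ?_⟩
    · refine ⟨((hN3.toHolds.frame hB4.frame (by decide)).frame hset.frame (by decide)),
        hW4.ans.setv (by norm_num), ?_, ?_, ?_, ?_, ?_, ?_, ?_, ?_, ?_, ?_⟩
      · intro i hi v hv
        have hi' : i < s.v 17 + 2 := by simpa [k17] using hi
        rcases Nat.lt_succ_iff_lt_or_eq.1 hi' with hi' | rfl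
        · rcases Nat.lt_succ_iff_lt_or_eq.1 hi' with hi' | rfl
          · rw [hold i hi' v hv]
            exact h.labels i hi' v hv
          · rw [hnew1 v hv]
            have h1 := h.labels _ hk v hv
            rcases child₁_eq (X v) (if p.adj a v then 1 else 0) (p.flag Ls a) with h2 | h2
            · exact Or.inl h2
            · rw [h2]; exact h1
        · rw [hnew2 v hv]
          have h1 := h.labels _ hk v hv
          rcases child₂_eq (X v) (if p.adj a v then 1 else 0) (p.flag Ls a) with h2 | h2
          · exact Or.inl h2
          · rw [h2]; exact h1
      · intro hn i
        have a1 : s4.a 1 = s3.a 1 := hB4.frame.a (by decide)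
        have a2 : s4.a 2 = s3.a 2 := hB4.frame.a (by decide)
        rw [HS.setv_a, a1, a2]
        exact hf hn i
      · intro i hi
        have a5 : s4.a 5 = s.a 5 := by rw [hB4.frame.a (by decide), fa5]
        simp only [HS.setv_v, HS.setv_a, if_false, show (18 = 16) = False by simp, h18, f18] at hi ⊢
        rw [a5]
        exact h.memo i (by omega)
      · simp only [HS.setv_out, hW4.out, fo, h.out, List.flatMap_append]
      · simp [hW4.count, f18, h.count, rects_append]
      · intro e he
        rcases List.mem_append.1 he with he | he
        exacts [h.lt e he, hW4.lt e he]
      · intro h0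
        obtain ⟨c1, c2, c3⟩ := hW4.correct (by simpa using h0)
        obtain ⟨d1, d2⟩ := h.correct (by rw [← f0, c1])
        refine ⟨?_, ?_⟩
        · intro r hr
          rw [rects_append] at hr
          rcases List.mem_append.1 hr with hr | hr
          exacts [d1 r hr, c2 r hr]
        · intro b hb u hu v hv hlu hlv hbu hbv
          rcases d2 b hb u hu v hv hlu hlv hbu hbv with hc | ⟨i, hi1, hi2, hi3, hi4⟩
          · exact Or.inl (hc.append_left _)
          · rcases Nat.eq_or_lt_of_le hi1 with rfl | hi1
            -- A pair that leaves the treated subproblem is either in the new rectangle, which is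
            -- used for all vertices, or in one of the two children at the end of the queue.
            · rcases child_cover (flag_le p Ls a) (y := if p.adj a u then 1 else 0)
                (y' := if p.adj a v then 1 else 0) (by split_ifs <;> simp) (by split_ifs <;> simp)
                hi3 hi4 with ⟨g1, g2⟩ | ⟨g1, g2⟩ | ⟨g1, g2⟩
              · left
                refine Covers.append_right ?_
                rw [← h.count, ← f18]
                refine c3 b hb u (List.mem_filter.2 ⟨mem_side.2 ⟨hu, hi3⟩, ?_⟩) v
                  (List.mem_filter.2 ⟨mem_side.2 ⟨hv, hi4⟩, ?_⟩)
                · by_contra hcon; simp [hcon] at g1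
                · by_contra hcon; simp [hcon] at g2
              · exact Or.inr ⟨s.v 17, by simpa using hk, by simp [k17], (hnew1 u hu).trans g1,
                  (hnew1 v hv).trans g2⟩
              · exact Or.inr ⟨s.v 17 + 1, by simp; omega, by simp [k17], (hnew2 u hu).trans g1,
                  (hnew2 v hv).trans g2⟩
            · refine Or.inr ⟨i, by simpa using hi1, by simp [k17]; omega, ?_, ?_⟩
              · rw [hold i hi2 u hu, hi3]
              · rw [hold i hi2 v hv, hi4]
      · simp [k17]; omega
      · have e16 : (s4.setv 16 (s.v 16 + 1)).v 16 = s.v 16 + 1 := by simp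
        have e17 : (s4.setv 16 (s.v 16 + 1)).v 17 = s.v 17 + 2 := by simp [k17]
        rw [e16, e17, hsumN']
        push_cast
        linarith
      · have := h.rect_le
        simp only [HS.setv_v, if_true, if_false, show (18 = 16) = False by simp, h18, f18,
          Nat.succ_mul]
        omega
    · have e16 : (s4.setv 16 (s.v 16 + 1)).v 16 = s.v 16 + 1 := by simp
      have e17 : (s4.setv 16 (s.v 16 + 1)).v 17 = s.v 17 + 2 := by simp [k17]
      rw [e16, e17, hsumN']
      have e1 : (V 24).cost = 1 := rfl
      have ht : t1 + (t2 + (t3 + ((V 24).cost + t4 + 2 + 7 + 1) + 1) + 1) + 1 + 10 ≤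
        10000 * ((p.n + 1) * (p.n + 1)) := by omega
      have ht' : (((t1 + (t2 + (t3 + ((V 24).cost + t4 + 2 + 7 + 1) + 1) + 1) + 1 + 10 : ℕ)) : ℝ) ≤
        10000 * ((p.n : ℝ) + 1) ^ 2 := by
        rw [← hsqR]; exact_mod_cast ht
      push_cast at ht' ⊢
      linarith
    · have e16 : (s4.setv 16 (s.v 16 + 1)).v 16 = s.v 16 + 1 := by simp
      have e17 : (s4.setv 16 (s.v 16 + 1)).v 17 = s.v 17 + 2 := by simp [k17]
      rw [e16, e17, hsumN']
      have h1 : (costs R' : ℝ) ≤ 5000 * ((p.n : ℝ) + 1) ^ 2 := by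
        rw [← hsqR]; exact_mod_cast hW4.cost
      have : 0 ≤ ((p.n : ℝ) + 1) ^ 2 := by positivity
      linarith

theorem exec_mainLoop (hp : p.Good) (hP : Potential p N F N₀) (hlab : ∀ v < p.n, lab v ≤ 2) {s : HS}
    (h : Search p N N₀ lab R s) :
    ∃ t s' R', Exec p mainLoop s t s' ∧ Search p N N₀ lab R' s' ∧ s'.v 17 ≤ s'.v 16 ∧
      (t : ℝ) ≤ ∑ i ∈ Finset.Ico (s.v 16) (s.v 17), F (area p.n (labels p s i)) + 10 ∧
      (costs R' : ℝ) ≤ costs R + ∑ i ∈ Finset.Ico (s.v 16) (s.v 17), F (area p.n (labels p s i)) := by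
  -- Termination: each round raises register `16`, and while the test succeeds it is below register
  -- `17`, hence below `N₀`.
  obtain ⟨d, hd⟩ : ∃ d, d = N₀ - s.v 16 := ⟨_, rfl⟩
  have hW1 := hp.W1
  have hcost : (Ex.lt (V 16) (V 17)).cost ≤ 5 := by decide
  induction d using Nat.strong_induction_on generalizing s R with
  | _ d ih =>
  have hc := h.count_le hP
  by_cases hk : s.v 16 < s.v 17
  · obtain ⟨t, s', R', hB, hS, h16, ht, hco⟩ := exec_mainBody hp hP hlab h hk
    obtain ⟨t2, s2, R2, hB2, hS2, hle, ht2, hco2⟩ := ih (N₀ - s'.v 16) (by omega) hS rfl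
    refine ⟨_, s2, R2, Big.loop_pos (by simp) (by simp [hk]) hB hB2, hS2, hle, ?_, ?_⟩
    · have : ((Ex.lt (V 16) (V 17)).cost : ℝ) ≤ 5 := by exact_mod_cast hcost
      push_cast
      linarith
    · rw [costs_append] at hco2
      push_cast at hco2
      linarith
  · refine ⟨_, s, R, Big.loop_neg (by simp) (by simp [hk]), h, by omega, ?_, ?_⟩
    · have : ((Ex.lt (V 16) (V 17)).cost : ℝ) ≤ 5 := by exact_mod_cast hcost
      rw [Finset.Ico_eq_empty (by omega)]
      push_cast
      simp
      linarith
    · rw [Finset.Ico_eq_empty (by omega)]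
      simp

end

/-! ### Concrete parameters and their computation -/

/-- Bit length of the number of vertices. -/
def lenN (n : ℕ) : ℕ := Nat.log 2 n + 1
/-- Bit length of the bit length. -/
def llenN (n : ℕ) : ℕ := Nat.log 2 (lenN n) + 1
/-- Group size. -/
def grpN (n : ℕ) : ℕ := lenN n / (32 * llenN n) + 1

/-- The parameters for `n` vertices. -/
def prmN (W n : ℕ) (I : ℕ → ℕ) (adj : ℕ → ℕ → Bool) : Prm where
  W := W
  n := n
  l := lenN n
  g := grpN n
  L := 2 ^ (3 * llenN n)
  M := 2 ^ ((3 * llenN n + 1) * grpN n)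
  R := 2 ^ (lenN n / 4)
  th := 256 * (llenN n * llenN n)
  B := 2 ^ (20 * lenN n)
  I := I
  adj := adj

theorem lenN_pos (n : ℕ) : 1 ≤ lenN n := Nat.le_add_left _ _
theorem llenN_pos (n : ℕ) : 1 ≤ llenN n := Nat.le_add_left _ _

theorem lt_two_pow_lenN (n : ℕ) : n < 2 ^ lenN n := Nat.lt_pow_succ_log_self (by norm_num) n

theorem lenN_lt_two_pow (n : ℕ) : lenN n < 2 ^ llenN n := Nat.lt_pow_succ_log_self (by norm_num) _

theorem two_pow_llenN_le (n : ℕ) : 2 ^ llenN n ≤ 2 * lenN n := by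
  rw [llenN, pow_succ, mul_comm]
  exact Nat.mul_le_mul_left _ (Nat.pow_log_le_self 2 (by have := lenN_pos n; omega))

theorem llenN_le (n : ℕ) : llenN n ≤ lenN n :=
  Nat.log_lt_self 2 (by have := lenN_pos n; omega)

/-- This makes `M` at most about `n ^ (1/8)` up to a power of `l`: one has `3m + 1 ≤ 4m` and `g - 1
≤ l / (32 m)`. The second summand on the right comes from the `+ 1` in the group size. -/
theorem exponent_le (n : ℕ) :
    8 * ((3 * llenN n + 1) * grpN n) ≤ lenN n + 8 * (3 * llenN n + 1) := by
  have h1 := Nat.mul_div_le (lenN n) (32 * llenN n)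
  have h2 : (3 * llenN n + 1) * (lenN n / (32 * llenN n)) ≤
      4 * llenN n * (lenN n / (32 * llenN n)) :=
    Nat.mul_le_mul_right _ (by have := llenN_pos n; omega)
  have h3 : 32 * llenN n * (lenN n / (32 * llenN n)) =
    8 * (4 * llenN n * (lenN n / (32 * llenN n))) := by ring
  rw [grpN, Nat.mul_succ]
  omega

section
variable {W n : ℕ} {I : ℕ → ℕ} {adj : ℕ → ℕ → Bool}

theorem prmN_EE_le (W n : ℕ) (I : ℕ → ℕ) (adj : ℕ → ℕ → Bool) :
    (prmN W n I adj).E * (prmN W n I adj).E ≤ 2 ^ (12 * lenN n) := by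
  have h1 := exponent_le n
  have h2 := llenN_le n
  have h3 := lenN_pos n
  have h4 : (prmN W n I adj).E ≤ 2 ^ (6 * lenN n) := by
    calc (prmN W n I adj).E ≤ 2 ^ lenN n * 2 ^ (5 * lenN n) :=
          Nat.mul_le_mul (lt_two_pow_lenN n).le (Nat.pow_le_pow_right (by norm_num) (by omega))
      _ = 2 ^ (6 * lenN n) := by rw [← pow_add]; congr 1; ring
  calc _ ≤ 2 ^ (6 * lenN n) * 2 ^ (6 * lenN n) := Nat.mul_le_mul h4 h4
    _ = _ := by rw [← pow_add]; congr 1; ring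

theorem prmN_good (hW : 100 * (2 ^ (20 * lenN n) * 2 ^ (20 * lenN n) *
      (2 ^ (20 * lenN n) * 2 ^ (20 * lenN n))) ≤ W)
    (hI : ∀ a < n, ∀ u < n, I (1 + n + (a * n + u)) = if adj a u then 1 else 0) :
    (prmN W n I adj).Good := by
  have h2 := llenN_le n
  have h3 := lenN_pos n
  have h4 := llenN_pos n
  have h5 := lt_two_pow_lenN n
  have h1 := exponent_le n
  have h0 : ∀ {a b : ℕ}, a ≤ b → 2 ^ a ≤ 2 ^ b := fun h => Nat.pow_le_pow_right (by norm_num) h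
  have h6 : lenN n < 2 ^ lenN n := Nat.lt_two_pow_self
  have h7 : 2 ^ lenN n ≤ 2 ^ (20 * lenN n) := h0 (by omega)
  have h8 : grpN n ≤ lenN n + 1 := Nat.succ_le_succ (Nat.div_le_self _ _)
  refine ⟨hI, ?_, ?_, Nat.le_add_left _ _, ?_, ?_, ?_, ?_, ?_, ?_, ?_, ?_, hW⟩
  · exact (pow_one 2).symm.le.trans (h0 (show 1 ≤ 3 * llenN n by omega))
  · simp only [prmN, Prm.K, ← pow_succ, ← pow_mul]
  · calc (prmN W n I adj).S ≤ 2 ^ lenN n * 2 ^ lenN n := by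
          have := Nat.mul_le_mul (Nat.succ_le_of_lt h5) (Nat.succ_le_of_lt h5)
          have e : (n + 1) * (n + 1) = n * n + 2 * n + 1 := by ring
          simp only [prmN, Prm.S]
          simp only [Nat.succ_eq_add_one] at this
          omega
      _ = 2 ^ (2 * lenN n) := by rw [← pow_add]; congr 1; ring
      _ ≤ _ := h0 (by omega)
  · simp only [prmN]; omega
  · simp only [prmN]; omega
  · simp only [prmN, Prm.K, ← pow_succ]
    exact h0 (by omega)
  · exact h0 (by omega)
  · exact (prmN_EE_le W n I adj).trans (h0 (by omega))
  · exact h0 (by omega)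
  · have h9 : llenN n ≤ 2 ^ lenN n := by omega
    calc (prmN W n I adj).th ≤ 2 ^ 8 * (2 ^ lenN n * 2 ^ lenN n) :=
          Nat.mul_le_mul (by norm_num) (Nat.mul_le_mul h9 h9)
      _ = 2 ^ (8 + 2 * lenN n) := by rw [← pow_add, ← pow_add]; congr 1; ring
      _ ≤ _ := h0 (by omega)

/-- The bit length in the form computed by the program, with a counter that starts at `1` while `n /
2` is halved until nothing is left. For `n = 0` both sides are `1`. -/
theorem log_half (n : ℕ) :
    1 + (if n / 2 = 0 then 0 else Nat.log 2 (n / 2) + 1) = Nat.log 2 n + 1 := by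
  rw [Nat.log_div_base]
  split_ifs with h
  · rw [Nat.log_of_lt (by omega)]
  · have : 0 < Nat.log 2 n := Nat.log_pos (by norm_num) (by omega)
    omega

theorem exec_bits {S r : ℕ} (hr : r ≠ 25) (hW : 2 < W) (s : HS) (h : s.v r + s.v 25 < W) :
    ∃ t s', Big W S I (.loop (V 25) (.set 25 (V 25 / 2) ;; .set r (V r + 1))) s t s' ∧
      t ≤ 30 * (s.v 25 + 1) ∧
      s'.v r = s.v r + if s.v 25 = 0 then 0 else Nat.log 2 (s.v 25) + 1 := by
  obtain ⟨x, hx⟩ : ∃ x, x = s.v 25 := ⟨_, rfl⟩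
  induction x using Nat.strong_induction_on generalizing s with
  | _ x ih =>
  have e0 : (V 25).cost = 1 := rfl
  by_cases h0 : s.v 25 = 0
  · exact ⟨_, s, Big.loop_neg (by simp) (by simpa using h0), by omega, by simp [h0]⟩
  · have h1 : Big W S I (.set 25 (V 25 / 2)) s 7 _ := Big.set (by simp; omega)
    have h2 : Big W S I (.set r (V r + 1)) (s.setv 25 (s.v 25 / 2)) 7 _ := Big.set (by
      simp [hr]; omega)
    simp only [Ex.val_add, Ex.val_var, Ex.val_lit1, Ex.val_div, Ex.val_lit2, HS.setv_v, if_neg hr]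
      at h1 h2
    obtain ⟨t, s', hB, ht, hv⟩ := ih (s.v 25 / 2) (by omega)
      ((s.setv 25 (s.v 25 / 2)).setv r (s.v r + 1)) (by simp [hr.symm]; omega) (by simp [hr.symm])
    refine ⟨_, s', Big.loop_pos (by simp) (by simpa using h0) (h1.seq h2) hB, ?_, ?_⟩
    · simp [hr.symm] at ht
      omega
    · simp only [HS.setv_v, if_true, hr.symm, if_false] at hv
      have := log_half (s.v 25)
      rw [hv, if_neg h0]
      omega

end

section
variable {W n : ℕ} {I : ℕ → ℕ} {adj : ℕ → ℕ → Bool}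

theorem lenN_le (n : ℕ) : lenN n ≤ n + 1 := Nat.succ_le_succ (Nat.log_le_self 2 n)

set_option maxHeartbeats 1000000 in
theorem exec_params (hp : (prmN W n I adj).Good) {s : HS} (h5 : s.v 5 = n) (h6 : s.v 6 = lenN n)
    (h7 : s.v 7 = llenN n) :
    ∃ t s', Exec (prmN W n I adj) params s t s' ∧ t ≤ 200 ∧ (prmN W n I adj).Holds s' := by
  have hW := hp.hW1
  have hW2 := hp.hW2
  have hB0 := hp.B0
  have hnB := hp.nB
  have hEB := hp.EEB
  have hgB := hp.gB
  have hKB := hp.KB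
  have hMB := hp.MB
  have hRB := hp.RB
  have htB := hp.thB
  have hlB := hp.lB
  have hEE := hp.EB
  have hB20 : 2 ^ 20 ≤ 2 ^ (20 * lenN n) :=
    Nat.pow_le_pow_right (by norm_num) (by have := lenN_pos n; omega)
  have h2 := llenN_le n
  have h4 := llenN_pos n
  have he := exponent_le n
  simp only [prmN, Prm.K, Prm.E, grpN] at *
  have hnM := Nat.mul_le_mul hnB hMB
  set Bv := 2 ^ (20 * lenN n) with hBv
  have hBB : Bv ≤ Bv * Bv := Nat.le_mul_of_pos_right _ hB0
  obtain ⟨t, hB, ht⟩ := St.big_run (W := W) (S := (prmN W n I adj).S) (I := I) (s := s) params (by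
    simp only [St.ok, St.run, Ex.ok_add, Ex.ok_mul, Ex.ok_div, Ex.ok_shl, Ex.ok_var, Ex.ok_lit1,
      Ex.ok_lit2, Ex.ok_lit3, Ex.ok_lit4, Ex.ok_lit32, Ex.ok_lit256, Ex.val_add, Ex.val_mul,
      Ex.val_div, Ex.val_shl, Ex.val_var, Ex.val_lit1, Ex.val_lit2, Ex.val_lit3, Ex.val_lit4,
      Ex.val_lit32, Ex.val_lit256, HS.setv_v, params, h5, h6, h7, one_mul, true_and]
    norm_num [h5, h6, h7]
    and_intros <;> omega)
  refine ⟨t, _, hB, ht.trans (by decide), ?_⟩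
  constructor <;> simp [params, St.run, h5, h6, h7, Prm.K, Prm.E]

set_option maxHeartbeats 1000000 in
theorem exec_setup (hp : (prmN W n I adj).Good) {s : HS} (h5 : s.v 5 = n) :
    ∃ t s', Exec (prmN W n I adj) setup s t s' ∧ t ≤ 500 * (n + 1) ∧ (prmN W n I adj).Holds s' ∧
      s'.v 16 = 0 ∧ s'.v 17 = 1 ∧ ∀ v < n, s'.a 0 v = I (1 + v) := by
  have hW : 100 * (prmN W n I adj).B ≤ W := hp.hW1
  have hB0 := hp.B0
  have hnB : n ≤ (prmN W n I adj).B := hp.nB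
  have hlB : lenN n ≤ (prmN W n I adj).B := hp.lB
  have hSB := hp.SB
  have hln := lenN_le n
  have hp1 : Exec (prmN W n I adj) (.set 6 1) s 3 _ := Big.set (by simp; exact hp.W1)
  have hp2 : Exec (prmN W n I adj) (.set 25 (V 5 / 2)) (s.setv 6 1) 7 _ := Big.set (by
    simp; show 2 < W; omega)
  simp only [Ex.val_div, Ex.val_lit1, Ex.val_lit2, Ex.val_var, HS.setv_v, h5] at hp1 hp2
  norm_num at hp1 hp2
  obtain ⟨t3, s3, hB3, ht3, hv3⟩ := exec_bits (W := W) (I := I) (S := (prmN W n I adj).S) (r := 6)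
    (by norm_num) (by omega) ((s.setv 6 1).setv 25 (n / 2)) (by simp; omega)
  simp only [HS.setv_v] at hv3 ht3
  norm_num only [if_true, if_false] at hv3 ht3
  rw [log_half] at hv3
  have k5 : s3.v 5 = n := by rw [hB3.frame.v (by decide)]; simp [h5]
  have hp4 : Exec (prmN W n I adj) (.set 7 1) s3 3 _ := Big.set (by simp; exact hp.W1)
  have hp5 : Exec (prmN W n I adj) (.set 25 (V 6 / 2)) (s3.setv 7 1) 7 _ := Big.set (by
    simp; show 2 < W; omega)
  simp only [Ex.val_div, Ex.val_lit1, Ex.val_lit2, Ex.val_var, HS.setv_v, hv3] at hp4 hp5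
  norm_num at hp4 hp5
  have hl' : Nat.log 2 n + 1 = lenN n := rfl
  rw [hl'] at hp5 hv3
  obtain ⟨t6, s6, hB6, ht6, hv6⟩ := exec_bits (W := W) (I := I) (S := (prmN W n I adj).S) (r := 7)
    (by norm_num) (by omega) ((s3.setv 7 1).setv 25 (lenN n / 2)) (by simp; omega)
  simp only [HS.setv_v] at hv6 ht6
  norm_num only [if_true, if_false] at hv6 ht6
  rw [log_half] at hv6
  obtain ⟨t7, s7, hB7, ht7, hH7⟩ := exec_params hp (s := s6)
    (by rw [hB6.frame.v (by decide)]; simp [k5]) (by rw [hB6.frame.v (by decide)]; simp [hv3]) hv6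
  obtain ⟨t8, s8, hB8, ht8, hI8, -⟩ := Big.for (W := W) (S := (prmN W n I adj).S) (I := I) (i := 25)
    (b := 5) (c := .put 0 (V 25) (.inp (1 + V 25))) (s₀ := s7) n (fun _ => 100)
    (fun j s' => ∀ v < j, s'.a 0 v = I (1 + v)) (by omega) (by omega) hH7.v5 (by decide) (by decide)
    (by decide) (by simp) (by
      intro j hj s1 hF hv hI
      have hS : n * n + n + 1 ≤ (prmN W n I adj).B := hSB
      obtain ⟨t, hB, ht⟩ := St.big_run (W := W) (S := (prmN W n I adj).S) (I := I) (s := s1)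
        (.put 0 (V 25) (.inp (1 + V 25))) (by
          simp [St.ok, hv, Prm.S]
          simp only [prmN] at *
          and_intros <;> omega)
      refine ⟨t, _, hB, ht.trans (show _ ≤ 100 by decide), ?_⟩
      intro v hv'
      simp only [St.run, HS.setv_a, HS.seta_a, Ex.val_var, hv, Ex.val_inp, Ex.val_add, Ex.val_lit1,
        true_and]
      split_ifs with h
      · rw [h]
      · exact hI v (by omega))
  have hp9 : Exec (prmN W n I adj) (.set 16 0) s8 3 _ := Big.set (by simp; exact hp.W1.trans' one_pos)
  have hp10 : Exec (prmN W n I adj) (.set 17 1) (s8.setv 16 0) 3 _ := Big.set (by simp; exact hp.W1)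
  simp only [Ex.val_lit0, Ex.val_lit1] at hp9 hp10
  refine ⟨_, _, hp1.seq (hp2.seq (hB3.seq (hp4.seq (hp5.seq (hB6.seq (hB7.seq
    (hB8.seq (hp9.seq hp10)))))))), ?_, ?_, by simp, by simp, ?_⟩
  · simp only [Finset.sum_const, Finset.card_range, smul_eq_mul] at ht8
    omega
  · exact ((hH7.frame hB8.frame (by decide)).frame (hp9.seq hp10).frame (by decide))
  · exact hI8

end

/-! ### From the structured program to the machine -/

/-- The complete machine program: load `n`, compute the first address above the input, and run the
structured program. -/
def machine : Cmd :=
  .seq (.load 5 5) (.seq (.const 101 1) (.seq (.op .add 100 5 101) (.seq (.op .mul 102 5 5)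
    (.seq (.op .add 100 102 100) prog.comp))))

/-- The initial state of the structured program. -/
def start (n : ℕ) : HS where
  v r := if r = 5 then n else 0
  a _ _ := 0
  out := []

section input
variable {n : ℕ} (G : SimpleGraph (Fin n)) (part : G.Coloring (Fin 3))

open scoped Classical in
/-- The adjacency relation on numbers. -/
noncomputable def adjN (a u : ℕ) : Bool :=
  decide (∃ (ha : a < n) (hu : u < n), G.Adj ⟨a, ha⟩ ⟨u, hu⟩)

theorem adjN_iff (a b : Fin n) : adjN G a b = true ↔ G.Adj a b := by
  simp [adjN]

theorem input_part (v : Fin n) : tripartiteInput G part (1 + v) = part v := by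
  simp [tripartiteInput]

open scoped Classical in
theorem input_adj : ∀ a < n, ∀ u < n,
    tripartiteInput G part (1 + n + (a * n + u)) = if adjN G a u then 1 else 0 := by
  intro a ha u hu
  have h1 : a * n + u < n * n := by
    have : (a + 1) * n ≤ n * n := Nat.mul_le_mul_right _ ha
    rw [Nat.succ_mul] at this
    omega
  have e1 : (⟨a * n + u, h1⟩ : Fin (n * n)).divNat = ⟨a, ha⟩ := by
    ext
    simp only [Fin.divNat, Fin.val_mk]
    rw [Nat.add_comm, Nat.add_mul_div_right _ _ (by omega), Nat.div_eq_of_lt hu, zero_add]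
  have e2 : (⟨a * n + u, h1⟩ : Fin (n * n)).modNat = ⟨u, hu⟩ := by
    ext
    simp only [Fin.modNat, Fin.val_mk]
    rw [Nat.add_comm, Nat.add_mul_mod_self_right, Nat.mod_eq_of_lt hu]
  have e3 : 1 + n + (a * n + u) - 1 - n = a * n + u := by omega
  have e4 := adjN_iff G ⟨a, ha⟩ ⟨u, hu⟩
  simp only at e4
  simp only [tripartiteInput]
  rw [if_neg (by omega), dif_neg (by omega), dif_pos (by rw [e3]; exact h1)]
  have key : ∀ k (hk : k < n * n), k = a * n + u →
      (if G.Adj (Fin.divNat ⟨k, hk⟩) (Fin.modNat ⟨k, hk⟩) then 1 else 0) =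
        if adjN G a u then 1 else 0 := by
    rintro k hk rfl
    rw [e1, e2]
    by_cases h : G.Adj ⟨a, ha⟩ ⟨u, hu⟩
    · rw [if_pos h, if_pos (e4.2 h)]
    · rw [if_neg h, if_neg (fun h' => h (e4.1 h'))]
  exact key _ _ e3

theorem input_zero (k : ℕ) (hk : n * n + n + 1 ≤ k) : tripartiteInput G part k = 0 := by
  simp only [tripartiteInput]
  rw [if_neg (by omega), dif_neg (by omega), dif_neg (by omega)]

theorem input_le (k : ℕ) : tripartiteInput G part k ≤ n + 2 := by
  simp only [tripartiteInput]
  split_ifs with h1 h2 h3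
  · omega
  · have := (part ⟨k - 1, h2⟩).isLt
    omega
  all_goals omega

end input

/-- All registers start at `0`, so the first load reads cell `0`, which holds `n`. The five
instructions and the five `seq` nodes take ten steps. The input vanishes above its last cell, so all
arrays are initially zero. -/
theorem machine_start {w n : ℕ} {I : ℕ → ℕ} (hI0 : I 0 = n) (hIz : ∀ k, n * n + n + 1 ≤ k → I k = 0)
    (hIw : ∀ k, I k < 2 ^ w) (hw : n * n + n + 1 < 2 ^ w) :
    ∃ u, (step w)^[10] ([machine], WordRAM.initial w I) = ([prog.comp], u) ∧
      Rel w (n * n + n + 1) I (start n) u := by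
  have h1 : 1 % 2 ^ w = 1 := Nat.mod_eq_of_lt (by omega)
  have h2 : (n + 1) % 2 ^ w = n + 1 := Nat.mod_eq_of_lt (by nlinarith)
  have h3 : (n * n) % 2 ^ w = n * n := Nat.mod_eq_of_lt (by omega)
  have h4 : (n * n + (n + 1)) % 2 ^ w = n * n + n + 1 := Nat.mod_eq_of_lt (by omega)
  have h5 : n % 2 ^ w = n := Nat.mod_eq_of_lt (by nlinarith)
  refine ⟨_, rfl, ?_⟩
  constructor
  · intro r hr
    simp [State.setReg, WordRAM.initial, start, Function.update_apply, show r ≠ 100 by omega,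
      show r ≠ 101 by omega, show r ≠ 102 by omega, hI0, h5]
  · simp [State.setReg, WordRAM.initial, hI0, h5, Op.eval, h1, h2, h3,
      h4]
  · intro i hi
    simp [State.setReg, WordRAM.initial, Nat.mod_eq_of_lt (hIw i)]
  · intro r hr i
    simp [State.setReg, WordRAM.initial, hIz _ (show n * n + n + 1 ≤ n * n + n + 1 + (8 * i + r) by omega),
      start]
  · simp [State.setReg, WordRAM.initial, start]
  · intro r
    simp only [State.setReg, WordRAM.initial, Function.update_apply, Op.eval]
    split_ifs <;> first | exact Nat.mod_lt _ (by omega) | omega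
  · intro i
    simp only [State.setReg, WordRAM.initial]
    exact Nat.mod_lt _ (by omega)

section record
variable {n : ℕ}

/-- Forget that the vertices are below `n`. -/
def toEntry : SearchEntry n → Entry
  | .rect S T => .rect (S.map Fin.val) (T.map Fin.val)
  | .use a j => .use a j

theorem exists_list_fin {S : List ℕ} (h : ∀ u ∈ S, u < n) :
    ∃ S' : List (Fin n), S'.map Fin.val = S := by
  have : S ∈ Set.range (List.map (Fin.val : Fin n → ℕ)) := by
    rw [Set.range_list_map]
    exact fun u hu => ⟨⟨u, h u hu⟩, rfl⟩
  exact this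

theorem exists_record {R : List Entry} (h : ∀ e ∈ R, e.Lt n) :
    ∃ R' : List (SearchEntry n), R'.map toEntry = R := by
  have : R ∈ Set.range (List.map (toEntry : SearchEntry n → Entry)) := by
    rw [Set.range_list_map]
    intro e he
    have := h e he
    rcases e with ⟨S, T⟩ | ⟨a, j⟩
    · obtain ⟨S', rfl⟩ := exists_list_fin this.1
      obtain ⟨T', rfl⟩ := exists_list_fin this.2
      exact ⟨.rect S' T', rfl⟩
    · exact ⟨.use ⟨a, this⟩ j, rfl⟩
  exact this

theorem encode_toEntry (e : SearchEntry n) : (toEntry e).encode = e.encode := by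
  cases e <;> simp [toEntry, Entry.encode, SearchEntry.encode]

theorem cost_toEntry (e : SearchEntry n) : (toEntry e).cost = e.cost := by
  cases e <;> simp [toEntry, Entry.cost, SearchEntry.cost]

theorem rects_toEntry (R : List (SearchEntry n)) :
    rects (R.map toEntry) = (rectangles R).map fun r => (r.1.map Fin.val, r.2.map Fin.val) := by
  induction R with
  | nil => rfl
  | cons e R ih =>
    simp only [rects, rectangles] at ih
    cases e <;> simp [rects, rectangles, toEntry, ih]

theorem isRefutation_of_rects (G : SimpleGraph (Fin n)) (part : G.Coloring (Fin 3)) {p : Prm}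
    (hadj : p.adj = adjN G) {R : List (SearchEntry n)}
    (h₁ : ∀ r ∈ rects (R.map toEntry), p.clear r.1 r.2 = true)
    (h₂ : ∀ a b c : Fin n, part b = 1 → part c = 2 → G.Adj a b → G.Adj a c →
      Covers 0 (R.map toEntry) a b c) : IsRefutation G part R := by
  constructor
  · intro r hr b hb c hc hbc
    have := h₁ (r.1.map Fin.val, r.2.map Fin.val) (by
      rw [rects_toEntry]; exact List.mem_map.2 ⟨r, hr, rfl⟩)
    rw [Prm.clear_iff, hadj] at this
    have := this b (List.mem_map_of_mem hb) c (List.mem_map_of_mem hc)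
    rw [(adjN_iff G b c).2 hbc] at this
    simp at this
  · intro a b c _ hb hc hab hac
    obtain ⟨j, S, T, hu, hr, hbS, hcT⟩ := h₂ a b c hb hc hab hac
    rw [rects_toEntry, List.getElem?_map] at hr
    rcases hr' : (rectangles R)[j]? with _ | r
    · simp [hr'] at hr
    · simp only [hr', Option.map_some, Option.some.injEq, Prod.mk.injEq] at hr
      obtain ⟨rfl, rfl⟩ := hr
      refine ⟨j, r, ?_, hr', ?_, ?_⟩
      · obtain ⟨e, he, hej⟩ := List.mem_map.1 hu
        rcases e with ⟨S, T⟩ | ⟨a', j'⟩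
        · simp [toEntry] at hej
        · simp only [toEntry, Entry.use.injEq, zero_add] at hej
          obtain ⟨h1, rfl⟩ := hej
          rwa [← Fin.ext h1]
      · obtain ⟨b', hb', hbb⟩ := List.mem_map.1 hbS
        rwa [← Fin.ext hbb]
      · obtain ⟨b', hb', hbb⟩ := List.mem_map.1 hcT
        rwa [← Fin.ext hbb]

/-- Adjacent vertices lie in different parts, so a triangle meets each of the three parts once and
its corners can be permuted into order. -/
theorem exists_sorted_triangle (G : SimpleGraph (Fin n)) (part : G.Coloring (Fin 3))
    (h : ∃ a b c : Fin n, G.Adj a b ∧ G.Adj a c ∧ G.Adj b c) :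
    ∃ a b c : Fin n, part a = 0 ∧ part b = 1 ∧ part c = 2 ∧ G.Adj a b ∧ G.Adj a c ∧ G.Adj b c := by
  obtain ⟨a, b, c, hab, hac, hbc⟩ := h
  have h1 := part.valid hab
  have h2 := part.valid hac
  have h3 := part.valid hbc
  have key : ∀ x y z : Fin 3, x ≠ y → x ≠ z → y ≠ z →
      (x = 0 ∧ y = 1 ∧ z = 2) ∨ (x = 0 ∧ z = 1 ∧ y = 2) ∨ (y = 0 ∧ x = 1 ∧ z = 2) ∨
      (y = 0 ∧ z = 1 ∧ x = 2) ∨ (z = 0 ∧ x = 1 ∧ y = 2) ∨ (z = 0 ∧ y = 1 ∧ x = 2) := by decide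
  rcases key _ _ _ h1 h2 h3 with ⟨x, y, z⟩ | ⟨x, y, z⟩ | ⟨x, y, z⟩ | ⟨x, y, z⟩ | ⟨x, y, z⟩ | ⟨x, y, z⟩
  · exact ⟨_, _, _, x, y, z, hab, hac, hbc⟩
  · exact ⟨_, _, _, x, y, z, hac, hab, hbc.symm⟩
  · exact ⟨_, _, _, x, y, z, hab.symm, hbc, hac⟩
  · exact ⟨_, _, _, x, y, z, hbc, hab.symm, hac.symm⟩
  · exact ⟨_, _, _, x, y, z, hac.symm, hbc.symm, hab⟩
  · exact ⟨_, _, _, x, y, z, hbc.symm, hac.symm, hab.symm⟩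

theorem not_triangle_of_isRefutation (G : SimpleGraph (Fin n)) (part : G.Coloring (Fin 3))
    {R : List (SearchEntry n)} (h : IsRefutation G part R) :
    ¬ ∃ a b c : Fin n, G.Adj a b ∧ G.Adj a c ∧ G.Adj b c := by
  intro ht
  obtain ⟨a, b, c, ha, hb, hc, hab, hac, hbc⟩ := exists_sorted_triangle G part ht
  obtain ⟨j, r, -, hr, hbr, hcr⟩ := h.2 a b c ha hb hc hab hac
  exact h.1 r (List.mem_of_getElem? hr) b hbr c hcr hbc

end record

/-- The answer `1` comes with a triangle and the answer `0` with a refutation. These exclude each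
other, so correctness of the answer follows from its justification together with register `0` being
at most `1`. -/
theorem machine_correct {n w : ℕ} (G : SimpleGraph (Fin n)) (part : G.Coloring (Fin 3))
    (hw : 100 * (Nat.log 2 n + 1) ≤ w) {N F : ℕ → ℝ} {N₀ T : ℕ}
    (hP : Potential (prmN (2 ^ w) n (tripartiteInput G part) (adjN G)) N F N₀)
    (hN : ∀ x ≤ n * n, N x ≤ N₀) (hT : ∀ x ≤ n * n, F x + 600 * (n + 1) ≤ T) :
    ∃ s : State, WordRAM.HaltsWithin w machine (tripartiteInput G part) T s ∧
      ((∃ a b c : Fin n, G.Adj a b ∧ G.Adj a c ∧ G.Adj b c) → s.reg 0 = 1) ∧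
      ((¬ ∃ a b c : Fin n, G.Adj a b ∧ G.Adj a c ∧ G.Adj b c) → s.reg 0 = 0) ∧
      CombinatoriallyJustified G part s T := by
  set I := tripartiteInput G part with hI
  set p := prmN (2 ^ w) n I (adjN G) with hp'
  have hl1 := lenN_pos n
  have hlw : 100 * lenN n ≤ w := hw
  have hp : p.Good := by
    refine prmN_good ?_ (input_adj G part)
    calc _ ≤ 2 ^ 7 * (2 ^ (20 * lenN n) * 2 ^ (20 * lenN n) *
        (2 ^ (20 * lenN n) * 2 ^ (20 * lenN n))) := Nat.mul_le_mul_right _ (by norm_num)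
      _ = 2 ^ (7 + 80 * lenN n) := by simp only [← pow_add]; congr 1; ring
      _ ≤ 2 ^ w := Nat.pow_le_pow_right (by norm_num) (by omega)
  have hSW : n * n + n + 1 < 2 ^ w := by
    have h1 := hp.SB
    have h2 := hp.hW1
    have h3 := hp.B0
    have e1 : p.S = n * n + n + 1 := rfl
    have e2 : p.W = 2 ^ w := rfl
    omega
  obtain ⟨u0, hu0, hrel⟩ := machine_start (w := w) (n := n) (I := I) (by simp [hI, tripartiteInput])
    (input_zero G part) (fun k => (input_le G part k).trans_lt (by
      have : 2 ^ 100 ≤ 2 ^ w := Nat.pow_le_pow_right (by norm_num) (by omega)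
      rcases Nat.lt_or_ge n 2 with h | h
      · norm_num at this; omega
      · nlinarith)) hSW
  obtain ⟨t1, s1, hB1, ht1, hH1, h16, h17, hlab⟩ := exec_setup hp (s := start n) rfl
  have hF := hB1.frame
  have hlab0 : ∀ v < n, labels p s1 0 v = I (1 + v) := by
    intro v hv
    simp only [labels, zero_mul, zero_add]
    exact hlab v hv
  have z18 : s1.v 18 = 0 := by rw [hF.v (by decide)]; rfl
  have z0 : s1.v 0 = 0 := by rw [hF.v (by decide)]; rfl
  have z1 : s1.a 1 = fun _ => 0 := by rw [hF.a (by decide)]; rfl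
  have z2 : s1.a 2 = fun _ => 0 := by rw [hF.a (by decide)]; rfl
  have z5 : s1.a 5 = fun _ => 0 := by rw [hF.a (by decide)]; rfl
  have zo : s1.out = [] := by rw [hF.out rfl]; rfl
  have harea : area p.n (labels p s1 0) ≤ n * n :=
    Nat.mul_le_mul (length_side_le _ _ _) (length_side_le _ _ _)
  have hS : Search p N N₀ (fun v => I (1 + v)) [] s1 := by
    refine ⟨hH1, ⟨by omega, by omega⟩, ?_, ?_, ?_, by simp [zo], by simp [z18, rects], by simp, ?_,
      by omega, ?_, by omega⟩
    · intro i hi v hv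
      obtain rfl : i = 0 := by omega
      exact Or.inr (hlab0 v hv)
    · intro hn i
      simp [z1, z2, hn]
    · simp [z5]
    · intro _
      refine ⟨by simp [rects], ?_⟩
      intro a _ u hu v hv hlu hlv _ _
      -- Before the loop, subproblem `0` contains every pair from the second and third part, and
      -- nothing is covered yet.
      exact Or.inr ⟨0, by omega, by omega, (hlab0 u hu).trans hlu, (hlab0 v hv).trans hlv⟩
    · rw [h16, h17]
      simp only [Nat.Ico_succ_singleton, Finset.sum_singleton]
      simpa using hN _ harea
  obtain ⟨t2, s2, R, hB2, hS2, hle, ht2, hco⟩ := exec_mainLoop hp hP (fun v hv => by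
    have h1 : I (1 + v) = part ⟨v, hv⟩ := input_part G part ⟨v, hv⟩
    have h3 := (part ⟨v, hv⟩).isLt
    show I (1 + v) ≤ 2
    omega) hS
  rw [h16, h17] at ht2 hco
  simp only [Nat.Ico_succ_singleton, Finset.sum_singleton] at ht2 hco
  have hTx := hT _ harea
  obtain ⟨u2, hr2, hrel2⟩ := Big.runs (by omega) (hB1.seq hB2) hrel prog_wf
  have hsteps : t1 + t2 + 1 + 10 ≤ T := by
    have h1 : (t1 : ℝ) ≤ 500 * (n + 1) := by exact_mod_cast ht1
    have h2 : (0 : ℝ) ≤ n := Nat.cast_nonneg n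
    have : ((t1 + t2 + 1 + 10 : ℕ) : ℝ) ≤ T := by
      push_cast
      linarith
    exact_mod_cast this
  have hhalt : WordRAM.HaltsWithin w machine I T u2 := by
    -- A halted machine stays where it is, so the exact step count may be padded to the time bound.
    obtain ⟨d, rfl⟩ := Nat.exists_eq_add_of_le hsteps
    have hstay : ∀ d, (step w)^[d] ([], u2) = ([], u2) := fun d => by
      induction d with
      | zero => rfl
      | succ d ih => rw [Function.iterate_succ_apply]; exact ih
    unfold WordRAM.HaltsWithin
    have hr3 : (step w)^[t1 + t2 + 1] ([prog.comp], u0) = ([], u2) := hr2 []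
    rw [Nat.add_comm _ d, Function.iterate_add_apply, Function.iterate_add_apply, hu0, hr3, hstay]
  have hr0 : u2.reg 0 = s2.v 0 := hrel2.reg 0 (by norm_num)
  have hA := hS2.ans
  have htri : u2.reg 0 = 1 → ∃ a b c : Fin n, u2.reg 1 = a ∧ u2.reg 2 = b ∧ u2.reg 3 = c ∧
      G.Adj a b ∧ G.Adj a c ∧ G.Adj b c := by
    intro h
    obtain ⟨h1, h2, h3, h4, h5, h6⟩ := hA.tri (by rw [← hr0, h])
    exact ⟨⟨_, h1⟩, ⟨_, h2⟩, ⟨_, h3⟩, hrel2.reg 1 (by norm_num), hrel2.reg 2 (by norm_num),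
      hrel2.reg 3 (by norm_num), (adjN_iff G ⟨_, h1⟩ ⟨_, h2⟩).1 h4,
      (adjN_iff G ⟨_, h1⟩ ⟨_, h3⟩).1 h5, (adjN_iff G ⟨_, h2⟩ ⟨_, h3⟩).1 h6⟩
  have href : u2.reg 0 = 0 → ∃ R : List (SearchEntry n), u2.out = R.flatMap SearchEntry.encode ∧
      IsRefutation G part R ∧ (R.map SearchEntry.cost).sum ≤ T := by
    intro h
    obtain ⟨R', rfl⟩ := exists_record (n := n) hS2.lt
    obtain ⟨c1, c2⟩ := hS2.correct (by rw [← hr0, h])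
    refine ⟨R', ?_, isRefutation_of_rects G part (p := p) rfl c1 ?_, ?_⟩
    · rw [hrel2.out, hS2.out, List.flatMap_map]
      simp only [encode_toEntry]
    · intro a b c hb hc hab hac
      rcases c2 a a.2 b b.2 c c.2 (by simp only [hI, input_part, hb]; rfl)
        (by simp only [hI, input_part, hc]; rfl)
        ((adjN_iff G a b).2 hab) ((adjN_iff G a c).2 hac) with hcov | ⟨i, hi1, hi2, -⟩
      · exact hcov
      · omega
    · have e : costs (R'.map toEntry) = (R'.map SearchEntry.cost).sum := by
        simp only [costs, List.map_map]
        congr 1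
        exact List.map_congr_left fun e _ => cost_toEntry e
      rw [e] at hco
      have h2 : (0 : ℝ) ≤ n := Nat.cast_nonneg n
      have : (((R'.map SearchEntry.cost).sum : ℕ) : ℝ) ≤ T := by
        have h3 : costs ([] : List Entry) = 0 := rfl
        rw [h3, Nat.cast_zero, zero_add] at hco
        linarith
      exact_mod_cast this
  refine ⟨u2, hhalt, ?_, ?_, htri, href⟩
  · intro h
    have h1 := hA.le
    by_contra hne
    obtain ⟨R', -, hR', -⟩ := href (by omega)
    exact not_triangle_of_isRefutation G part hR' h
  · intro h
    have h1 := hA.le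
    by_contra hne
    obtain ⟨a, b, c, -, -, -, h'⟩ := htri (by omega)
    exact h ⟨a, b, c, h'⟩

/-! ### Potential functions for the number and the cost of subproblems -/

/-- Here γ and β are the fractions of the two sides seen by the dense vertex. Bernoulli's inequality
gives (1-β)^(1-δ) ≤ 1 - β/2 and (1-γ)^(1-δ) ≤ 1 - (1-δ)γ. The only loss is γ^(-δ) ≤ exp(δt) ≤ 1 +
2δt. So the sum is at most 1 + γ((1 + 2δt)(1 - β/2) - 1 + δ), and by `h2` the gain β/2 outweighs the
loss 2δt + δ. -/
theorem rpow_split_le_one {γ β δ t : ℝ} (hγ0 : 0 < γ) (hγ1 : γ ≤ 1) (hβ1 : β ≤ 1) (hβ0 : 0 ≤ β)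
    (hδ0 : 0 ≤ δ) (hδ : δ ≤ 1 / 2) (ht0 : 0 ≤ t) (ht : Real.exp (-t) ≤ γ) (h1 : δ * t ≤ 1)
    (h2 : δ * (2 * t + 1) ≤ β / 2) : (γ * (1 - β)) ^ (1 - δ) + (1 - γ) ^ (1 - δ) ≤ 1 := by
  have b1 : (1 - β) ^ (1 - δ) ≤ 1 - β / 2 := by
    have := rpow_one_add_le_one_add_mul_self (s := -β) (p := 1 - δ) (by linarith) (by linarith)
      (by linarith)
    rw [← sub_eq_add_neg] at this
    nlinarith
  have b2 : (1 - γ) ^ (1 - δ) ≤ 1 - (1 - δ) * γ := by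
    have := rpow_one_add_le_one_add_mul_self (s := -γ) (p := 1 - δ) (by linarith) (by linarith)
      (by linarith)
    rw [← sub_eq_add_neg] at this
    linarith
  have b3 : γ ^ (1 - δ) ≤ γ * (1 + 2 * (δ * t)) := by
    have e1 : γ ^ (1 - δ) = γ * γ ^ (-δ) := by
      rw [sub_eq_add_neg, Real.rpow_add hγ0, Real.rpow_one]
    have e2 : γ ^ (-δ) ≤ Real.exp (δ * t) := by
      calc γ ^ (-δ) ≤ Real.exp (-t) ^ (-δ) :=
            Real.rpow_le_rpow_of_nonpos (Real.exp_pos _) ht (by linarith)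
        _ = Real.exp (δ * t) := by rw [← Real.exp_mul]; congr 1; ring
    have h0 : 0 ≤ δ * t := mul_nonneg hδ0 ht0
    have e3 := Real.abs_exp_sub_one_le (x := δ * t) (by rwa [abs_of_nonneg h0])
    rw [abs_of_nonneg h0] at e3
    have e4 := (abs_le.1 e3).2
    rw [e1]
    exact mul_le_mul_of_nonneg_left (by linarith) hγ0.le
  have h0 : 0 ≤ δ * t := mul_nonneg hδ0 ht0
  have b4 : (γ * (1 - β)) ^ (1 - δ) ≤ γ * (1 + 2 * (δ * t)) * (1 - β / 2) := by
    rw [Real.mul_rpow hγ0.le (by linarith)]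
    exact mul_le_mul b3 b1 (Real.rpow_nonneg (by linarith) _) (by positivity)
  have b5 : (1 + 2 * (δ * t)) * (1 - β / 2) - 1 + δ ≤ 0 := by nlinarith
  nlinarith

/-- The two parts of a split have smaller total weight, for the weight `x ↦ x ^ (1 - δ)`. -/
theorem rpow_split_le {u₁ u₂ d₁ d₂ θ δ t : ℝ} (hu₁ : 0 < u₁) (hu₂ : 0 < u₂) (hd₁ : d₁ ≤ u₁)
    (hd₂ : d₂ ≤ u₂) (hθ : 0 < θ) (h₁ : θ ^ 2 * u₁ ≤ d₁) (h₂ : θ * u₂ ≤ d₂)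
    (hδ0 : 0 ≤ δ) (hδ : δ ≤ 1 / 2) (ht0 : 0 ≤ t) (ht : Real.exp (-t) ≤ θ ^ 2) (hδt : δ * t ≤ 1)
    (hδθ : δ * (2 * t + 1) ≤ θ / 2) :
    (d₁ * (u₂ - d₂)) ^ (1 - δ) + ((u₁ - d₁) * u₂) ^ (1 - δ) ≤ (u₁ * u₂) ^ (1 - δ) := by
  have hγ : θ ^ 2 ≤ d₁ / u₁ := by rwa [le_div_iff₀ hu₁]
  have hβ : θ ≤ d₂ / u₂ := by rwa [le_div_iff₀ hu₂]
  have hγ1 : d₁ / u₁ ≤ 1 := (div_le_one hu₁).2 hd₁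
  have hβ1 : d₂ / u₂ ≤ 1 := (div_le_one hu₂).2 hd₂
  have hd : 0 < d₁ / u₁ := lt_of_lt_of_le (by positivity) hγ
  have key := rpow_split_le_one hd hγ1 hβ1 (hθ.le.trans hβ) hδ0 hδ ht0 (ht.trans hγ) hδt
    (hδθ.trans (by linarith))
  have e1 : d₁ * (u₂ - d₂) = u₁ * u₂ * (d₁ / u₁ * (1 - d₂ / u₂)) := by field_simp
  have e2 : (u₁ - d₁) * u₂ = u₁ * u₂ * (1 - d₁ / u₁) := by field_simp
  have hu : 0 < u₁ * u₂ := by positivity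
  rw [e1, e2]
  generalize u₁ * u₂ = u at hu
  rw [Real.mul_rpow hu.le (mul_nonneg hd.le (by linarith)),
    Real.mul_rpow hu.le (by linarith), ← mul_add]
  exact mul_le_of_le_one_right (by positivity) key

/-- Number of pairs of codes. -/
def codesN (n : ℕ) : ℕ :=
  n * 2 ^ ((3 * llenN n + 1) * grpN n) * (n * 2 ^ ((3 * llenN n + 1) * grpN n))

/-- Bound for the number of subproblems. -/
def nodesN (n : ℕ) : ℕ := 1 + 2 ^ (lenN n / 4) * lenN n ^ 2

/-- Bound for the number of subproblems below a subproblem of area `x`. -/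
noncomputable def countN (n : ℕ) (x : ℝ) : ℝ := 1 + x * 2 ^ (lenN n / 4) * (lenN n : ℝ) ^ 2 / (n : ℝ) ^ 2

/-- The cost of a subproblem apart from the dependence on its area. -/
noncomputable def baseN (n : ℕ) : ℝ :=
  4000 * (codesN n * ((grpN n : ℝ) + 1) ^ 2) + 25000 * ((n : ℝ) + 1) ^ 2

/-- The cost of one vertex in a large subproblem without dense vertices, divided by the area. -/
noncomputable def rateN (n : ℕ) : ℝ :=
  (256 * (llenN n : ℝ) ^ 2) ^ 2 / ((lenN n : ℝ) ^ 2 * (grpN n : ℝ) ^ 2) +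
    3 / ((grpN n : ℝ) * 2 ^ (3 * llenN n))

/-- The exponent by which the total area of small subproblems is smaller. -/
noncomputable def gainN (n : ℕ) : ℝ := min (1 / 2) (16 * llenN n / lenN n)

/-- The weight of a subproblem of area `x` in the bound for the total area of small subproblems. -/
noncomputable def smallN (n : ℕ) (x : ℝ) : ℝ :=
  x ^ (1 - gainN n) * ((n : ℝ) ^ 2 / 2 ^ (lenN n / 4)) ^ gainN n

/-- Bound for the total cost below a subproblem of area `x`. -/
noncomputable def costN (n : ℕ) (x : ℝ) : ℝ :=
  baseN n * countN n x + 4000 * (n * (x * rateN n)) + 4000 * (n * smallN n x)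

theorem lenN_posR (n : ℕ) : (1 : ℝ) ≤ lenN n := by exact_mod_cast lenN_pos n
theorem llenN_posR (n : ℕ) : (1 : ℝ) ≤ llenN n := by exact_mod_cast llenN_pos n

theorem gainN_nonneg (n : ℕ) : 0 ≤ gainN n := le_min (by norm_num) (by positivity)
theorem gainN_le_half (n : ℕ) : gainN n ≤ 1 / 2 := min_le_left _ _
theorem gainN_le (n : ℕ) : gainN n ≤ 16 * llenN n / lenN n := min_le_right _ _

theorem baseN_ge (n : ℕ) : 25000 * ((n : ℝ) + 1) ^ 2 ≤ baseN n :=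
  le_add_of_nonneg_left (by positivity)

theorem rateN_nonneg (n : ℕ) : 0 ≤ rateN n := by unfold rateN; positivity
theorem smallN_nonneg (n : ℕ) {x : ℝ} (hx : 0 ≤ x) : 0 ≤ smallN n x := by
  unfold smallN; positivity
theorem one_le_countN (n : ℕ) {x : ℝ} (hx : 0 ≤ x) : 1 ≤ countN n x :=
  le_add_of_nonneg_right (by positivity)

theorem countN_mono (n : ℕ) {x y : ℝ} (hxy : x ≤ y) : countN n x ≤ countN n y := by
  unfold countN; gcongr

theorem costN_mono (n : ℕ) {x y : ℝ} (hx : 0 ≤ x) (hxy : x ≤ y) : costN n x ≤ costN n y := by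
  have h0 : 0 ≤ baseN n := (by positivity : (0 : ℝ) ≤ 25000 * ((n : ℝ) + 1) ^ 2).trans (baseN_ge n)
  have h1 := countN_mono n hxy
  have h2 := rateN_nonneg n
  have h3 : smallN n x ≤ smallN n y := by
    unfold smallN
    have := gainN_le_half n
    gcongr
    linarith
  unfold costN
  gcongr

/-- Up to area `n² / R` the factor `x ^ δ` is at most `(n² / R) ^ δ`, which is why the weight is
normalised in this way. -/
theorem le_smallN (n : ℕ) {x : ℝ} (hx : 0 ≤ x) (h : x * 2 ^ (lenN n / 4) ≤ (n : ℝ) ^ 2) :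
    x ≤ smallN n x := by
  rcases hx.eq_or_lt with rfl | hx
  · exact smallN_nonneg n le_rfl
  · have h1 : x ≤ (n : ℝ) ^ 2 / 2 ^ (lenN n / 4) := by rwa [le_div_iff₀ (by positivity)]
    calc x = x ^ (1 - gainN n) * x ^ gainN n := by
          rw [← Real.rpow_add hx, sub_add_cancel, Real.rpow_one]
      _ ≤ _ := by
          have := gainN_nonneg n
          unfold smallN
          gcongr

/-- Applied with `u = 1 / g` and `v = 1 / L`. Only the main term has to keep the degrees: the other
quadratic terms contain a factor `v` and are each at most `s₁ s₂ u v`, and the four linear terms are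
at most `n` each. -/
theorem mul_groups_le {d₁ d₂ s₁ s₂ n u v : ℝ} (hd₁ : 0 ≤ d₁) (hd₂ : 0 ≤ d₂) (h₁ : d₁ ≤ s₁)
    (h₂ : d₂ ≤ s₂) (hs₁ : s₁ ≤ n) (hs₂ : s₂ ≤ n) (hv : 0 ≤ v) (hvu : v ≤ u) (hu : u ≤ 1) :
    (d₁ * u + s₁ * v + 1) * (d₂ * u + s₂ * v + 1) ≤
      d₁ * d₂ * u ^ 2 + 3 * (s₁ * s₂ * (u * v)) + (4 * n + 1) := by
  have hu0 := hv.trans hvu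
  have e1 : d₁ * s₂ * (u * v) ≤ s₁ * s₂ * (u * v) := by gcongr; linarith
  have e2 : s₁ * d₂ * (u * v) ≤ s₁ * s₂ * (u * v) := by gcongr; linarith
  have e3 : s₁ * s₂ * (v * v) ≤ s₁ * s₂ * (u * v) := by
    have : 0 ≤ s₁ * s₂ := mul_nonneg (by linarith) (by linarith)
    gcongr
  have e4 : ∀ {x y : ℝ}, 0 ≤ x → x ≤ n → y ≤ 1 → 0 ≤ y → x * y ≤ n := fun h1 h2 h3 h4 =>
    (mul_le_of_le_one_right h1 h3).trans h2
  have f1 := e4 hd₁ (h₁.trans hs₁) hu hu0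
  have f2 := e4 hd₂ (h₂.trans hs₂) hu hu0
  have f3 := e4 (hd₁.trans h₁) hs₁ (hvu.trans hu) hv
  have f4 := e4 (hd₂.trans h₂) hs₂ (hvu.trans hu) hv
  nlinarith

/-- From `l ≤ 2 ^ m ≤ exp m` one gets `exp (-m) ≤ 1 / l ≤ θ`; thus `2m` bounds the logarithm of `1 /
θ²`. -/
theorem exp_neg_le_sq {n : ℕ} {θ : ℝ} (hθ : (1 : ℝ) / lenN n ≤ θ) :
    Real.exp (-(2 * llenN n)) ≤ θ ^ 2 := by
  have h1 : (lenN n : ℝ) ≤ Real.exp (llenN n) := by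
    calc (lenN n : ℝ) ≤ 2 ^ llenN n := by exact_mod_cast (lenN_lt_two_pow n).le
      _ ≤ Real.exp 1 ^ llenN n := by
          have : (2 : ℝ) ≤ Real.exp 1 := by have := Real.add_one_le_exp (1 : ℝ); linarith
          gcongr
      _ = Real.exp (llenN n) := by rw [← Real.exp_nat_mul, mul_one]
  have h0 : (0 : ℝ) < lenN n := by have := lenN_posR n; linarith
  have h2 : Real.exp (-(llenN n : ℝ)) ≤ θ := by
    rw [Real.exp_neg, inv_eq_one_div]
    exact (one_div_le_one_div_of_le h0 h1).trans hθ
  calc Real.exp (-(2 * llenN n)) = Real.exp (-(llenN n : ℝ)) ^ 2 := by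
        rw [← Real.exp_nat_mul]; congr 1; push_cast; ring
    _ ≤ θ ^ 2 := by gcongr

/-- The weights of small subproblems are superadditive under splits. -/
theorem smallN_split {n : ℕ} {u₁ u₂ d₁ d₂ θ : ℝ} (hu₁ : 0 < u₁) (hu₂ : 0 < u₂) (hd₁ : d₁ ≤ u₁)
    (hd₂ : d₂ ≤ u₂) (hθ : θ = 256 * (llenN n : ℝ) ^ 2 / lenN n) (hθ1 : θ ≤ 1)
    (h₁ : θ ^ 2 * u₁ ≤ d₁) (h₂ : θ * u₂ ≤ d₂) :
    smallN n (d₁ * (u₂ - d₂)) + smallN n ((u₁ - d₁) * u₂) ≤ smallN n (u₁ * u₂) := by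
  have hl := lenN_posR n
  have hm := llenN_posR n
  have hl0 : (0 : ℝ) < lenN n := by linarith
  have hθ0 : 0 < θ := by rw [hθ]; positivity
  have hg := gainN_le n
  have hg0 := gainN_nonneg n
  have hmm : (llenN n : ℝ) ≤ (llenN n : ℝ) ^ 2 := by nlinarith
  -- The constant `256` has its room here. With `t = 2m` and δ ≤ 16 m / l, the loss δ(2t + 1) is at
  -- most 80 m² / l, below θ/2 = 128 m² / l.
  have key := rpow_split_le (t := 2 * llenN n) hu₁ hu₂ hd₁ hd₂ hθ0 h₁ h₂ hg0 (gainN_le_half n)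
    (by positivity) (exp_neg_le_sq (by rw [hθ]; gcongr; nlinarith)) (by
      calc gainN n * (2 * llenN n) ≤ 16 * llenN n / lenN n * (2 * llenN n) := by gcongr
        _ = 32 * (llenN n : ℝ) ^ 2 / lenN n := by ring
        _ ≤ θ := by rw [hθ]; gcongr; norm_num
        _ ≤ 1 := hθ1) (by
      calc gainN n * (2 * (2 * llenN n) + 1) ≤ 16 * llenN n / lenN n * (5 * llenN n) := by
            gcongr; linarith
        _ = 80 * (llenN n : ℝ) ^ 2 / lenN n := by ring
        _ ≤ 128 * (llenN n : ℝ) ^ 2 / lenN n := by gcongr; norm_num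
        _ = θ / 2 := by rw [hθ]; ring)
  simp only [smallN, ← add_mul]
  gcongr

theorem nodesN_le (n : ℕ) : nodesN n ≤ 1 + 2 ^ (3 * lenN n) := by
  have h6 : lenN n < 2 ^ lenN n := Nat.lt_two_pow_self
  have h1 : 2 ^ (lenN n / 4) ≤ 2 ^ lenN n := Nat.pow_le_pow_right (by norm_num) (Nat.div_le_self _ _)
  have h2 : lenN n ^ 2 ≤ (2 ^ lenN n) ^ 2 := Nat.pow_le_pow_left h6.le 2
  calc nodesN n ≤ 1 + 2 ^ lenN n * (2 ^ lenN n) ^ 2 :=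
        Nat.add_le_add_left (Nat.mul_le_mul h1 h2) _
    _ = _ := by rw [← pow_mul, ← pow_add]; congr 2; ring

theorem countN_le_nodesN {n : ℕ} {x : ℝ} (hx : x ≤ (n : ℝ) * n) : countN n x ≤ nodesN n := by
  refine (countN_mono n hx).trans ?_
  unfold countN nodesN
  push_cast
  rcases Nat.eq_zero_or_pos n with rfl | hn
  · simp
  · have : (0 : ℝ) < n := by exact_mod_cast hn
    apply le_of_eq
    field_simp

section
variable {W n : ℕ} {I : ℕ → ℕ} {adj : ℕ → ℕ → Bool} {Ls : ℕ → List ℕ}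

theorem grpN_le (n : ℕ) : grpN n ≤ 2 ^ (3 * llenN n) :=
  calc grpN n ≤ lenN n + 1 := Nat.succ_le_succ (Nat.div_le_self _ _)
    _ ≤ 2 ^ llenN n := lenN_lt_two_pow n
    _ ≤ _ := Nat.pow_le_pow_right (by norm_num) (by omega)

theorem ngroups_le (d len : ℕ) : (((prmN W n I adj).ngroups d len : ℕ) : ℝ) ≤
    d * (1 / (grpN n : ℝ)) + len * (1 / (2 : ℝ) ^ (3 * llenN n)) + 1 := by
  have h1 : ((d / grpN n : ℕ) : ℝ) ≤ d / (grpN n : ℝ) := Nat.cast_div_le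
  have h2 : ((len / 2 ^ (3 * llenN n) : ℕ) : ℝ) ≤ len / ((2 ^ (3 * llenN n) : ℕ) : ℝ) := Nat.cast_div_le
  simp only [Prm.ngroups, prmN]
  push_cast at h2 ⊢
  rw [mul_one_div, mul_one_div]
  linarith

/-- The two kinds of leaf differ only in the bound for the product of degrees: without a dense
vertex it is below θ² x, which `rateN` absorbs; in a small leaf it is at most `x`, hence at most
`smallN n x`. The terms of order `n²` are `4000`, `4 * 4000` and `5000` times `(n + 1)²`, which add
up to the `25000` in `baseN`. -/
theorem leafCost_le (hlen : ∀ q, q = 1 ∨ q = 2 → (Ls q).length ≤ n)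
    (h : (Ls 1).length * (Ls 2).length * 2 ^ (lenN n / 4) < n * n ∨
      ∀ a < n, (prmN W n I adj).deg a (Ls 1) * (prmN W n I adj).deg a (Ls 2) * (lenN n * lenN n) <
        256 * (llenN n * llenN n) * (256 * (llenN n * llenN n)) * ((Ls 1).length * (Ls 2).length)) :
    (((prmN W n I adj).leafCost Ls : ℕ) : ℝ) + 5000 * ((n : ℝ) + 1) ^ 2 ≤
      costN n (((Ls 1).length * (Ls 2).length : ℕ) : ℝ) := by
  set p := prmN W n I adj with hp
  set x : ℝ := (((Ls 1).length * (Ls 2).length : ℕ) : ℝ) with hx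
  have hx0 : 0 ≤ x := Nat.cast_nonneg _
  have hxs : x = (Ls 1).length * (Ls 2).length := by rw [hx]; push_cast; ring
  have hl := lenN_posR n
  have hg1 : (1 : ℝ) ≤ grpN n := by exact_mod_cast (Nat.le_add_left 1 _ : 1 ≤ grpN n)
  have hgL : (grpN n : ℝ) ≤ 2 ^ (3 * llenN n) := by exact_mod_cast grpN_le n
  have hg0 : (0 : ℝ) < grpN n := by linarith
  have hL0 : (0 : ℝ) < 2 ^ (3 * llenN n) := by positivity
  set u : ℝ := 1 / (grpN n : ℝ) with hu
  set v : ℝ := 1 / (2 : ℝ) ^ (3 * llenN n) with hv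
  have hv0 : 0 ≤ v := by positivity
  have hvu : v ≤ u := one_div_le_one_div_of_le hg0 hgL
  have hu1 : u ≤ 1 := (div_le_one hg0).2 hg1
  have hdeg : ∀ a q, p.deg a (Ls q) ≤ (Ls q).length := fun a q => p.deg_le a _
  have hnp : (p.npairs Ls : ℝ) ≤ ∑ a ∈ Finset.range n,
      ((p.deg a (Ls 1) : ℝ) * p.deg a (Ls 2) * u ^ 2 + 3 * (x * (u * v)) + (4 * n + 1)) := by
    simp only [Prm.npairs]
    push_cast
    refine Finset.sum_le_sum fun a _ => ?_
    refine (mul_le_mul (ngroups_le _ _) (ngroups_le _ _) (Nat.cast_nonneg _) (by positivity)).trans ?_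
    rw [hxs]
    exact mul_groups_le (Nat.cast_nonneg _) (Nat.cast_nonneg _) (by exact_mod_cast hdeg a 1)
      (by exact_mod_cast hdeg a 2) (by exact_mod_cast hlen 1 (by simp))
      (by exact_mod_cast hlen 2 (by simp)) hv0 hvu hu1
  have hD : ∀ a ∈ Finset.range n, (p.deg a (Ls 1) : ℝ) * p.deg a (Ls 2) * u ^ 2 +
      3 * (x * (u * v)) + (4 * n + 1) ≤ x * rateN n + smallN n x + (4 * n + 1) := by
    intro a ha
    have hS := smallN_nonneg n hx0
    have e1 : 3 * (x * (u * v)) = x * (3 / ((grpN n : ℝ) * 2 ^ (3 * llenN n))) := by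
      rw [hu, hv]; field_simp
    have e2 : 0 ≤ x * ((256 * (llenN n : ℝ) ^ 2) ^ 2 / ((lenN n : ℝ) ^ 2 * (grpN n : ℝ) ^ 2)) := by
      positivity
    rw [rateN, mul_add, ← e1]
    rcases h with h | h
    · have h1 : x * 2 ^ (lenN n / 4) ≤ (n : ℝ) ^ 2 := by
        rw [hxs, sq]; exact_mod_cast h.le
      have h2 := le_smallN n hx0 h1
      have h3 : (p.deg a (Ls 1) : ℝ) * p.deg a (Ls 2) * u ^ 2 ≤ x := by
        have h4 : (p.deg a (Ls 1) : ℝ) * p.deg a (Ls 2) ≤ x := by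
          rw [hxs]; exact_mod_cast Nat.mul_le_mul (hdeg a 1) (hdeg a 2)
        have h5 : u ^ 2 ≤ 1 := pow_le_one₀ (by positivity) hu1
        exact (mul_le_of_le_one_right (by positivity) h5).trans h4
      linarith
    · have h1 : (p.deg a (Ls 1) : ℝ) * p.deg a (Ls 2) * (lenN n : ℝ) ^ 2 ≤
          (256 * (llenN n : ℝ) ^ 2) ^ 2 * x := by
        rw [hxs]
        have := (h a (Finset.mem_range.1 ha)).le
        have : ((p.deg a (Ls 1) * p.deg a (Ls 2) * (lenN n * lenN n) : ℕ) : ℝ) ≤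
          ((256 * (llenN n * llenN n) * (256 * (llenN n * llenN n)) *
            ((Ls 1).length * (Ls 2).length) : ℕ) : ℝ) := by exact_mod_cast this
        push_cast at this
        linarith
      have h2 : (p.deg a (Ls 1) : ℝ) * p.deg a (Ls 2) * u ^ 2 ≤
          x * ((256 * (llenN n : ℝ) ^ 2) ^ 2 / ((lenN n : ℝ) ^ 2 * (grpN n : ℝ) ^ 2)) := by
        rw [hu, mul_div_assoc', le_div_iff₀ (by positivity)]
        calc _ = (p.deg a (Ls 1) : ℝ) * p.deg a (Ls 2) * (lenN n : ℝ) ^ 2 := by field_simp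
          _ ≤ _ := by linarith
      linarith
  have hsum := hnp.trans (Finset.sum_le_sum hD)
  simp only [Finset.sum_const, Finset.card_range, nsmul_eq_mul] at hsum
  have hleaf : ((p.leafCost Ls : ℕ) : ℝ) = 4000 * (codesN n * ((grpN n : ℝ) + 1) ^ 2 +
      ((n : ℝ) + 1) ^ 2 + p.npairs Ls) := by
    simp only [Prm.leafCost]
    push_cast
    have : ((p.E : ℝ) * p.E) = codesN n := by rw [← Nat.cast_mul]; rfl
    rw [this]
    simp only [hp, prmN]
    ring
  have hc := one_le_countN n hx0
  have hb := baseN_ge n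
  have hb0 : 0 ≤ baseN n := (by positivity : (0 : ℝ) ≤ 25000 * ((n : ℝ) + 1) ^ 2).trans hb
  have hbc : baseN n ≤ baseN n * countN n x := le_mul_of_one_le_right hb0 hc
  have hn : (n : ℝ) * (4 * n + 1) ≤ 4 * ((n : ℝ) + 1) ^ 2 := by
    have : (0 : ℝ) ≤ n := Nat.cast_nonneg n
    nlinarith
  rw [hleaf, costN]
  rw [baseN] at hbc ⊢
  linarith

theorem deg_mul_le (hth : 256 * (llenN n * llenN n) * (256 * (llenN n * llenN n)) *
    ((Ls 1).length * (Ls 2).length) ≤ (prmN W n I adj).deg a (Ls 1) *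
      (prmN W n I adj).deg a (Ls 2) * (lenN n * lenN n)) :
    (256 * (llenN n : ℝ) ^ 2) ^ 2 * (((Ls 1).length : ℝ) * (Ls 2).length) ≤
      (prmN W n I adj).deg a (Ls 1) * (prmN W n I adj).deg a (Ls 2) * (lenN n : ℝ) ^ 2 := by
  have : ((256 * (llenN n * llenN n) * (256 * (llenN n * llenN n)) *
    ((Ls 1).length * (Ls 2).length) : ℕ) : ℝ) ≤ (((prmN W n I adj).deg a (Ls 1) *
      (prmN W n I adj).deg a (Ls 2) * (lenN n * lenN n) : ℕ) : ℝ) := by exact_mod_cast hth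
  push_cast at this
  linarith

/-- The assumption `h₂` says d₂/u₂ ≥ θ. Then d₂ ≤ u₂ yields the rest: θ ≤ 1, and d₁/u₁ ≥ θ² from the
bound on the product. -/
theorem smallN_dense {u₁ u₂ d₁ d₂ : ℝ} (hu₁ : 0 < u₁) (hu₂ : 0 < u₂) (hd0 : 0 ≤ d₁) (hd₁ : d₁ ≤ u₁)
    (hd₂ : d₂ ≤ u₂)
    (h : (256 * (llenN n : ℝ) ^ 2) ^ 2 * (u₁ * u₂) ≤ d₁ * d₂ * (lenN n : ℝ) ^ 2)
    (h₂ : 256 * (llenN n : ℝ) ^ 2 * u₂ ≤ d₂ * lenN n) :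
    smallN n (d₁ * (u₂ - d₂)) + smallN n ((u₁ - d₁) * u₂) ≤ smallN n (u₁ * u₂) := by
  have hl := lenN_posR n
  have hl0 : (0 : ℝ) < lenN n := by linarith
  refine smallN_split hu₁ hu₂ hd₁ hd₂ rfl ?_ ?_ ?_
  · rw [div_le_one hl0]
    have : 256 * (llenN n : ℝ) ^ 2 * u₂ ≤ lenN n * u₂ := by
      calc _ ≤ d₂ * lenN n := h₂
        _ ≤ u₂ * lenN n := by gcongr
        _ = _ := mul_comm _ _
    exact le_of_mul_le_mul_right this hu₂
  · rw [div_pow, div_mul_eq_mul_div, div_le_iff₀ (by positivity)]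
    refine le_of_mul_le_mul_right ?_ hu₂
    calc _ = (256 * (llenN n : ℝ) ^ 2) ^ 2 * (u₁ * u₂) := by ring
      _ ≤ d₁ * d₂ * (lenN n : ℝ) ^ 2 := h
      _ ≤ d₁ * u₂ * (lenN n : ℝ) ^ 2 := by gcongr
      _ = _ := by ring
  · rw [div_mul_eq_mul_div, div_le_iff₀ hl0]
    exact h₂

/-- Under a split the term in `countN` falls by at least one unit of `baseN`, which exceeds the cost
of the split; the area term does not grow because the children are disjoint; and `smallN` does not
grow by `smallN_dense`. Leaves are `leafCost_le`. -/
theorem prmN_potential (W n : ℕ) (I : ℕ → ℕ) (adj : ℕ → ℕ → Bool) :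
    Potential (prmN W n I adj) (fun x => countN n x) (fun x => costN n x) (nodesN n) := by
  have hl := lenN_posR n
  have hm := llenN_posR n
  have hl1 := lenN_pos n
  have h0 : ∀ {a b : ℕ}, a ≤ b → 2 ^ a ≤ 2 ^ b := fun h => Nat.pow_le_pow_right (by norm_num) h
  have hN := nodesN_le n
  have h1N : 2 ^ 1 ≤ 2 ^ (3 * lenN n) := h0 (by omega)
  refine ⟨fun x => one_le_countN n (Nat.cast_nonneg x), ?_, fun Ls hlen h => leafCost_le hlen h,
    ?_, ?_⟩
  · intro Ls hlen a ha hbig hdense x₁ x₂ hx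
    set p := prmN W n I adj with hp
    have hR : p.R = 2 ^ (lenN n / 4) := rfl
    have hn : (0 : ℝ) < n := by exact_mod_cast (Nat.zero_le a).trans_lt ha
    have hd₁ : p.deg a (Ls 1) ≤ (Ls 1).length := p.deg_le a _
    have hd₂ : p.deg a (Ls 2) ≤ (Ls 2).length := p.deg_le a _
    have hpos : 0 < (Ls 1).length * (Ls 2).length := by
      by_contra hc
      rw [show (Ls 1).length * (Ls 2).length = 0 by omega, zero_mul] at hbig
      have : 0 < p.n * p.n := Nat.mul_pos (Nat.zero_lt_of_lt ha) (Nat.zero_lt_of_lt ha)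
      omega
    have hs₁ : (0 : ℝ) < (Ls 1).length := by exact_mod_cast Nat.pos_of_mul_pos_right hpos
    have hs₂ : (0 : ℝ) < (Ls 2).length := by exact_mod_cast Nat.pos_of_mul_pos_left hpos
    have hdR := deg_mul_le (a := a) hdense
    have hd₁' : (p.deg a (Ls 1) : ℝ) ≤ (Ls 1).length := by exact_mod_cast hd₁
    have hd₂' : (p.deg a (Ls 2) : ℝ) ≤ (Ls 2).length := by exact_mod_cast hd₂
    rw [← hp] at hdR
    have hsplit : (x₁ : ℝ) + x₂ = (Ls 1).length * (Ls 2).length - p.deg a (Ls 1) * p.deg a (Ls 2) ∧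
        smallN n x₁ + smallN n x₂ ≤ smallN n ((Ls 1).length * (Ls 2).length) := by
      have hl0 : (0 : ℝ) < lenN n := by linarith
      unfold Prm.flag splitAreas at hx
      -- If the first fraction is below θ, the second is at least θ because their product is at
      -- least θ²; otherwise the first is at least θ and the two sides exchange roles.
      by_cases hf : p.deg a (Ls 1) * p.l < p.th * (Ls 1).length <;>
        simp only [hf, if_true, if_false, one_ne_zero, Prod.mk.injEq] at hx <;>
        obtain ⟨rfl, rfl⟩ := hx
      · push_cast [Nat.cast_sub hd₁, Nat.cast_sub hd₂]
        refine ⟨by ring, smallN_dense hs₁ hs₂ (Nat.cast_nonneg _) hd₁' hd₂' hdR ?_⟩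
        have hf' : (p.deg a (Ls 1) : ℝ) * lenN n ≤ 256 * (llenN n : ℝ) ^ 2 * (Ls 1).length := by
          have : ((p.deg a (Ls 1) * lenN n : ℕ) : ℝ) ≤
            ((256 * (llenN n * llenN n) * (Ls 1).length : ℕ) : ℝ) := by exact_mod_cast hf.le
          push_cast at this
          linarith
        have hpos' : 0 < 256 * (llenN n : ℝ) ^ 2 * (Ls 1).length := by positivity
        refine le_of_mul_le_mul_left ?_ hpos'
        calc _ = (256 * (llenN n : ℝ) ^ 2) ^ 2 * ((Ls 1).length * (Ls 2).length) := by ring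
          _ ≤ p.deg a (Ls 1) * p.deg a (Ls 2) * (lenN n : ℝ) ^ 2 := hdR
          _ = p.deg a (Ls 1) * lenN n * (p.deg a (Ls 2) * lenN n) := by ring
          _ ≤ _ := by gcongr
      · push_cast [Nat.cast_sub hd₁, Nat.cast_sub hd₂]
        refine ⟨by ring, ?_⟩
        have := smallN_dense hs₂ hs₁ (Nat.cast_nonneg _) hd₂' hd₁'
          (by rw [mul_comm ((Ls 2).length : ℝ), mul_comm (p.deg a (Ls 2) : ℝ)]; exact hdR) (by
            have : ((256 * (llenN n * llenN n) * (Ls 1).length : ℕ) : ℝ) ≤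
              ((p.deg a (Ls 1) * lenN n : ℕ) : ℝ) := by exact_mod_cast not_lt.1 hf
            push_cast at this
            linarith)
        rw [mul_comm (_ - _) (p.deg a (Ls 2) : ℝ), mul_comm ((Ls 1).length : ℝ) (_ - _),
          mul_comm ((Ls 1).length : ℝ) ((Ls 2).length : ℝ)]
        exact this
    obtain ⟨hsum, hsmall⟩ := hsplit
    set x : ℝ := (Ls 1).length * (Ls 2).length with hxdef
    set D : ℝ := p.deg a (Ls 1) * p.deg a (Ls 2) with hD
    have hcast : (((Ls 1).length * (Ls 2).length : ℕ) : ℝ) = x := by rw [hxdef]; push_cast; ring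
    have hD0 : 0 ≤ D := by positivity
    have hbigR : (n : ℝ) ^ 2 ≤ x * 2 ^ (lenN n / 4) := by
      rw [hxdef, sq]; exact_mod_cast hbig
    -- The left side has three constant units and the right side one, so the removed area `D` must
    -- be worth two. It is worth at least `th ^ 2`, since `D ≥ θ² x` and `x R ≥ n²`.
    have hcount : 1 + (countN n x₁ + countN n x₂) ≤ countN n x := by
      have e : countN n x - (1 + (countN n x₁ + countN n x₂)) =
          D * 2 ^ (lenN n / 4) * (lenN n : ℝ) ^ 2 / (n : ℝ) ^ 2 - 2 := by
        have : D = x - (x₁ + x₂) := by linarith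
        rw [this]
        simp only [countN]
        ring
      have h2 : 2 ≤ D * 2 ^ (lenN n / 4) * (lenN n : ℝ) ^ 2 / (n : ℝ) ^ 2 := by
        rw [le_div_iff₀ (by positivity)]
        have h3 : (2 : ℝ) ≤ (256 * (llenN n : ℝ) ^ 2) ^ 2 := by
          have : (1 : ℝ) ≤ (llenN n : ℝ) ^ 2 := one_le_pow₀ hm
          nlinarith
        calc 2 * (n : ℝ) ^ 2 ≤ (256 * (llenN n : ℝ) ^ 2) ^ 2 * (x * 2 ^ (lenN n / 4)) := by gcongr
          _ = (256 * (llenN n : ℝ) ^ 2) ^ 2 * x * 2 ^ (lenN n / 4) := by ring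
          _ ≤ D * (lenN n : ℝ) ^ 2 * 2 ^ (lenN n / 4) := by gcongr
          _ = _ := by ring
      linarith
    rw [hcast]
    refine ⟨hcount, ?_⟩
    have hb := baseN_ge n
    have hb0 : 0 ≤ baseN n := (by positivity : (0 : ℝ) ≤ 25000 * ((n : ℝ) + 1) ^ 2).trans hb
    have h1 : baseN n * (1 + (countN n x₁ + countN n x₂)) ≤ baseN n * countN n x := by gcongr
    have hr := rateN_nonneg n
    have h2 : (n : ℝ) * (((x₁ : ℝ) + x₂) * rateN n) ≤ n * (x * rateN n) := by
      gcongr; linarith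
    have h3 : (n : ℝ) * (smallN n x₁ + smallN n x₂) ≤ n * smallN n x := by gcongr
    have h4 : 0 ≤ ((n : ℝ) + 1) ^ 2 := by positivity
    have hpn : p.n = n := rfl
    simp only [costN, hpn]
    linarith
  · calc (nodesN n + 2) * (n + 1) ≤ 2 ^ (3 * lenN n + 2) * 2 ^ lenN n :=
          Nat.mul_le_mul (by rw [pow_add]; omega) (lt_two_pow_lenN n)
      _ = 2 ^ (4 * lenN n + 2) := by rw [← pow_add]; congr 1; ring
      _ ≤ _ := h0 (by omega)
  · have hE := prmN_EE_le W n I adj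
    calc (nodesN n + 1) * ((prmN W n I adj).E * (prmN W n I adj).E + 1) ≤
          2 ^ (3 * lenN n + 2) * 2 ^ (12 * lenN n + 1) := by
          refine Nat.mul_le_mul (by rw [pow_add]; omega) ?_
          have : 1 ≤ 2 ^ (12 * lenN n) := Nat.one_le_two_pow
          rw [pow_succ]
          omega
      _ = 2 ^ (15 * lenN n + 3) := by rw [← pow_add]; congr 1; ring
      _ ≤ _ := h0 (by omega)

end

/-! ### Asymptotics of the running time -/

/-- The running time. -/
noncomputable def timeN (n : ℕ) : ℕ := ⌈costN n ((n : ℝ) * n)⌉₊ + 600 * (n + 1)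

theorem grpN_ge (n : ℕ) : (lenN n : ℝ) / (32 * llenN n) ≤ grpN n := by
  have hm := llenN_posR n
  rw [div_le_iff₀ (by positivity)]
  have := Nat.lt_mul_div_succ (lenN n) (show 0 < 32 * llenN n by have := llenN_pos n; omega)
  have h2 : ((lenN n : ℕ) : ℝ) ≤ ((32 * llenN n * grpN n : ℕ) : ℝ) := by exact_mod_cast this.le
  push_cast at h2
  linarith

/-- With `g ≥ l / (32 m)` the first term becomes `2^16 * 2^10 * m^6 / l^4`. The second is `O(m /
l^4)` because blocks have length `2 ^ (3m) ≥ l^3`; this determines the `3` in the block length. -/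
theorem rateN_le (n : ℕ) : rateN n ≤ 2 ^ 27 * ((llenN n : ℝ) ^ 6 / (lenN n : ℝ) ^ 4) := by
  have hl := lenN_posR n
  have hm := llenN_posR n
  have hg := grpN_ge n
  have hg0 : 0 < (lenN n : ℝ) / (32 * llenN n) := by positivity
  have hL : (lenN n : ℝ) ^ 3 ≤ 2 ^ (3 * llenN n) := by
    rw [mul_comm 3, pow_mul]
    have : (lenN n : ℝ) ≤ 2 ^ llenN n := by exact_mod_cast (lenN_lt_two_pow n).le
    gcongr
  have h1 : (256 * (llenN n : ℝ) ^ 2) ^ 2 / ((lenN n : ℝ) ^ 2 * (grpN n : ℝ) ^ 2) ≤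
      2 ^ 26 * ((llenN n : ℝ) ^ 6 / (lenN n : ℝ) ^ 4) := by
    calc _ ≤ (256 * (llenN n : ℝ) ^ 2) ^ 2 /
          ((lenN n : ℝ) ^ 2 * ((lenN n : ℝ) / (32 * llenN n)) ^ 2) := by gcongr
      _ = _ := by field_simp; norm_num
  have h2 : 3 / ((grpN n : ℝ) * 2 ^ (3 * llenN n)) ≤
      2 ^ 26 * ((llenN n : ℝ) ^ 6 / (lenN n : ℝ) ^ 4) := by
    calc _ ≤ 3 / ((lenN n : ℝ) / (32 * llenN n) * (lenN n : ℝ) ^ 3) := by gcongr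
      _ = 96 * ((llenN n : ℝ) ^ 1 / (lenN n : ℝ) ^ 4) := by field_simp; norm_num
      _ ≤ _ := by gcongr <;> norm_num
  rw [rateN]
  linarith

/-- At the root the weight is `n² R^(-δ)`. The hypothesis `h` ensures δ = 16 m / l, so the exponent
of `2` is about `-4m`, and `2 ^ m ≥ l`. The factor `2` makes up for rounding in `l / 4`. -/
theorem smallN_le {n : ℕ} (hn : 0 < n) (h : 32 * llenN n ≤ lenN n) :
    smallN n ((n : ℝ) * n) ≤ 2 * (n : ℝ) ^ 2 / (lenN n : ℝ) ^ 4 := by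
  have hl := lenN_posR n
  have hm := llenN_posR n
  have hn' : (0 : ℝ) < n := by exact_mod_cast hn
  have hR : (0 : ℝ) < 2 ^ (lenN n / 4) := by positivity
  have hh : 32 * (llenN n : ℝ) ≤ lenN n := by exact_mod_cast h
  have hgain : gainN n = 16 * llenN n / lenN n := by
    refine min_eq_right ?_
    rw [div_le_iff₀ (by linarith)]
    linarith
  have e : smallN n ((n : ℝ) * n) = (n : ℝ) ^ 2 * (2 : ℝ) ^ (-((lenN n / 4 : ℕ) * gainN n)) := by
    rw [smallN, ← sq, Real.div_rpow (by positivity) hR.le, mul_div_assoc',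
      ← Real.rpow_add (by positivity), sub_add_cancel, Real.rpow_one, Real.rpow_neg (by norm_num),
      div_eq_mul_inv, Real.rpow_mul (by norm_num), Real.rpow_natCast]
  have h4 : (lenN n : ℝ) / 4 - 1 ≤ (lenN n / 4 : ℕ) := by
    have := Nat.lt_mul_div_succ (lenN n) (show 0 < 4 by norm_num)
    have h2 : ((lenN n : ℕ) : ℝ) ≤ ((4 * (lenN n / 4 + 1) : ℕ) : ℝ) := by exact_mod_cast this.le
    push_cast at h2
    linarith
  have hexp : -((lenN n / 4 : ℕ) * gainN n) ≤ 1 + -(4 * llenN n : ℝ) := by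
    have h5 : ((lenN n : ℝ) / 4 - 1) * gainN n ≤ (lenN n / 4 : ℕ) * gainN n :=
      mul_le_mul_of_nonneg_right h4 (gainN_nonneg n)
    have h6 : ((lenN n : ℝ) / 4 - 1) * gainN n = 4 * llenN n - gainN n := by
      rw [hgain]; field_simp; ring
    have := gainN_le_half n
    linarith
  have h7 : (2 : ℝ) ^ (-((lenN n / 4 : ℕ) * gainN n)) ≤ 2 / (lenN n : ℝ) ^ 4 := by
    calc (2 : ℝ) ^ (-((lenN n / 4 : ℕ) * gainN n)) ≤ (2 : ℝ) ^ (1 + -(4 * llenN n : ℝ)) :=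
          Real.rpow_le_rpow_of_exponent_le (by norm_num) hexp
      _ = 2 / (2 ^ llenN n) ^ 4 := by
          rw [Real.rpow_add (by norm_num), Real.rpow_one, Real.rpow_neg (by norm_num), ← pow_mul,
            ← Real.rpow_natCast, div_eq_mul_inv]
          congr 3
          push_cast
          ring
      _ ≤ _ := by
          have : (lenN n : ℝ) ≤ 2 ^ llenN n := by exact_mod_cast (lenN_lt_two_pow n).le
          gcongr
  rw [e, mul_comm 2, mul_div_assoc]
  gcongr

/-- In terms of `r = (2n)^(1/8)` one has `M ≤ 16 l³ r` and `R ≤ r²`, so the product is at most a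
constant times `n² r⁴ l^10`, of order `n^(5/2) l^10`. The hypothesis `h` is exactly `l^14 r⁴ ≤ n`,
which turns this into `n³ / l⁴`. -/
theorem base_mul_count_le {n : ℕ} (hn : 0 < n) (h : 2 * lenN n ^ 28 ≤ n) :
    baseN n * countN n ((n : ℝ) * n) ≤ 2 ^ 30 * (n : ℝ) ^ 3 / (lenN n : ℝ) ^ 4 := by
  have hl := lenN_posR n
  have hm := llenN_posR n
  have hn' : (1 : ℝ) ≤ n := by exact_mod_cast hn
  have h2l : (2 : ℝ) ^ lenN n ≤ 2 * n := by
    have : 2 ^ lenN n ≤ 2 * n := by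
      rw [lenN, pow_succ, mul_comm]
      exact Nat.mul_le_mul_left _ (Nat.pow_log_le_self 2 (by omega))
    exact_mod_cast this
  obtain ⟨r, hr0, hr⟩ : ∃ r : ℝ, 0 ≤ r ∧ r ^ 8 = 2 * n :=
    ⟨(2 * n : ℝ) ^ ((8 : ℕ) : ℝ)⁻¹, by positivity, Real.rpow_inv_natCast_pow (by positivity) (by norm_num)⟩
  have hr1 : 1 ≤ r := by
    by_contra hc
    have : r ^ 8 ≤ 1 := pow_le_one₀ hr0 (not_le.1 hc).le
    linarith
  have hM : (2 : ℝ) ^ ((3 * llenN n + 1) * grpN n) ≤ 16 * (lenN n : ℝ) ^ 3 * r := by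
    rw [← pow_le_pow_iff_left₀ (by positivity) (by positivity) (show 8 ≠ 0 by norm_num)]
    calc ((2 : ℝ) ^ ((3 * llenN n + 1) * grpN n)) ^ 8 = 2 ^ (8 * ((3 * llenN n + 1) * grpN n)) := by
          rw [← pow_mul, mul_comm]
      _ ≤ 2 ^ (lenN n + 8 * (3 * llenN n + 1)) := pow_le_pow_right₀ (by norm_num) (exponent_le n)
      _ = 2 ^ lenN n * ((2 ^ llenN n) ^ 3 * 2) ^ 8 := by
          rw [← pow_mul, ← pow_succ, ← pow_mul, ← pow_add]; congr 1; ring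
      _ ≤ 2 * n * ((2 * lenN n) ^ 3 * 2) ^ 8 := by
          have : (2 : ℝ) ^ llenN n ≤ 2 * lenN n := by exact_mod_cast two_pow_llenN_le n
          gcongr
      _ = (16 * (lenN n : ℝ) ^ 3 * r) ^ 8 := by rw [← hr]; ring
  have hR : (2 : ℝ) ^ (lenN n / 4) ≤ r ^ 2 := by
    rw [← pow_le_pow_iff_left₀ (by positivity) (by positivity) (show 4 ≠ 0 by norm_num)]
    calc ((2 : ℝ) ^ (lenN n / 4)) ^ 4 = 2 ^ (lenN n / 4 * 4) := by rw [← pow_mul]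
      _ ≤ 2 ^ lenN n := pow_le_pow_right₀ (by norm_num) (Nat.div_mul_le_self _ _)
      _ ≤ 2 * n := h2l
      _ = (r ^ 2) ^ 4 := by rw [← hr]; ring
  have hg : (grpN n : ℝ) + 1 ≤ 3 * lenN n := by
    have : grpN n ≤ lenN n + 1 := Nat.succ_le_succ (Nat.div_le_self _ _)
    have : (grpN n : ℝ) ≤ lenN n + 1 := by exact_mod_cast this
    linarith
  have hlr : (lenN n : ℝ) ^ 14 * r ^ 4 ≤ n := by
    rw [← pow_le_pow_iff_left₀ (by positivity) (by positivity) (show 2 ≠ 0 by norm_num)]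
    have h' : 2 * (lenN n : ℝ) ^ 28 ≤ n := by exact_mod_cast h
    calc ((lenN n : ℝ) ^ 14 * r ^ 4) ^ 2 = (lenN n : ℝ) ^ 28 * (2 * n) := by rw [← hr]; ring
      _ = 2 * (lenN n : ℝ) ^ 28 * n := by ring
      _ ≤ n * n := by gcongr
      _ = (n : ℝ) ^ 2 := by ring
  have hcodes : (codesN n : ℝ) ≤ (n * (16 * (lenN n : ℝ) ^ 3 * r)) ^ 2 := by
    rw [codesN]
    push_cast
    rw [sq]
    gcongr
  have hbase : baseN n ≤ 2 ^ 24 * ((n : ℝ) ^ 2 * (lenN n : ℝ) ^ 8 * r ^ 2) := by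
    have h1 : (codesN n : ℝ) * ((grpN n : ℝ) + 1) ^ 2 ≤
        2304 * ((n : ℝ) ^ 2 * (lenN n : ℝ) ^ 8 * r ^ 2) := by
      calc _ ≤ (n * (16 * (lenN n : ℝ) ^ 3 * r)) ^ 2 * (3 * lenN n) ^ 2 := by gcongr
        _ = _ := by ring
    have h2 : ((n : ℝ) + 1) ^ 2 ≤ 4 * ((n : ℝ) ^ 2 * (lenN n : ℝ) ^ 8 * r ^ 2) := by
      calc ((n : ℝ) + 1) ^ 2 ≤ (2 * n) ^ 2 := by gcongr; linarith
        _ = 4 * ((n : ℝ) ^ 2 * 1 * 1) := by ring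
        _ ≤ _ := by
          gcongr
          · exact one_le_pow₀ hl
          · exact one_le_pow₀ hr1
    have h3 : 0 ≤ (n : ℝ) ^ 2 * (lenN n : ℝ) ^ 8 * r ^ 2 := by positivity
    rw [baseN]
    linarith
  have hcount : countN n ((n : ℝ) * n) ≤ 2 * (r ^ 2 * (lenN n : ℝ) ^ 2) := by
    have h1 : countN n ((n : ℝ) * n) = 1 + 2 ^ (lenN n / 4) * (lenN n : ℝ) ^ 2 := by
      rw [countN]; field_simp
    have h2 : (2 : ℝ) ^ (lenN n / 4) * (lenN n : ℝ) ^ 2 ≤ r ^ 2 * (lenN n : ℝ) ^ 2 := by gcongr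
    have h3 : (1 : ℝ) ≤ r ^ 2 * (lenN n : ℝ) ^ 2 :=
      one_le_mul_of_one_le_of_one_le (one_le_pow₀ hr1) (one_le_pow₀ hl)
    linarith
  have hb0 : 0 ≤ baseN n := (by positivity : (0 : ℝ) ≤ 25000 * ((n : ℝ) + 1) ^ 2).trans (baseN_ge n)
  have hc0 : 0 ≤ countN n ((n : ℝ) * n) := zero_le_one.trans (one_le_countN n (by positivity))
  rw [le_div_iff₀ (by positivity)]
  calc baseN n * countN n ((n : ℝ) * n) * (lenN n : ℝ) ^ 4 ≤
      2 ^ 24 * ((n : ℝ) ^ 2 * (lenN n : ℝ) ^ 8 * r ^ 2) * (2 * (r ^ 2 * (lenN n : ℝ) ^ 2)) *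
        (lenN n : ℝ) ^ 4 := by gcongr
    _ = 2 ^ 25 * (n : ℝ) ^ 2 * ((lenN n : ℝ) ^ 14 * r ^ 4) := by ring
    _ ≤ 2 ^ 25 * (n : ℝ) ^ 2 * n := by gcongr
    _ ≤ 2 ^ 30 * (n : ℝ) ^ 3 := by
      have : 0 ≤ (n : ℝ) ^ 3 := by positivity
      nlinarith

theorem timeN_le {n : ℕ} (hn : 0 < n) (h₁ : 2 * lenN n ^ 28 ≤ n) (h₂ : 32 * llenN n ≤ lenN n) :
    (timeN n : ℝ) ≤ 2 ^ 40 * ((n : ℝ) ^ 3 / (lenN n : ℝ) ^ 4 * (llenN n : ℝ) ^ 6) := by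
  have hl := lenN_posR n
  have hm := llenN_posR n
  have hn' : (1 : ℝ) ≤ n := by exact_mod_cast hn
  set X := (n : ℝ) ^ 3 / (lenN n : ℝ) ^ 4 with hX
  have hX0 : 0 ≤ X := by positivity
  have hm6 : (1 : ℝ) ≤ (llenN n : ℝ) ^ 6 := one_le_pow₀ hm
  have hXm : X ≤ X * (llenN n : ℝ) ^ 6 := le_mul_of_one_le_right hX0 hm6
  have hnX : (n : ℝ) ≤ X := by
    rw [hX, le_div_iff₀ (by positivity)]
    have h3 : (lenN n : ℝ) ^ 4 ≤ (n : ℝ) ^ 2 := by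
      have h4 : (lenN n : ℝ) ^ 4 ≤ (lenN n : ℝ) ^ 28 := pow_le_pow_right₀ hl (by norm_num)
      have h5 : 2 * (lenN n : ℝ) ^ 28 ≤ n := by exact_mod_cast h₁
      have h6 : 0 ≤ (lenN n : ℝ) ^ 28 := by positivity
      nlinarith
    calc (n : ℝ) * (lenN n : ℝ) ^ 4 ≤ n * (n : ℝ) ^ 2 := by gcongr
      _ = _ := by ring
  have h3 := base_mul_count_le hn h₁
  rw [mul_div_assoc, ← hX] at h3
  have h4 : (n : ℝ) * ((n : ℝ) * n * rateN n) ≤ 2 ^ 27 * (X * (llenN n : ℝ) ^ 6) := by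
    calc _ ≤ (n : ℝ) * ((n : ℝ) * n * (2 ^ 27 * ((llenN n : ℝ) ^ 6 / (lenN n : ℝ) ^ 4))) := by
          gcongr; exact rateN_le n
      _ = _ := by rw [hX]; ring
  have h5 : (n : ℝ) * smallN n ((n : ℝ) * n) ≤ 2 * X := by
    calc _ ≤ (n : ℝ) * (2 * (n : ℝ) ^ 2 / (lenN n : ℝ) ^ 4) := by gcongr; exact smallN_le hn h₂
      _ = _ := by rw [hX]; ring
  have h6 : 0 ≤ costN n ((n : ℝ) * n) := by
    have h7 := (by positivity : (0 : ℝ) ≤ 25000 * ((n : ℝ) + 1) ^ 2).trans (baseN_ge n)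
    have h8 := one_le_countN n (x := (n : ℝ) * n) (by positivity)
    have h9 := smallN_nonneg n (x := (n : ℝ) * n) (by positivity)
    have h10 := rateN_nonneg n
    unfold costN
    positivity
  have h7 := (Nat.ceil_lt_add_one h6).le
  rw [timeN]
  push_cast
  rw [costN] at h7
  rw [costN]
  linarith

open Filter Asymptotics

theorem log_le_lenN {n : ℕ} (hn : 0 < n) : Real.log n ≤ lenN n := by
  have h : (n : ℝ) ≤ 2 ^ lenN n := by exact_mod_cast (lt_two_pow_lenN n).le
  calc Real.log n ≤ Real.log (2 ^ lenN n) := Real.log_le_log (by exact_mod_cast hn) h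
    _ = lenN n * Real.log 2 := by rw [Real.log_pow]
    _ ≤ lenN n := mul_le_of_le_one_right (Nat.cast_nonneg _) (by have := Real.log_two_lt_d9; linarith)

theorem lenN_le_log {n : ℕ} (hn : 0 < n) (h : 1 ≤ Real.log n) : (lenN n : ℝ) ≤ 3 * Real.log n := by
  have h2 : (2 : ℝ) ^ Nat.log 2 n ≤ n := by exact_mod_cast Nat.pow_log_le_self 2 (by omega)
  have h3 : Nat.log 2 n * Real.log 2 ≤ Real.log n := by
    rw [← Real.log_pow]
    exact Real.log_le_log (by positivity) h2
  have h4 := Real.log_two_gt_d9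
  have h5 : (0 : ℝ) ≤ Nat.log 2 n := Nat.cast_nonneg _
  rw [lenN]
  push_cast
  nlinarith

theorem llenN_le_loglog {n : ℕ} (hn : 0 < n) (h : 1 ≤ Real.log n) (h' : 1 ≤ Real.log (Real.log n)) :
    (llenN n : ℝ) ≤ 6 * Real.log (Real.log n) := by
  have h2 : (2 : ℝ) ^ llenN n ≤ 6 * Real.log n := by
    have : (2 : ℝ) ^ llenN n ≤ 2 * lenN n := by exact_mod_cast two_pow_llenN_le n
    have := lenN_le_log hn h
    linarith
  have h3 : llenN n * Real.log 2 ≤ Real.log 6 + Real.log (Real.log n) := by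
    rw [← Real.log_pow, ← Real.log_mul (by norm_num) (by linarith)]
    exact Real.log_le_log (by positivity) h2
  have h4 := Real.log_two_gt_d9
  have h5 : Real.log 6 ≤ 2 := by
    rw [Real.log_le_iff_le_exp (by norm_num)]
    have : Real.exp 2 = Real.exp 1 ^ 2 := by rw [← Real.exp_nat_mul]; norm_num
    have := Real.exp_one_gt_d9
    nlinarith
  have h6 : (0 : ℝ) ≤ llenN n := Nat.cast_nonneg _
  nlinarith

theorem mul_le_two_pow {m : ℕ} (h : 10 ≤ m) : 64 * m ≤ 2 ^ m := by
  induction m, h using Nat.le_induction with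
  | base => norm_num
  | succ m hm ih => rw [pow_succ]; omega

theorem llenN_le_lenN {n : ℕ} (h : 2 ^ 10 ≤ lenN n) : 32 * llenN n ≤ lenN n := by
  have h1 : 10 ≤ Nat.log 2 (lenN n) := Nat.le_log_of_pow_le (by norm_num) h
  have h2 := mul_le_two_pow (show 10 ≤ llenN n by unfold llenN; omega)
  have h3 := two_pow_llenN_le n
  omega

theorem eventually_pow_log_le (k : ℕ) {c : ℝ} (hc : 0 < c) :
    ∀ᶠ n : ℕ in atTop, Real.log n ^ k ≤ c * n := by
  have h := ((Real.isLittleO_pow_log_id_atTop (n := k)).comp_tendsto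
    tendsto_natCast_atTop_atTop).bound hc
  filter_upwards [h] with n hn
  simp only [Function.comp_apply, id_eq, Real.norm_eq_abs, Nat.abs_cast] at hn
  exact (le_abs_self _).trans hn

/-- The exponent `6` is that of `m` in `rateN_le`. Eventually `n³ / log⁴ n ≥ n`, so the iterated
logarithm of the bound is at least `log (log n)`, which dominates `m` up to a constant factor. -/
theorem hatO_timeN : HatO timeN (fun n => (n : ℝ) ^ 3 / Real.log n ^ 4) := by
  refine ⟨6, ?_⟩
  have hlog : Tendsto (fun n : ℕ => Real.log n) atTop atTop :=
    Real.tendsto_log_atTop.comp tendsto_natCast_atTop_atTop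
  have hloglog : Tendsto (fun n : ℕ => Real.log (Real.log n)) atTop atTop :=
    Real.tendsto_log_atTop.comp hlog
  refine IsBigO.of_bound (2 ^ 40 * 6 ^ 6) ?_
  filter_upwards [eventually_gt_atTop 0, hlog.eventually_ge_atTop (2 ^ 10),
    hloglog.eventually_ge_atTop 1, eventually_pow_log_le 28 (c := (2 * 3 ^ 28)⁻¹) (by positivity),
    eventually_pow_log_le 2 one_pos] with n hn hl hll h28 h2
  have hn' : (1 : ℝ) ≤ n := by exact_mod_cast hn
  have hl1 : 1 ≤ Real.log n := le_trans (by norm_num) hl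
  have hln := log_le_lenN hn
  have hnl := lenN_le_log hn hl1
  have hml := llenN_le_loglog hn hl1 hll
  have hlen : 2 ^ 10 ≤ lenN n := by exact_mod_cast hl.trans hln
  have h28' : 2 * lenN n ^ 28 ≤ n := by
    have : 2 * (lenN n : ℝ) ^ 28 ≤ n := by
      calc 2 * (lenN n : ℝ) ^ 28 ≤ 2 * (3 * Real.log n) ^ 28 := by gcongr
        _ = 2 * 3 ^ 28 * Real.log n ^ 28 := by ring
        _ ≤ 2 * 3 ^ 28 * ((2 * 3 ^ 28)⁻¹ * n) := by gcongr
        _ = n := by field_simp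
    exact_mod_cast this
  have hT := timeN_le hn h28' (llenN_le_lenN hlen)
  have hf : (n : ℝ) ≤ (n : ℝ) ^ 3 / Real.log n ^ 4 := by
    rw [le_div_iff₀ (by positivity)]
    rw [one_mul] at h2
    calc (n : ℝ) * Real.log n ^ 4 = n * (Real.log n ^ 2) ^ 2 := by ring
      _ ≤ n * (n : ℝ) ^ 2 := by gcongr
      _ = _ := by ring
  have hlf : Real.log (Real.log n) ≤ Real.log (Real.log ((n : ℝ) ^ 3 / Real.log n ^ 4)) :=
    Real.log_le_log (by linarith) (Real.log_le_log (by linarith) hf)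
  have hbound : (n : ℝ) ^ 3 / (lenN n : ℝ) ^ 4 * (llenN n : ℝ) ^ 6 ≤
      (n : ℝ) ^ 3 / Real.log n ^ 4 *
        (6 * Real.log (Real.log ((n : ℝ) ^ 3 / Real.log n ^ 4))) ^ 6 := by
    have : (llenN n : ℝ) ≤ 6 * Real.log (Real.log ((n : ℝ) ^ 3 / Real.log n ^ 4)) := by linarith
    have : 0 < Real.log n := by linarith
    gcongr
  rw [Real.norm_of_nonneg (Nat.cast_nonneg _), Real.norm_of_nonneg (by
    have : 0 ≤ Real.log (Real.log ((n : ℝ) ^ 3 / Real.log n ^ 4)) := by linarith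
    have : 0 < Real.log n := by linarith
    positivity)]
  calc (timeN n : ℝ) ≤ _ := hT
    _ ≤ 2 ^ 40 * ((n : ℝ) ^ 3 / Real.log n ^ 4 *
        (6 * Real.log (Real.log ((n : ℝ) ^ 3 / Real.log n ^ 4))) ^ 6) := by gcongr
    _ = _ := by ring

end HL

theorem theorem1 :
    ∃ (P : WordRAM.Cmd) (κ : ℕ) (T : ℕ → ℕ),
      HatO T (fun n => (n : ℝ) ^ 3 / Real.log n ^ 4) ∧
      ∀ (n w : ℕ) (G : SimpleGraph (Fin n)) (part : G.Coloring (Fin 3)),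
        κ * (Nat.log 2 n + 1) ≤ w →
        ∃ s : WordRAM.State,
          WordRAM.HaltsWithin w P (tripartiteInput G part) (T n) s ∧
          ((∃ a b c : Fin n, G.Adj a b ∧ G.Adj a c ∧ G.Adj b c) → s.reg 0 = 1) ∧
          ((¬ ∃ a b c : Fin n, G.Adj a b ∧ G.Adj a c ∧ G.Adj b c) → s.reg 0 = 0) ∧
          CombinatoriallyJustified G part s (T n) := by
  refine ⟨HL.machine, 100, HL.timeN, HL.hatO_timeN, fun n w G part hw => ?_⟩
  refine HL.machine_correct G part hw (HL.prmN_potential _ n _ _)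
    (fun x hx => HL.countN_le_nodesN (by exact_mod_cast hx)) (fun x hx => ?_)
  have h1 : HL.costN n x ≤ HL.costN n ((n : ℝ) * n) :=
    HL.costN_mono n (Nat.cast_nonneg x) (by exact_mod_cast hx)
  have h2 := Nat.le_ceil (HL.costN n ((n : ℝ) * n))
  rw [HL.timeN]
  push_cast
  linarith
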